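/- Let $K$ be a field, let $q,Q\in K^\times$, and let $n,d\ge 0$ be integers. Let $I(n)=[-r,r]\cap\mathbb Z$ if $n=2r+1$ and $I(n)=([-r,r]\cap\mathbb Z)\setminus\{0\}$ if $n=2r$, and let $V=V(n)$ be the $K$-vector space with basis $\{v_i\mid i\in I(n)\}$, so that $V^{\otimes d}$ has the basis $v_\mu=v_{\mu_1}\otimes\cdots\otimes v_{\mu_d}$, $\mu\in I(n)^d$. Let $\mathcal H^{\mathrm B}_{Q,q}(d)$ be the $K$-algebra generated by $T_0,\dots,T_{d-1}$ subject to $T_iT_{i+1}T_i=T_{i+1}T_iT_{i+1}$ $(1\le i\le d-2)$, $(T_0T_1)^2=(T_1T_0)^2$, $T_iT_j=T_jT_i$ $(|i-j|>1)$, $T_0^2=(Q^{-1}-Q)T_0+1$ and $T_i^2=(q^{-1}-q)T_i+1$ $(1\le i\le d-1)$, and let $\mathcal H^{\mathrm A}_q(\Sigma_d)$ be the $K$-algebra generated by $T_1,\dots,T_{d-1}$ subject to those of the relations that do not involve $T_0$. For $1\le t\le d-1$ let $\mu\cdot s_t$ be $\mu$ with the entries $\mu_t,\mu_{t+1}$ interchanged,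 and let $\mu\cdot s_0=(-\mu_1,\mu_2,\dots,\mu_d)$. Then $\mathcal H^{\mathrm B}_{Q,q}(d)$ acts on $V^{\otimes d}$ from the right by \[ v_\mu T_t=\begin{cases} v_{\mu\cdot s_t}&\mu_t<\mu_{t+1},\\ q^{-1}v_{\mu\cdot s_t}&\mu_t=\mu_{t+1},\\ v_{\mu\cdot s_t}+(q^{-1}-q)v_\mu&\mu_t>\mu_{t+1},\end{cases} \qquad v_\mu T_0=\begin{cases} v_{\mu\cdot s_0}&0<\mu_1,\\ Q^{-1}v_{\mu\cdot s_0}&0=\mu_1,\\ v_{\mu\cdot s_0}+(Q^{-1}-Q)v_\mu&0>\mu_1,\end{cases} \] and $\mathcal H^{\mathrm A}_q(\Sigma_d)$ acts by the formulas for $T_1,\dots,T_{d-1}$. Put \[ S^{\mathrm A}_q(n,d)=\mathrm{End}_{\mathcal H^{\mathrm A}_q(\Sigma_d)}(V(n)^{\otimes d}),\qquad S^{\mathrm B}_{Q,q}(n,d)=\mathrm{End}_{\mathcal H^{\mathrm B}_{Q,q}(d)}(V(n)^{\otimes d}). \] Suppose that \[ f^{\mathrm B}_d(Q,q)=\prod_{i=1-d}^{d-1}\left(Q^{-2}+q^{2i}\right)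 \] is invertible in $K$. Then there is an isomorphism of $K$-algebras \[ S^{\mathrm B}_{Q,q}(n,d)\;\cong\;\bigoplus_{i=0}^{d} S^{\mathrm A}_q(\lceil n/2\rceil,i)\otimes_K S^{\mathrm A}_q(\lfloor n/2\rfloor,d-i). \] -/

import Mathlib

open scoped TensorProduct

noncomputable section

namespace QSchur

/-- The index set `I(n)`: the integers in `[-r, r]` if `n = 2r + 1`, and the nonzero integers in
`[-r, r]` if `n = 2r`. -/
def I (n : ℕ) : Finset ℤ :=
  (Finset.Icc (-((n / 2 : ℕ) : ℤ)) ((n / 2 : ℕ) : ℤ)).filter fun i => Even n → i ≠ 0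

/-- The involution `i ↦ -i` of `I(n)`. -/
def neg {n : ℕ} (i : I n) : I n :=
  ⟨-i.1, by
    have h := i.2
    simp only [I, Finset.mem_filter, Finset.mem_Icc] at h ⊢
    exact ⟨⟨by omega, by omega⟩, fun hn h0 => h.2 hn (by omega)⟩⟩

@[simp] theorem coe_neg {n : ℕ} (i : I n) : (neg i : ℤ) = -(i : ℤ) := rfl

@[simp] theorem neg_neg {n : ℕ} (i : I n) : neg (neg i) = i := Subtype.ext (by simp)

section TensorSpace

variable (K : Type*) [Field K] (n d : ℕ)

/-- The tensor space `V^{⊗ d}`, where `V = V(n)` is the vector space with basis indexed by `I(n)`. -/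
abbrev TensorSpace : Type _ := PiTensorProduct K fun _ : Fin d => (I n → K)

/-- The basis `v_μ = v_{μ_1} ⊗ ⋯ ⊗ v_{μ_d}`, `μ ∈ I(n)^d`, of `V^{⊗ d}`. -/
def v : Module.Basis (Fin d → I n) K (TensorSpace K n d) :=
  Basis.piTensorProduct fun _ => Pi.basisFun K (I n)

variable {K n d}

/-- The operator that acts on the (distinct) tensor positions `a`, `b` as `T_t` acts on the
positions `t`, `t + 1`. -/
def swapOp (q : Kˣ) (a b : Fin d) : Module.End K (TensorSpace K n d) :=
  (v K n d).constr K fun μ =>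
    if (μ a : ℤ) < μ b then v K n d (μ ∘ Equiv.swap a b)
    else if (μ a : ℤ) = μ b then (q : K)⁻¹ • v K n d (μ ∘ Equiv.swap a b)
    else v K n d (μ ∘ Equiv.swap a b) + ((q : K)⁻¹ - q) • v K n d μ

/-- The operator that acts on the tensor position `a` as `T_0` acts on the first position. -/
def signOp (Q : Kˣ) (a : Fin d) : Module.End K (TensorSpace K n d) :=
  (v K n d).constr K fun μ =>
    if 0 < (μ a : ℤ) then v K n d (Function.update μ a (neg (μ a)))
    else if 0 = (μ a : ℤ) then (Q : K)⁻¹ • v K n d (Function.update μ a (neg (μ a)))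
    else v K n d (Function.update μ a (neg (μ a))) + ((Q : K)⁻¹ - Q) • v K n d μ

theorem swapOp_lt (q : Kˣ) (a b : Fin d) (μ : Fin d → I n) (h : (μ a : ℤ) < μ b) :
    swapOp q a b (v K n d μ) = v K n d (μ ∘ Equiv.swap a b) := by
  rw [swapOp, Module.Basis.constr_basis, if_pos h]

theorem swapOp_eq (q : Kˣ) (a b : Fin d) (μ : Fin d → I n) (h : (μ a : ℤ) = μ b) :
    swapOp q a b (v K n d μ) = (q : K)⁻¹ • v K n d (μ ∘ Equiv.swap a b) := by
  rw [swapOp, Module.Basis.constr_basis, if_neg (by omega), if_pos h]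

theorem swapOp_gt (q : Kˣ) (a b : Fin d) (μ : Fin d → I n) (h : (μ b : ℤ) < μ a) :
    swapOp q a b (v K n d μ) =
      v K n d (μ ∘ Equiv.swap a b) + ((q : K)⁻¹ - q) • v K n d μ := by
  rw [swapOp, Module.Basis.constr_basis, if_neg (by omega), if_neg (by omega)]

theorem signOp_pos (Q : Kˣ) (a : Fin d) (μ : Fin d → I n) (h : 0 < (μ a : ℤ)) :
    signOp Q a (v K n d μ) = v K n d (Function.update μ a (neg (μ a))) := by
  rw [signOp, Module.Basis.constr_basis, if_pos h]

theorem signOp_zero (Q : Kˣ) (a : Fin d) (μ : Fin d → I n) (h : (μ a : ℤ) = 0) :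
    signOp Q a (v K n d μ) = (Q : K)⁻¹ • v K n d (Function.update μ a (neg (μ a))) := by
  rw [signOp, Module.Basis.constr_basis, if_neg (by omega), if_pos h.symm]

theorem signOp_neg (Q : Kˣ) (a : Fin d) (μ : Fin d → I n) (h : (μ a : ℤ) < 0) :
    signOp Q a (v K n d μ) =
      v K n d (Function.update μ a (neg (μ a))) + ((Q : K)⁻¹ - Q) • v K n d μ := by
  rw [signOp, Module.Basis.constr_basis, if_neg (by omega), if_neg (by omega)]

/-! The operators satisfy the defining relations of the Hecke algebras. -/

theorem swapOp_sq (q : Kˣ) (a b : Fin d) :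
    swapOp (n := n) q a b * swapOp q a b = ((q : K)⁻¹ - q) • swapOp q a b + 1 := by
  refine (v K n d).ext fun μ => ?_
  have hs : (μ ∘ Equiv.swap a b) ∘ Equiv.swap a b = μ := by
    funext i; simp
  have hq : (q : K) ≠ 0 := q.ne_zero
  simp only [Module.End.mul_apply, LinearMap.add_apply, LinearMap.smul_apply, Module.End.one_apply]
  rcases lt_trichotomy (μ a : ℤ) (μ b) with h | h | h
  · rw [swapOp_lt _ _ _ _ h, swapOp_gt _ _ _ _ (by simpa using h), hs]
    module
  · rw [swapOp_eq _ _ _ _ h, map_smul, swapOp_eq _ _ _ _ (by simpa using h.symm), hs]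
    have h2 : μ ∘ Equiv.swap a b = μ := by
      funext i
      have h' : μ a = μ b := Subtype.ext h
      simp only [Function.comp, Equiv.swap_apply_def]
      split_ifs <;> simp_all
    rw [h2]
    match_scalars
    field_simp
    ring
  · rw [swapOp_gt _ _ _ _ h, map_add, map_smul, swapOp_lt _ _ _ _ (by simpa using h),
      swapOp_gt _ _ _ _ h, hs]
    module

theorem signOp_sq (Q : Kˣ) (a : Fin d) :
    signOp (n := n) Q a * signOp Q a = ((Q : K)⁻¹ - Q) • signOp Q a + 1 := by
  refine (v K n d).ext fun μ => ?_
  have hQ : (Q : K) ≠ 0 := Q.ne_zero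
  simp only [Module.End.mul_apply, LinearMap.add_apply, LinearMap.smul_apply, Module.End.one_apply]
  rcases lt_trichotomy 0 (μ a : ℤ) with h | h | h
  · rw [signOp_pos _ _ _ h, signOp_neg _ _ _ (by simpa using h)]
    simp
    module
  · have h2 : neg (μ a) = μ a := Subtype.ext (by simp; omega)
    rw [signOp_zero _ _ _ h.symm, h2, Function.update_eq_self, map_smul, signOp_zero _ _ _ h.symm,
      h2, Function.update_eq_self]
    match_scalars
    field_simp
    ring
  · rw [signOp_neg _ _ _ h, map_add, map_smul, signOp_pos _ _ _ (by simpa using h),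
      signOp_neg _ _ _ h]
    simp
    module

theorem swapOp_comm (q : Kˣ) (a b c e : Fin d) (hac : a ≠ c) (hae : a ≠ e) (hbc : b ≠ c)
    (hbe : b ≠ e) :
    swapOp (n := n) q a b * swapOp q c e = swapOp q c e * swapOp q a b := by
  refine (v K n d).ext fun μ => ?_
  have hs : (μ ∘ Equiv.swap a b) ∘ Equiv.swap c e = (μ ∘ Equiv.swap c e) ∘ Equiv.swap a b := by
    funext i
    simp only [Function.comp, Equiv.swap_apply_def]
    congr 1
    split_ifs <;> simp_all
  have h1 : (μ ∘ Equiv.swap a b) c = μ c := by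
    simp [Equiv.swap_apply_of_ne_of_ne hac.symm hbc.symm]
  have h2 : (μ ∘ Equiv.swap a b) e = μ e := by
    simp [Equiv.swap_apply_of_ne_of_ne hae.symm hbe.symm]
  have h3 : (μ ∘ Equiv.swap c e) a = μ a := by
    simp [Equiv.swap_apply_of_ne_of_ne hac hae]
  have h4 : (μ ∘ Equiv.swap c e) b = μ b := by
    simp [Equiv.swap_apply_of_ne_of_ne hbc hbe]
  simp only [Module.End.mul_apply]
  rcases lt_trichotomy (μ a : ℤ) (μ b) with h | h | h <;>
  rcases lt_trichotomy (μ c : ℤ) (μ e) with h' | h' | h' <;>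
  simp (disch := (try simp only [h1, h2, h3, h4]); omega) only
    [swapOp_lt, swapOp_eq, swapOp_gt, map_add, map_smul, hs] <;> module

theorem signOp_comm (q Q : Kˣ) (a b c : Fin d) (hab : a ≠ b) (hac : a ≠ c) :
    signOp (n := n) Q a * swapOp q b c = swapOp q b c * signOp Q a := by
  refine (v K n d).ext fun μ => ?_
  have h1 : (μ ∘ Equiv.swap b c) a = μ a := by
    simp [Equiv.swap_apply_of_ne_of_ne hab hac]
  have hs : Function.update (μ ∘ Equiv.swap b c) a (neg (μ a)) =
      Function.update μ a (neg (μ a)) ∘ Equiv.swap b c := by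
    funext i
    simp only [Function.comp, Equiv.swap_apply_def, Function.update_apply]
    split_ifs <;> simp_all
  have h2 : Function.update μ a (neg (μ a)) b = μ b := by simp [hab.symm]
  have h3 : Function.update μ a (neg (μ a)) c = μ c := by simp [hac.symm]
  simp only [Module.End.mul_apply]
  rcases lt_trichotomy (μ b : ℤ) (μ c) with h | h | h <;>
  rcases lt_trichotomy (μ a : ℤ) 0 with h' | h' | h' <;>
  simp (disch := (try simp only [h1, h2, h3]); omega) only
    [swapOp_lt, swapOp_eq, swapOp_gt, signOp_pos, signOp_neg, signOp_zero, map_add, map_smul,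
      h1, hs] <;> module

/-- The index `μ` with the entries at the positions `a`, `b`, `c` replaced. -/
def put3 (μ : Fin d → I n) (a b c : Fin d) (x y z : I n) : Fin d → I n :=
  fun i => if i = a then x else if i = b then y else if i = c then z else μ i

theorem swapOp_braid (q : Kˣ) (a b c : Fin d) (hab : a ≠ b) (hac : a ≠ c) (hbc : b ≠ c) :
    swapOp (n := n) q a b * swapOp q b c * swapOp q a b =
      swapOp q b c * swapOp q a b * swapOp q b c := by
  refine (v K n d).ext fun μ => ?_
  have ha : ∀ x y z, put3 μ a b c x y z a = x := by intros; simp [put3]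
  have hb : ∀ x y z, put3 μ a b c x y z b = y := by intros; simp [put3, hab.symm]
  have hc : ∀ x y z, put3 μ a b c x y z c = z := by intros; simp [put3, hac.symm, hbc.symm]
  have h1 : ∀ x y z, put3 μ a b c x y z ∘ Equiv.swap a b = put3 μ a b c y x z := by
    intros; funext i; simp only [put3, Function.comp, Equiv.swap_apply_def]
    split_ifs <;> simp_all
  have h2 : ∀ x y z, put3 μ a b c x y z ∘ Equiv.swap b c = put3 μ a b c x z y := by
    intros; funext i; simp only [put3, Function.comp, Equiv.swap_apply_def]
    split_ifs <;> simp_all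
  have hμ : μ = put3 μ a b c (μ a) (μ b) (μ c) := by
    funext i; simp only [put3]; split_ifs <;> simp_all
  rw [hμ]
  generalize μ a = x, μ b = y, μ c = z
  simp only [Module.End.mul_apply]
  rcases lt_trichotomy (x : ℤ) y with h | h | h <;>
  rcases lt_trichotomy (y : ℤ) z with h' | h' | h' <;>
  rcases lt_trichotomy (x : ℤ) z with h'' | h'' | h'' <;>
  first
  | omega
  | (simp (disch := (try simp only [ha, hb, hc]); omega) only
      [swapOp_lt, swapOp_eq, swapOp_gt, map_add, map_smul, h1, h2]
     try rw [show x = y from Subtype.ext h]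
     try rw [show y = z from Subtype.ext h']
     try rw [show x = z from Subtype.ext h'']
     first
     | done
     | module
     | (match_scalars <;> field_simp <;> ring))

theorem signOp_braid (q Q : Kˣ) (a b : Fin d) (hab : a ≠ b) :
    signOp (n := n) Q a * swapOp q a b * (signOp Q a * swapOp q a b) =
      swapOp q a b * signOp Q a * (swapOp q a b * signOp Q a) := by
  refine (v K n d).ext fun μ => ?_
  have ha : ∀ x y z, put3 μ a b b x y z a = x := by intros; simp [put3]
  have hb : ∀ x y z, put3 μ a b b x y z b = y := by intros; simp [put3, hab.symm]
  have h1 : ∀ x y, put3 μ a b b x y y ∘ Equiv.swap a b = put3 μ a b b y x x := by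
    intros; funext i; simp only [put3, Function.comp, Equiv.swap_apply_def]
    split_ifs <;> simp_all
  have h2 : ∀ x y w, Function.update (put3 μ a b b x y y) a w = put3 μ a b b w y y := by
    intros; funext i; simp only [put3, Function.update_apply]
    split_ifs <;> simp_all
  have hμ : μ = put3 μ a b b (μ a) (μ b) (μ b) := by
    funext i; simp only [put3]; split_ifs <;> simp_all
  rw [hμ]
  generalize μ a = x, μ b = y
  simp only [Module.End.mul_apply]
  rcases lt_trichotomy (x : ℤ) 0 with h | h | h <;>
  rcases lt_trichotomy (y : ℤ) 0 with h' | h' | h' <;>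
  rcases lt_trichotomy (x : ℤ) y with h'' | h'' | h'' <;>
  rcases lt_trichotomy (x : ℤ) (-y) with h3 | h3 | h3 <;>
  first
  | omega
  | (simp (disch := (try simp only [ha, hb, coe_neg]); omega) only
      [swapOp_lt, swapOp_eq, swapOp_gt, signOp_pos, signOp_neg, signOp_zero, map_add, map_smul,
        h1, h2, ha, neg_neg]
     try rw [show x = y from Subtype.ext h'']
     try rw [show x = neg y from Subtype.ext h3]
     try rw [show neg y = y from Subtype.ext (by rw [coe_neg]; omega)]
     try rw [show neg x = x from Subtype.ext (by rw [coe_neg]; omega)]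
     try simp only [neg_neg]
     first
     | done
     | module
     | (match_scalars <;> field_simp <;> ring))

end TensorSpace

section Hecke

variable {K : Type*} [Field K]

/-- The defining relations of the Hecke algebra of type `B` on the generators `T_0, …, T_{d-1}`. -/
inductive RelB (q Q : Kˣ) (d : ℕ) : FreeAlgebra K (Fin d) → FreeAlgebra K (Fin d) → Prop
  | braid (i j : Fin d) (hi : 1 ≤ i.val) (hij : j.val = i.val + 1) :
      RelB q Q d (.ι K i * .ι K j * .ι K i) (.ι K j * .ι K i * .ι K j)
  | braidZero (i j : Fin d) (hi : i.val = 0) (hj : j.val = 1) :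
      RelB q Q d ((.ι K i * .ι K j) ^ 2) ((.ι K j * .ι K i) ^ 2)
  | comm (i j : Fin d) (hij : i.val + 1 < j.val) :
      RelB q Q d (.ι K i * .ι K j) (.ι K j * .ι K i)
  | quadZero (i : Fin d) (hi : i.val = 0) :
      RelB q Q d (.ι K i ^ 2) (((Q : K)⁻¹ - Q) • .ι K i + 1)
  | quad (i : Fin d) (hi : 1 ≤ i.val) :
      RelB q Q d (.ι K i ^ 2) (((q : K)⁻¹ - q) • .ι K i + 1)

/-- The two-parameter Hecke algebra `H^B_{Q,q}(d)` of type `B`. -/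
abbrev HeckeB (q Q : Kˣ) (d : ℕ) : Type _ := RingQuot (RelB q Q d)

/-- The defining relations of the Hecke algebra of the symmetric group `Σ_d` on the generators
`T_1, …, T_{d-1}`; the generator `T_{k+1}` is indexed by `k : Fin (d - 1)`. -/
inductive RelA (q : Kˣ) (d : ℕ) :
    FreeAlgebra K (Fin (d - 1)) → FreeAlgebra K (Fin (d - 1)) → Prop
  | braid (i j : Fin (d - 1)) (hij : j.val = i.val + 1) :
      RelA q d (.ι K i * .ι K j * .ι K i) (.ι K j * .ι K i * .ι K j)
  | comm (i j : Fin (d - 1)) (hij : i.val + 1 < j.val) :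
      RelA q d (.ι K i * .ι K j) (.ι K j * .ι K i)
  | quad (i : Fin (d - 1)) :
      RelA q d (.ι K i ^ 2) (((q : K)⁻¹ - q) • .ι K i + 1)

/-- The Hecke algebra `H^A_q(Σ_d)` of the symmetric group. -/
abbrev HeckeA (q : Kˣ) (d : ℕ) : Type _ := RingQuot (RelA q d)

/-- The operator `x ↦ x T_{k+1}` on `V^{⊗ d}` (positions are counted from zero). -/
def opA (q : Kˣ) (n d : ℕ) (k : Fin (d - 1)) : Module.End K (TensorSpace K n d) :=
  swapOp q ⟨k.val, by omega⟩ ⟨k.val + 1, by omega⟩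

/-- The operator `x ↦ x T_t` on `V^{⊗ d}`, `0 ≤ t ≤ d - 1`. -/
def opB (q Q : Kˣ) (n d : ℕ) (t : Fin d) : Module.End K (TensorSpace K n d) :=
  if t.val = 0 then signOp Q t else swapOp q ⟨t.val - 1, by omega⟩ t

/-- The right action of `H^A_q(Σ_d)` on `V^{⊗ d}`, as a homomorphism to the opposite of the algebra
of linear endomorphisms. -/
def actionA (q : Kˣ) (n d : ℕ) : HeckeA q d →ₐ[K] (Module.End K (TensorSpace K n d))ᵐᵒᵖ :=
  RingQuot.liftAlgHom K ⟨FreeAlgebra.lift K fun k => MulOpposite.op (opA q n d k), by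
    intro x y h
    apply MulOpposite.unop_injective
    induction h with
    | braid i j hij =>
      obtain ⟨j, hj⟩ := j
      obtain rfl : j = i.val + 1 := hij
      simp only [map_mul, FreeAlgebra.lift_ι_apply, MulOpposite.unop_mul, MulOpposite.unop_op,
        ← mul_assoc, opA]
      apply swapOp_braid <;> simp only [ne_eq, Fin.ext_iff] <;> omega
    | comm i j hij =>
      simp only [map_mul, FreeAlgebra.lift_ι_apply, MulOpposite.unop_mul, MulOpposite.unop_op, opA]
      apply swapOp_comm <;> simp only [ne_eq, Fin.ext_iff] <;> omega
    | quad i =>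
      rw [pow_two]
      simp only [map_mul, map_add, map_smul, map_one, FreeAlgebra.lift_ι_apply,
        MulOpposite.unop_mul, MulOpposite.unop_add, MulOpposite.unop_smul, MulOpposite.unop_one,
        MulOpposite.unop_op, opA]
      apply swapOp_sq⟩

/-- The right action of `H^B_{Q,q}(d)` on `V^{⊗ d}`, as a homomorphism to the opposite of the
algebra of linear endomorphisms. -/
def actionB (q Q : Kˣ) (n d : ℕ) : HeckeB q Q d →ₐ[K] (Module.End K (TensorSpace K n d))ᵐᵒᵖ :=
  RingQuot.liftAlgHom K ⟨FreeAlgebra.lift K fun t => MulOpposite.op (opB q Q n d t), by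
    intro x y h
    apply MulOpposite.unop_injective
    induction h with
    | braid i j hi hij =>
      have hj : (⟨j.val - 1, by omega⟩ : Fin d) = i := Fin.ext (by simp; omega)
      simp only [map_mul, FreeAlgebra.lift_ι_apply, MulOpposite.unop_mul, MulOpposite.unop_op,
        ← mul_assoc, opB]
      rw [if_neg (by omega), if_neg (by omega), hj]
      apply swapOp_braid <;> simp only [ne_eq, Fin.ext_iff] <;> omega
    | braidZero i j hi hj =>
      have hj' : (⟨j.val - 1, by omega⟩ : Fin d) = i := Fin.ext (by simp; omega)
      simp only [map_mul, FreeAlgebra.lift_ι_apply, MulOpposite.unop_mul,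
        MulOpposite.unop_op, opB, pow_two]
      rw [if_pos hi, if_neg (by omega), hj']
      exact (signOp_braid q Q i j (by simp only [ne_eq, Fin.ext_iff]; omega)).symm
    | comm i j hij =>
      simp only [map_mul, FreeAlgebra.lift_ι_apply, MulOpposite.unop_mul, MulOpposite.unop_op, opB]
      rw [if_neg (show ¬ j.val = 0 by omega)]
      split_ifs with hi
      · exact (signOp_comm q Q i _ j (by simp only [ne_eq, Fin.ext_iff]; omega)
          (by simp only [ne_eq, Fin.ext_iff]; omega)).symm
      · apply swapOp_comm <;> simp only [ne_eq, Fin.ext_iff] <;> omega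
    | quadZero i hi =>
      rw [pow_two]
      simp only [map_mul, map_add, map_smul, map_one, FreeAlgebra.lift_ι_apply,
        MulOpposite.unop_mul, MulOpposite.unop_add, MulOpposite.unop_smul, MulOpposite.unop_one,
        MulOpposite.unop_op, opB, if_pos hi]
      apply signOp_sq
    | quad i hi =>
      rw [pow_two]
      simp only [map_mul, map_add, map_smul, map_one, FreeAlgebra.lift_ι_apply,
        MulOpposite.unop_mul, MulOpposite.unop_add, MulOpposite.unop_smul, MulOpposite.unop_one,
        MulOpposite.unop_op, opB, if_neg (show ¬ i.val = 0 by omega)]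
      apply swapOp_sq⟩

/-- For a right action `ρ` of a `K`-algebra `H` on `M`, written `x · h = (ρ h).unop x`, the
`K`-algebra `End_H(M)` of endomorphisms `φ` with `φ (x · h) = φ x · h`. -/
def endRight {H M : Type*} [Ring H] [Algebra K H] [AddCommGroup M] [Module K M]
    (ρ : H →ₐ[K] (Module.End K M)ᵐᵒᵖ) : Subalgebra K (Module.End K M) where
  carrier := {φ | ∀ (h : H) (x : M), φ ((ρ h).unop x) = (ρ h).unop (φ x)}
  mul_mem' := by
    intro φ ψ hφ hψ h x
    rw [Module.End.mul_apply, Module.End.mul_apply, hψ, hφ]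
  add_mem' := by
    intro φ ψ hφ hψ h x
    rw [LinearMap.add_apply, LinearMap.add_apply, hψ, hφ, map_add]
  algebraMap_mem' := by
    intro r h x
    simp [Module.algebraMap_end_apply]

/-- The `q`-Schur algebra `S^A_q(n, d) = End_{H^A_q(Σ_d)}(V^{⊗ d})` of type `A`. -/
abbrev SchurA (q : Kˣ) (n d : ℕ) : Subalgebra K (Module.End K (TensorSpace K n d)) :=
  endRight (actionA q n d)

/-- The `q`-Schur algebra `S^B_{Q,q}(n, d) = End_{H^B_{Q,q}(d)}(V^{⊗ d})` of type `B`. -/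
abbrev SchurB (q Q : Kˣ) (n d : ℕ) : Subalgebra K (Module.End K (TensorSpace K n d)) :=
  endRight (actionB q Q n d)

/-- `f^B_d(Q, q) = ∏_{i = 1 - d}^{d - 1} (Q^{-2} + q^{2i})`. -/
def fB (q Q : Kˣ) (d : ℕ) : K :=
  ∏ i ∈ Finset.Icc (1 - (d : ℤ)) ((d : ℤ) - 1), ((Q : K) ^ (-2 : ℤ) + (q : K) ^ (2 * i))

end Hecke

end QSchur

end

/-!
The Jucys–Murphy elements `L₀ = T₀`, `L_{k+1} = T_{k+1} L_k T_{k+1}` commute, and on `V^{⊗d}` their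
eigenvalues lie in the two families `Q⁻¹ q^{2c}` and `-Q q^{2c}`. The contents `c`, `c'` that occur
in different families satisfy `|c - c'| < d`, so invertibility of `f_d^B` keeps the families apart
and `V^{⊗d}` is the direct sum of its sign spaces: for `δ ∈ {+, -}^d`, the part on which the
generalized eigenvalue of `L_k` lies in the first family if `δ_k = +` and in the second if
`δ_k = -`. An endomorphism commuting with the action preserves every sign space, and invertible
intertwiners identify the sign spaces of two sequences that differ by a transposition of adjacent
opposite signs. Hence such an endomorphism is determined by its restrictions to the sign spaces of
the `d + 1` sequences `+^i -^{d-i}`, and these restrictions can be arbitrary maps commuting with the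
`T_k`, `k ≠ 0, i`.

Tensors in the nonnegative letters followed by tensors in the positive letters, projected to the
sign space of `+^i -^{d-i}`, identify it with `V(⌈n/2⌉)^{⊗i} ⊗ V(⌊n/2⌋)^{⊗(d-i)}`: these projections
generate `V^{⊗d}`, and the count `∑ (d choose i) ⌈n/2⌉^i ⌊n/2⌋^{d-i} = n^d` leaves no room for a
kernel. The restrictions then range over the commutant of a tensor product, which is the tensor
product of the commutants.
-/

noncomputable section

namespace QSchur

section Relations

variable {K A : Type*} [Field K] [Ring A] [Algebra K A]

/-- The elements `T 0, …, T (d - 1)` of an algebra satisfy the defining relations of the Hecke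
algebra of type `B`; the values `T k` with `d ≤ k` are irrelevant. -/
structure IsHeckeB (q Q : Kˣ) (d : ℕ) (T : ℕ → A) : Prop where
  quadZero : 0 < d → T 0 * T 0 = ((Q : K)⁻¹ - Q) • T 0 + 1
  quad : ∀ k, k + 1 < d → T (k + 1) * T (k + 1) = ((q : K)⁻¹ - q) • T (k + 1) + 1
  braidZero : 1 < d → T 0 * T 1 * (T 0 * T 1) = T 1 * T 0 * (T 1 * T 0)
  braid : ∀ k, k + 2 < d →
    T (k + 1) * T (k + 2) * T (k + 1) = T (k + 2) * T (k + 1) * T (k + 2)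
  comm : ∀ i j, i + 1 < j → j < d → T i * T j = T j * T i

/-- The Jucys–Murphy elements `L_k = T_k ⋯ T_1 T_0 T_1 ⋯ T_k`. -/
def jucysMurphy (T : ℕ → A) : ℕ → A
  | 0 => T 0
  | k + 1 => T (k + 1) * jucysMurphy T k * T (k + 1)

/-- The intertwiner of `L_k` and `L_{k+1}`, the type `B` analogue of the intertwiners of the affine
Hecke algebra. -/
def intertwiner (q : Kˣ) (T : ℕ → A) (k : ℕ) : A :=
  T (k + 1) * (jucysMurphy T k - jucysMurphy T (k + 1)) +
    ((q : K)⁻¹ - q) • jucysMurphy T (k + 1)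

theorem mul_intertwiners_of_braid {a b x y z : A} {c : K} (hxy : x * y = y * x)
    (hxz : x * z = z * x) (hyz : y * z = z * y) (hab : a * b * a = b * a * b)
    (ha : a * a = c • a + 1) (hb : b * b = c • b + 1) (hax : a * x = y * a - c • y)
    (hay : a * y = c • y + x * a) (haz : a * z = z * a) (hbx : b * x = x * b)
    (hby : b * y = z * b - c • z) (hbz : b * z = c • z + y * b) :
    a * ((b * (y - z) + c • z) * (a * (x - y) + c • y)) =
        (b * (y - z) + c • z) * (a * (x - y) + c • y) * b ∧
      b * ((a * (x - y) + c • y) * (b * (y - z) + c • z)) =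
        (a * (x - y) + c • y) * (b * (y - z) + c • z) * a := by
  have assoc {u w r : A} (e : u * w = r) (s : A) : u * (w * s) = r * s := by rw [← mul_assoc, e]
  have hab' : a * (b * a) = b * (a * b) := by simpa only [mul_assoc] using hab
  constructor <;>
  · simp only [mul_add, add_mul, mul_sub, sub_mul, smul_mul_assoc, mul_smul_comm, smul_add,
      smul_sub, mul_assoc, hax, hay, haz, hby, hbz, hyz, assoc hax, assoc hay, assoc haz,
      assoc hbx, assoc hby, assoc hbz, assoc hxy, assoc hxz, assoc hyz, ha, hb, hab', mul_one]
    module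

namespace IsHeckeB

variable {q Q : Kˣ} {d : ℕ} {T : ℕ → A} (h : IsHeckeB q Q d T)
include h

theorem jucysMurphy_commute_of_lt {k j : ℕ} (hkj : k + 1 < j) (hj : j < d) :
    Commute (jucysMurphy T k) (T j) := by
  induction k with
  | zero => exact h.comm 0 j hkj hj
  | succ k ih =>
    have hTT : Commute (T (k + 1)) (T j) := h.comm _ _ hkj hj
    exact (hTT.mul_left (ih (by omega))).mul_left hTT

theorem jucysMurphy_commute_of_succ {k : ℕ} (hk : k + 2 < d) :
    Commute (jucysMurphy T (k + 2)) (T (k + 1)) := by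
  have hb := h.braid k hk
  have hc : Commute (jucysMurphy T k) (T (k + 2)) := h.jucysMurphy_commute_of_lt (by omega) hk
  simp only [jucysMurphy, Commute, SemiconjBy, add_assoc, Nat.reduceAdd]
  calc T (k + 2) * (T (k + 1) * jucysMurphy T k * T (k + 1)) * T (k + 2) * T (k + 1)
      = T (k + 2) * T (k + 1) * jucysMurphy T k * (T (k + 1) * T (k + 2) * T (k + 1)) := by
        simp only [mul_assoc]
    _ = T (k + 2) * T (k + 1) * (jucysMurphy T k * T (k + 2)) * T (k + 1) * T (k + 2) := by
        rw [hb]; simp only [mul_assoc]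
    _ = (T (k + 2) * T (k + 1) * T (k + 2)) * jucysMurphy T k * T (k + 1) * T (k + 2) := by
        rw [hc.eq]; simp only [mul_assoc]
    _ = _ := by rw [← hb]; simp only [mul_assoc]

theorem jucysMurphy_commute_of_gt {k j : ℕ} (hjk : j < k) (hk : k < d) :
    Commute (jucysMurphy T k) (T j) := by
  induction k with
  | zero => omega
  | succ k ih =>
    rcases k with _ | k
    · obtain rfl : j = 0 := by omega
      have hb := h.braidZero hk
      simp only [jucysMurphy, Commute, SemiconjBy, zero_add]
      simp only [mul_assoc] at hb ⊢
      exact hb.symm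
    · obtain rfl | hj := eq_or_ne j (k + 1)
      · exact h.jucysMurphy_commute_of_succ hk
      · have hTT : Commute (T (k + 2)) (T j) := (h.comm _ _ (by omega) hk).symm
        exact (hTT.mul_left (ih (by omega) (by omega))).mul_left hTT

theorem jucysMurphy_commute {i j : ℕ} (hi : i < d) (hj : j < d) :
    Commute (jucysMurphy T i) (jucysMurphy T j) := by
  wlog hij : i ≤ j generalizing i j
  · exact (this hj hi (by omega)).symm
  obtain rfl | hij := hij.eq_or_lt
  · exact Commute.refl _
  induction i with
  | zero => exact (h.jucysMurphy_commute_of_gt hij hj).symm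
  | succ i ih =>
    have hT := (h.jucysMurphy_commute_of_gt hij hj).symm
    exact (hT.mul_left (ih (by omega) (by omega) (by omega))).mul_left hT

theorem mul_jucysMurphy {k : ℕ} (hk : k + 1 < d) :
    T (k + 1) * jucysMurphy T k =
      jucysMurphy T (k + 1) * T (k + 1) - ((q : K)⁻¹ - q) • jucysMurphy T (k + 1) := by
  simp only [jucysMurphy, mul_assoc, h.quad k hk, mul_add, mul_smul_comm, mul_one]
  abel

theorem mul_jucysMurphy_succ {k : ℕ} (hk : k + 1 < d) :
    T (k + 1) * jucysMurphy T (k + 1) =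
      ((q : K)⁻¹ - q) • jucysMurphy T (k + 1) + jucysMurphy T k * T (k + 1) := by
  simp only [jucysMurphy, ← mul_assoc, h.quad k hk, add_mul, smul_mul_assoc, one_mul]

theorem commute_jucysMurphy {k j : ℕ} (hk : k + 1 < d) (hj : j < d) (h0 : j ≠ k)
    (h1 : j ≠ k + 1) : Commute (T (k + 1)) (jucysMurphy T j) := by
  rcases lt_or_gt_of_ne h1 with h2 | h2
  · exact (h.jucysMurphy_commute_of_lt (by omega) hk).symm
  · exact (h.jucysMurphy_commute_of_gt h2 hj).symm

theorem commute_jucysMurphy_add {k : ℕ} (hk : k + 1 < d) :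
    Commute (T (k + 1)) (jucysMurphy T k + jucysMurphy T (k + 1)) := by
  rw [Commute, SemiconjBy, mul_add, h.mul_jucysMurphy hk, h.mul_jucysMurphy_succ hk, add_mul]
  abel

theorem commute_jucysMurphy_mul {k : ℕ} (hk : k + 1 < d) :
    Commute (T (k + 1)) (jucysMurphy T k * jucysMurphy T (k + 1)) := by
  rw [Commute, SemiconjBy, ← mul_assoc, h.mul_jucysMurphy hk, sub_mul, mul_assoc,
    h.mul_jucysMurphy_succ hk, mul_add, (h.jucysMurphy_commute (by omega) hk).eq, smul_mul_assoc,
    mul_smul_comm, mul_assoc]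
  abel

theorem mul_jucysMurphy_sub {k : ℕ} (hk : k + 1 < d) :
    T (k + 1) * (jucysMurphy T k - jucysMurphy T (k + 1)) =
      (jucysMurphy T (k + 1) - jucysMurphy T k) * T (k + 1) -
        (2 * ((q : K)⁻¹ - q)) • jucysMurphy T (k + 1) := by
  rw [mul_sub, h.mul_jucysMurphy hk, h.mul_jucysMurphy_succ hk, sub_mul]
  module

theorem intertwiner_eq {k : ℕ} (hk : k + 1 < d) :
    intertwiner q T k = (jucysMurphy T (k + 1) - jucysMurphy T k) * T (k + 1) -
      ((q : K)⁻¹ - q) • jucysMurphy T (k + 1) := by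
  rw [intertwiner, h.mul_jucysMurphy_sub hk]
  module

theorem intertwiner_mul_jucysMurphy {k : ℕ} (hk : k + 1 < d) :
    intertwiner q T k * jucysMurphy T k = jucysMurphy T (k + 1) * intertwiner q T k := by
  have hT := h.mul_jucysMurphy hk
  have hcomm := (h.jucysMurphy_commute (i := k) (j := k + 1) (by omega) hk).eq
  rw [intertwiner]
  generalize jucysMurphy T k = x at *
  generalize jucysMurphy T (k + 1) = y at *
  generalize T (k + 1) = t at *
  calc (t * (x - y) + ((q : K)⁻¹ - q) • y) * x
      = t * x * (x - y) + ((q : K)⁻¹ - q) • (x * y) := by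
        simp only [add_mul, mul_assoc, sub_mul, mul_sub, smul_mul_assoc, hcomm]
    _ = y * (t * (x - y) + ((q : K)⁻¹ - q) • y) := by
        rw [hT, hcomm]
        simp only [mul_add, mul_sub, sub_mul, mul_assoc, smul_mul_assoc, mul_smul_comm]
        module

theorem intertwiner_mul_jucysMurphy_succ {k : ℕ} (hk : k + 1 < d) :
    intertwiner q T k * jucysMurphy T (k + 1) = jucysMurphy T k * intertwiner q T k := by
  have hxy : Commute (jucysMurphy T k) (jucysMurphy T (k + 1)) :=
    h.jucysMurphy_commute (by omega) hk
  have hadd : Commute (intertwiner q T k) (jucysMurphy T k + jucysMurphy T (k + 1)) :=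
    ((h.commute_jucysMurphy_add hk).mul_left
      (((Commute.refl _).sub_left hxy.symm).add_right (hxy.sub_left (Commute.refl _)))).add_left
      ((hxy.symm.add_right (Commute.refl _)).smul_left _)
  have hsum := hadd.eq
  rw [mul_add, add_mul, h.intertwiner_mul_jucysMurphy hk, add_comm (jucysMurphy T k * _)] at hsum
  exact add_left_cancel hsum

theorem intertwiner_commute_jucysMurphy {k j : ℕ} (hk : k + 1 < d) (hj : j < d) (h0 : j ≠ k)
    (h1 : j ≠ k + 1) : Commute (intertwiner q T k) (jucysMurphy T j) :=
  have hk_j := h.jucysMurphy_commute (i := k) (j := j) (by omega) hj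
  have hk1_j := h.jucysMurphy_commute hk hj
  ((h.commute_jucysMurphy hk hj h0 h1).mul_left (hk_j.sub_left hk1_j)).add_left (hk1_j.smul_left _)

theorem intertwiner_mul_self {k : ℕ} (hk : k + 1 < d) :
    intertwiner q T k * intertwiner q T k =
      -((jucysMurphy T k - (q : K) ^ 2 • jucysMurphy T (k + 1)) *
        (jucysMurphy T k - ((q : K)⁻¹) ^ 2 • jucysMurphy T (k + 1))) := by
  have hy := h.mul_jucysMurphy_succ hk
  have hxy := h.mul_jucysMurphy_sub hk
  have hcomm := (h.jucysMurphy_commute (i := k) (j := k + 1) (by omega) hk).eq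
  have hquad := h.quad k hk
  nth_rw 1 [h.intertwiner_eq hk]
  rw [intertwiner]
  generalize jucysMurphy T k = x at *
  generalize jucysMurphy T (k + 1) = y at *
  generalize T (k + 1) = t at *
  have hexpand : ((y - x) * t - ((q : K)⁻¹ - q) • y) * (t * (x - y) + ((q : K)⁻¹ - q) • y) =
      (y - x) * ((t * t) * (x - y)) + ((q : K)⁻¹ - q) • ((y - x) * (t * y))
      - ((q : K)⁻¹ - q) • (y * (t * (x - y))) - ((q : K)⁻¹ - q) ^ 2 • (y * y) := by
    simp only [sub_mul, mul_add, smul_mul_assoc, mul_smul_comm, mul_assoc, smul_sub, smul_smul]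
    module
  rw [hexpand, hquad, add_mul, smul_mul_assoc, hxy, hy]
  simp only [sub_mul, mul_sub, mul_add, smul_mul_assoc, mul_smul_comm, one_mul, ← mul_assoc, hcomm]
  match_scalars <;> field_simp <;> ring

theorem mul_intertwiners {k : ℕ} (hk : k + 2 < d) :
    T (k + 1) * (intertwiner q T (k + 1) * intertwiner q T k) =
        intertwiner q T (k + 1) * intertwiner q T k * T (k + 2) ∧
      T (k + 2) * (intertwiner q T k * intertwiner q T (k + 1)) =
        intertwiner q T k * intertwiner q T (k + 1) * T (k + 1) :=
  mul_intertwiners_of_braid (h.jucysMurphy_commute (by omega) (by omega))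
    (h.jucysMurphy_commute (by omega) (by omega)) (h.jucysMurphy_commute (by omega) (by omega))
    (h.braid k hk) (h.quad k (by omega)) (h.quad (k + 1) hk) (h.mul_jucysMurphy (by omega))
    (h.mul_jucysMurphy_succ (by omega)) (h.jucysMurphy_commute_of_succ hk).eq.symm
    (h.jucysMurphy_commute_of_lt (by omega) hk).eq.symm (h.mul_jucysMurphy hk)
    (h.mul_jucysMurphy_succ hk)

theorem commute_intertwiner {k j : ℕ} (hk : k + 1 < d) (hj : j + 1 < d)
    (hkj : k + 1 < j ∨ j + 1 < k) : Commute (T (k + 1)) (intertwiner q T j) := by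
  have hTT : Commute (T (k + 1)) (T (j + 1)) := by
    rcases hkj with hkj | hkj
    · exact h.comm _ _ (by omega) hj
    · exact (h.comm _ _ (by omega) hk).symm
  have hTj := h.commute_jucysMurphy (k := k) (j := j) hk (by omega) (by omega) (by omega)
  have hTj1 := h.commute_jucysMurphy (k := k) (j := j + 1) hk hj (by omega) (by omega)
  exact (hTT.mul_right (hTj.sub_right hTj1)).add_right (hTj1.smul_right _)

theorem intertwiner_commute {k j : ℕ} (hk : k + 1 < d) (hj : j + 1 < d)
    (hkj : k + 1 < j ∨ j + 1 < k) : Commute (intertwiner q T k) (intertwiner q T j) := by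
  have hjk := h.intertwiner_commute_jucysMurphy (k := j) (j := k) hj (by omega) (by omega)
    (by omega)
  have hjk1 := h.intertwiner_commute_jucysMurphy (k := j) (j := k + 1) hj hk (by omega) (by omega)
  exact ((h.commute_intertwiner hk hj hkj).mul_left (hjk.sub_right hjk1).symm).add_left
    (hjk1.symm.smul_left _)

end IsHeckeB

end Relations

section LinearAlgebra

open Module Module.End

variable {K M : Type*} [Field K] [AddCommGroup M] [Module K M]

theorem le_map_of_injOn [FiniteDimensional K M] {f : End K M} {W : Submodule K M}
    (hmaps : ∀ w ∈ W, f w ∈ W) (hinj : ∀ w ∈ W, f w = 0 → w = 0) : W ≤ W.map f := by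
  have hinj' : Function.Injective (f.restrict hmaps) :=
    (injective_iff_map_eq_zero _).2 fun w hw =>
      Subtype.ext (hinj w w.2 (congrArg Subtype.val hw))
  intro w hw
  obtain ⟨u, hu⟩ := LinearMap.surjective_of_injective hinj' ⟨w, hw⟩
  exact ⟨u, u.2, congrArg Subtype.val hu⟩

theorem eq_zero_of_mem_iSup_maxGenEigenspace_ne {f : End K M} {a : K} {m : M}
    (hm : m ∈ ⨆ b ≠ a, f.maxGenEigenspace b) (h0 : f m = a • m) : m = 0 :=
  Submodule.disjoint_def.1 (independent_maxGenEigenspace f a) m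
    (eigenspace_le_maxGenEigenspace (mem_eigenspace_iff.2 h0)) hm

theorem eq_zero_of_mem_maxGenEigenspace {f : End K M} {a b : K} {m : M} (hab : b ≠ a)
    (hm : m ∈ f.maxGenEigenspace b) (h0 : f m = a • m) : m = 0 :=
  eq_zero_of_mem_iSup_maxGenEigenspace_ne (Submodule.mem_iSup_of_mem b
    (Submodule.mem_iSup_of_mem hab hm)) h0

theorem maxGenEigenspace_le_mul {f g : End K M} (h : Commute f g) :
    f.maxGenEigenspace 0 ≤ (f * g).maxGenEigenspace 0 := by
  intro m hm
  simp only [mem_maxGenEigenspace, zero_smul, sub_zero] at hm ⊢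
  obtain ⟨k, hk⟩ := hm
  exact ⟨k, by rw [h.mul_pow, (h.pow_pow k k).eq, mul_apply, hk, map_zero]⟩

theorem maxGenEigenspace_inf_le_add {f g : End K M} (h : Commute f g) (a b : K) :
    f.maxGenEigenspace a ⊓ g.maxGenEigenspace b ≤ (f + g).maxGenEigenspace (a + b) :=
  genEigenspace_inf_le_add f g a b ⊤ ⊤ h

theorem maxGenEigenspace_inf_le_sub_smul {f g : End K M} (h : Commute f g) (a b c : K) :
    f.maxGenEigenspace a ⊓ g.maxGenEigenspace b ≤ (f - c • g).maxGenEigenspace (a - c * b) := by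
  rw [sub_eq_add_neg f, sub_eq_add_neg a, ← neg_smul, ← neg_mul]
  exact (inf_le_inf_left _ (genEigenspace_le_smul g b (-c) ⊤)).trans
    (maxGenEigenspace_inf_le_add (h.smul_right _) a _)

theorem maxGenEigenspace_sub (f : End K M) (a : K) :
    (f - a • (1 : End K M)).maxGenEigenspace 0 = f.maxGenEigenspace a :=
  (maxGenEigenspace_eq_maxGenEigenspace_zero f a).symm

theorem maxGenEigenspace_inf_le_mul {f g : End K M} (h : Commute f g) (a b : K) :
    f.maxGenEigenspace a ⊓ g.maxGenEigenspace b ≤ (f * g).maxGenEigenspace (a * b) := by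
  have hfg : f * g - (a * b) • 1 = (f - a • 1) * g + (g - b • 1) * (a • 1) := by
    simp only [sub_mul, mul_smul_comm, smul_mul_assoc, one_mul, mul_one, smul_sub, smul_smul]
    abel
  have hone : Commute (1 : End K M) g := Commute.one_left g
  have hfa : Commute (f - a • 1) g := h.sub_left (hone.smul_left a)
  have hga : Commute (g - b • 1) (a • (1 : End K M)) := (Commute.one_right _).smul_right a
  have hgg : Commute ((f - a • 1) * g) ((g - b • 1) * (a • (1 : End K M))) :=
    ((hfa.sub_right ((Commute.one_right _).smul_right b)).mul_left
      ((Commute.refl g).sub_right (hone.symm.smul_right b))).mul_right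
      ((Commute.one_right _).smul_right a)
  rw [← maxGenEigenspace_sub (f * g), hfg, ← maxGenEigenspace_sub f, ← maxGenEigenspace_sub g]
  exact (inf_le_inf (maxGenEigenspace_le_mul hfa) (maxGenEigenspace_le_mul hga)).trans
    ((maxGenEigenspace_inf_le_add hgg 0 0).trans_eq (by rw [add_zero]))

theorem maxGenEigenspace_add_inf_mul_le {f g : End K M} (h : Commute f g) (a : K) :
    (f + g).maxGenEigenspace (a + a) ⊓ (f * g).maxGenEigenspace (a * a) ≤
      f.maxGenEigenspace a := by
  have hsq : (f - a • 1) ^ 2 = (f + g - (a + a) • 1) * f + (f * g - (a * a) • 1) * (-1) := by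
    simp only [pow_two, sub_mul, mul_sub, add_mul, h.eq, mul_smul_comm, smul_mul_assoc, one_mul,
      mul_one, mul_neg]
    module
  have hff : Commute (f + g) f := (Commute.refl f).add_left h.symm
  have hgf : Commute (f * g) f := (Commute.refl f).mul_left h.symm
  have hfg : Commute (f + g) (f * g) :=
    ((Commute.refl f).mul_right h).add_left (h.symm.mul_right (Commute.refl g))
  have hone (x : End K M) (b : K) : Commute x (b • (1 : End K M)) :=
    (Commute.one_right x).smul_right b
  have hAf : Commute (f + g - (a + a) • 1) f := hff.sub_left (hone f _).symm
  have hAB : Commute (f + g - (a + a) • 1) (f * g - (a * a) • 1) :=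
    (hfg.sub_right (hone _ _)).sub_left ((hone _ _).symm)
  have hBf : Commute (f * g - (a * a) • 1) f := hgf.sub_left (hone f _).symm
  have hneg (x : End K M) : Commute x (-1) := (Commute.one_right x).neg_right
  intro m hm
  rw [Submodule.mem_inf, ← maxGenEigenspace_sub (f + g), ← maxGenEigenspace_sub (f * g)] at hm
  have hsum := maxGenEigenspace_inf_le_add
    ((hAB.mul_left hBf.symm).mul_right (hneg _)) 0 0
    ⟨maxGenEigenspace_le_mul hAf hm.1, maxGenEigenspace_le_mul (hneg _) hm.2⟩
  rw [← hsq, add_zero, mem_maxGenEigenspace] at hsum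
  obtain ⟨k, hk⟩ := hsum
  exact (mem_maxGenEigenspace _ _ _).2
    ⟨2 * k, by simpa only [zero_smul, sub_zero, ← pow_mul] using hk⟩

theorem mem_iSup_maxGenEigenspace_of_sub_smul_mem [FiniteDimensional K M] {f : End K M} {c : K}
    {m : M} (hm : f m - c • m ∈ ⨆ μ, f.maxGenEigenspace μ) : m ∈ ⨆ μ, f.maxGenEigenspace μ := by
  have hle : ⨆ μ, f.maxGenEigenspace μ ≤
      f.maxGenEigenspace c ⊔ (⨆ μ, f.maxGenEigenspace μ).map (f - c • 1) := by
    refine iSup_le fun μ => ?_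
    obtain rfl | hμ := eq_or_ne μ c
    · exact le_sup_left
    · have hmaps : ∀ w ∈ f.maxGenEigenspace μ, (f - c • (1 : End K M)) w ∈ f.maxGenEigenspace μ :=
        fun w hw => mapsTo_maxGenEigenspace_of_comm
          ((Commute.refl f).sub_right ((Commute.one_right f).smul_right c)) μ hw
      refine (le_map_of_injOn hmaps fun w hw h0 => ?_).trans
        ((Submodule.map_mono (le_iSup _ μ)).trans le_sup_right)
      exact eq_zero_of_mem_maxGenEigenspace hμ hw (sub_eq_zero.1 h0)
  obtain ⟨u, hu, _, ⟨w, hw, rfl⟩, huw⟩ := Submodule.mem_sup.1 (hle hm)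
  have hmw : (f - c • (1 : End K M)) (m - w) = u := by
    rw [map_sub, sub_eq_iff_eq_add, huw]
    rfl
  have hmem : m - w ∈ f.maxGenEigenspace c := by
    obtain ⟨k, hk⟩ := (mem_maxGenEigenspace _ _ _).1 hu
    exact (mem_maxGenEigenspace _ _ _).2 ⟨k + 1, by rw [pow_succ, mul_apply, hmw, hk]⟩
  simpa only [sub_add_cancel] using add_mem (Submodule.mem_iSup_of_mem c hmem) hw

theorem mem_iSup_maxGenEigenspace_of_smul_sub_smul_mem [FiniteDimensional K M] {f : End K M}
    {c e : K} (he : e ≠ 0) {m : M} (hm : c • m - e • f m ∈ ⨆ μ, f.maxGenEigenspace μ) :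
    m ∈ ⨆ μ, f.maxGenEigenspace μ := by
  refine mem_iSup_maxGenEigenspace_of_sub_smul_mem (c := e⁻¹ * c) ?_
  have hm' := Submodule.smul_mem _ (-e⁻¹) hm
  rwa [smul_sub, smul_smul, smul_smul, neg_mul, neg_mul, inv_mul_cancel₀ he, neg_smul, neg_smul,
    one_smul, neg_sub_neg] at hm'

theorem apply_mem_iSup_maxGenEigenspace {f g : End K M} (h : Commute f g) {m : M}
    (hm : m ∈ ⨆ μ, f.maxGenEigenspace μ) : g m ∈ ⨆ μ, f.maxGenEigenspace μ := by
  have hle : ⨆ μ, f.maxGenEigenspace μ ≤ (⨆ μ, f.maxGenEigenspace μ).comap g :=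
    iSup_le fun μ m hm => Submodule.mem_iSup_of_mem μ (mapsTo_maxGenEigenspace_of_comm h μ hm)
  exact hle hm

theorem mapsTo_maxGenEigenspace_of_semiconj {f g φ : End K M} (h : φ * f = g * φ) {c : K} {m : M}
    (hm : m ∈ f.maxGenEigenspace c) : φ m ∈ g.maxGenEigenspace c := by
  have hφ : SemiconjBy φ (f - c • 1) (g - c • 1) := by
    rw [SemiconjBy, mul_sub, sub_mul, h, mul_smul_comm, smul_mul_assoc, mul_one, one_mul]
  obtain ⟨k, hk⟩ := (mem_maxGenEigenspace _ _ _).1 hm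
  refine (mem_maxGenEigenspace _ _ _).2 ⟨k, ?_⟩
  rw [← mul_apply, ← (hφ.pow_right k).eq, mul_apply, hk, map_zero]

theorem iSup_maxGenEigenspace_eq_top_of_mul_self [FiniteDimensional K M] {f g φ : End K M}
    {a b : K} (ha : a ≠ 0) (hb : b ≠ 0) (hfg : Commute f g) (hφ : φ * f = g * φ)
    (hφφ : φ * φ = -((f - a • g) * (f - b • g))) (hf : ⨆ μ, f.maxGenEigenspace μ = ⊤) :
    ⨆ μ, g.maxGenEigenspace μ = ⊤ := by
  set W := ⨆ μ, g.maxGenEigenspace μ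
  have hrange (m : M) : φ m ∈ W := by
    have hle : ⨆ μ, f.maxGenEigenspace μ ≤ W.comap φ := iSup_le fun μ m hm =>
      Submodule.mem_iSup_of_mem μ (mapsTo_maxGenEigenspace_of_semiconj hφ hm)
    exact hle (hf ▸ Submodule.mem_top)
  have hgen (c : K) (k : ℕ) : ∀ m, ((f - c • (1 : End K M)) ^ k) m = 0 → m ∈ W := by
    induction k with
    | zero =>
      intro m hm
      rw [show m = 0 from hm]
      exact zero_mem W
    | succ k ih =>
      intro m hm
      have hstep : (f - c • (1 : End K M)) m ∈ W := ih _ (by rwa [pow_succ, mul_apply] at hm)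
      have hcomm : Commute g (f + c • 1 - (a + b) • g) :=
        (hfg.symm.add_right ((Commute.one_right g).smul_right c)).sub_right
          ((Commute.refl g).smul_right _)
      have hsplit : (c • 1 - a • g) * (c • 1 - b • g) =
          -(φ * φ) - (f + c • 1 - (a + b) • g) * (f - c • 1) := by
        rw [hφφ]
        simp only [mul_sub, sub_mul, add_mul, mul_smul_comm, smul_mul_assoc, mul_one, one_mul,
          hfg.eq]
        module
      have hmem : ((c • 1 - a • g) * (c • 1 - b • g)) m ∈ W := by
        rw [hsplit]
        exact sub_mem (neg_mem (hrange _)) (apply_mem_iSup_maxGenEigenspace hcomm hstep)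
      exact mem_iSup_maxGenEigenspace_of_smul_sub_smul_mem hb
        (mem_iSup_maxGenEigenspace_of_smul_sub_smul_mem ha hmem)
  refine top_unique (hf ▸ iSup_le fun c m hm => ?_)
  obtain ⟨k, hk⟩ := (mem_maxGenEigenspace _ _ _).1 hm
  exact hgen c k m hk

theorem iSup_maxGenEigenspace_eq_top_of_quadratic [FiniteDimensional K M] {f : End K M} {a b : K}
    (h : (f - a • 1) * (f - b • 1) = 0) : ⨆ μ, f.maxGenEigenspace μ = ⊤ := by
  refine top_unique fun m _ => mem_iSup_maxGenEigenspace_of_sub_smul_mem (c := b) ?_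
  refine mem_iSup_maxGenEigenspace_of_sub_smul_mem (c := a) ?_
  have hm : f (f m - b • m) - a • (f m - b • m) = 0 := congrArg (fun x : End K M => x m) h
  rw [hm]
  exact zero_mem _

theorem le_iSup_inf_iInf_maxGenEigenspace [FiniteDimensional K M] {ι : Type*} {f : ι → End K M}
    (hcomm : Pairwise fun i j => Commute (f i) (f j))
    (htop : ∀ i, ⨆ μ, (f i).maxGenEigenspace μ = ⊤)
    {p : Submodule K M} (hp : ∀ i, ∀ m ∈ p, f i m ∈ p) :
    p ≤ ⨆ x : ι → K, p ⊓ ⨅ i, (f i).maxGenEigenspace (x i) := by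
  have hcomm' : Pairwise fun i j => Commute ((f i).restrict (hp i)) ((f j).restrict (hp j)) :=
    fun i j hij => LinearMap.restrict_commute (hcomm hij) (hp i) (hp j)
  have htop' := iSup_iInf_maxGenEigenspace_eq_top_of_iSup_maxGenEigenspace_eq_top_of_commute _
    hcomm' fun i => genEigenspace_restrict_eq_top (hp i) (htop i)
  have hmap := congrArg (Submodule.map p.subtype) htop'
  rw [Submodule.map_iSup, Submodule.map_subtype_top] at hmap
  refine hmap.ge.trans (iSup_mono fun x => ?_)
  rintro _ ⟨m, hm, rfl⟩
  refine ⟨m.2, Submodule.mem_iInf _ |>.2 fun i => ?_⟩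
  have hmi := (Submodule.mem_iInf _).1 hm i
  rw [maxGenEigenspace, genEigenspace_restrict] at hmi
  exact hmi

end LinearAlgebra

section Signs

open Finset

variable {K : Type*} [Field K] {d : ℕ}

/-- The generalized eigenvalue of a Jucys–Murphy element on a box of content `c` of the first
(`s = true`) or second (`s = false`) component of a bipartition. -/
def contentValue (q Q : Kˣ) (s : Bool) (c : ℤ) : K :=
  (if s then (Q : K)⁻¹ else -(Q : K)) * (q : K) ^ (2 * c)

/-- The number of positions before `j` at which the sign sequence `δ` takes the value `s`. -/
def signCount (δ : Fin d → Bool) (s : Bool) (j : Fin d) : ℕ :=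
  #{i | i < j ∧ δ i = s}

/-- The sequence `x` can be the sequence of contents of a standard bitableau whose `j`-th box lies
in the component `δ j`. -/
def Admissible (q Q : Kˣ) (δ : Fin d → Bool) (x : Fin d → K) : Prop :=
  ∀ j, ∃ c : ℤ, |c| ≤ signCount δ (δ j) j ∧ x j = contentValue q Q (δ j) c

/-- The transposition of the positions `k` and `k + 1`. -/
abbrev adjSwap (k : ℕ) (hk : k + 1 < d) : Equiv.Perm (Fin d) :=
  Equiv.swap ⟨k, by omega⟩ ⟨k + 1, hk⟩

theorem adjSwap_apply_of_ne {k : ℕ} (hk : k + 1 < d) {j : Fin d} (h0 : (j : ℕ) ≠ k)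
    (h1 : (j : ℕ) ≠ k + 1) : adjSwap k hk j = j :=
  Equiv.swap_apply_of_ne_of_ne (mt (congrArg Fin.val) h0) (mt (congrArg Fin.val) h1)

theorem comp_adjSwap_of_eq {α : Type*} {f : Fin d → α} {k : ℕ} (hk : k + 1 < d)
    (h : f ⟨k, by omega⟩ = f ⟨k + 1, hk⟩) : f ∘ adjSwap k hk = f := by
  rw [adjSwap, Equiv.comp_swap_eq_update, h, Function.update_eq_self, ← h,
    Function.update_eq_self]

theorem comp_adjSwap_comp_adjSwap {α : Type*} (f : Fin d → α) {k : ℕ} (hk : k + 1 < d) :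
    (f ∘ adjSwap k hk) ∘ adjSwap k hk = f :=
  funext fun _ => congrArg f (Equiv.swap_apply_self _ _ _)

theorem signCount_congr {δ δ' : Fin d → Bool} {j : Fin d} (h : ∀ i < j, δ i = δ' i) (s : Bool) :
    signCount δ s j = signCount δ' s j :=
  congrArg card (filter_congr fun i _ => and_congr_right fun hi => by rw [h i hi])

theorem signCount_lt_signCount {δ : Fin d → Bool} {i j : Fin d} (hij : i < j) :
    signCount δ (δ i) i < signCount δ (δ i) j := by
  refine card_lt_card ⟨fun l hl => ?_, fun hsub => ?_⟩
  · simp only [mem_filter, mem_univ, true_and] at hl ⊢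
    exact ⟨hl.1.trans hij, hl.2⟩
  · exact absurd (mem_filter.1 (hsub (mem_filter.2 ⟨mem_univ i, hij, rfl⟩))).2.1 (lt_irrefl i)

theorem signCount_comp_add_signCount_lt (δ : Fin d → Bool) (σ : Equiv.Perm (Fin d)) (s : Bool)
    (j : Fin d) : signCount δ s (σ j) + signCount (δ ∘ σ) (!s) j < d := by
  set A : Finset (Fin d) := {i | i < σ j ∧ δ i = s}
  set B : Finset (Fin d) := {i | i < j ∧ δ (σ i) = !s}
  have hdisj : Disjoint A (B.map σ.toEmbedding) := by
    refine disjoint_left.2 fun i hi hi' => ?_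
    obtain ⟨l, hl, rfl⟩ := mem_map.1 hi'
    exact Bool.eq_not.1 (mem_filter.1 hl).2.2 (mem_filter.1 hi).2.2
  have hcard := card_lt_univ_of_notMem (s := A ∪ B.map σ.toEmbedding) (x := σ j) (by simp [A, B])
  rwa [card_union_of_disjoint hdisj, card_map, Fintype.card_fin] at hcard

theorem signCount_add_signCount_add_two_le {δ : Fin d → Bool} {i j : Fin d} (h : δ i ≠ δ j) :
    signCount δ (δ i) i + signCount δ (δ j) j + 2 ≤ d := by
  set A : Finset (Fin d) := {l | l < i ∧ δ l = δ i}
  set B : Finset (Fin d) := {l | l < j ∧ δ l = δ j}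
  have hAB : Disjoint A B := disjoint_filter.2 fun l _ hl hl' => h (hl.2.symm.trans hl'.2)
  have hpair : Disjoint (A ∪ B) {i, j} := by simp [A, B, h, h.symm]
  have hcard := card_le_univ (A ∪ B ∪ {i, j})
  rwa [card_union_of_disjoint hpair, card_union_of_disjoint hAB,
    card_pair fun e => h (congrArg δ e), Fintype.card_fin] at hcard

variable {q Q : Kˣ}

theorem contentValue_mul_zpow (s : Bool) (c e : ℤ) :
    (q : K) ^ (2 * e) * contentValue q Q s c = contentValue q Q s (c + e) := by
  rw [contentValue, contentValue, mul_left_comm, ← zpow_add₀ q.ne_zero, mul_add, add_comm (2 * e)]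

theorem contentValue_ne (hf : IsUnit (fB q Q d)) {s s' : Bool} (hs : s ≠ s') {c c' : ℤ}
    (hc : |c - c'| < d) : contentValue q Q s c ≠ contentValue q Q s' c' := by
  wlog h : s = true generalizing s s' c c'
  · refine (this hs.symm (by rwa [abs_sub_comm]) ?_).symm
    cases s <;> cases s' <;> simp_all
  obtain rfl := h
  obtain rfl : s' = false := by simpa using hs.symm
  intro e
  have h0 : (Q : K) ^ (-2 : ℤ) + (q : K) ^ (2 * (c' - c)) ≠ 0 :=
    prod_ne_zero_iff.1 hf.ne_zero (c' - c) (by rw [abs_lt] at hc; rw [mem_Icc]; omega)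
  apply h0
  have hQ : (Q : K) ≠ 0 := Q.ne_zero
  have hqc : (q : K) ^ (2 * c) ≠ 0 := zpow_ne_zero _ q.ne_zero
  simp only [contentValue, if_true, Bool.false_eq_true, if_false] at e
  rw [mul_sub, zpow_sub₀ q.ne_zero, zpow_neg, zpow_two]
  field_simp at e ⊢
  linear_combination e

theorem Admissible.eq_comp (hf : IsUnit (fB q Q d)) {δ δ' : Fin d → Bool} {x : Fin d → K}
    (σ : Equiv.Perm (Fin d)) (hδ : Admissible q Q δ x) (hδ' : Admissible q Q δ' (x ∘ σ)) :
    δ' = δ ∘ σ := by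
  funext j
  induction j using WellFoundedLT.induction with
  | _ j ih =>
    by_contra hne
    obtain ⟨c, hc, hxc⟩ := hδ (σ j)
    obtain ⟨c', hc', hxc'⟩ := hδ' j
    have hcount := signCount_comp_add_signCount_lt δ σ (δ (σ j)) j
    rw [Bool.eq_not_of_ne hne, signCount_congr ih, Function.comp_apply] at hc'
    refine contentValue_ne hf (Ne.symm hne) ?_ (hxc.symm.trans hxc')
    have := abs_sub c c'
    omega

theorem Admissible.unique (hf : IsUnit (fB q Q d)) {δ δ' : Fin d → Bool} {x : Fin d → K}
    (hδ : Admissible q Q δ x) (hδ' : Admissible q Q δ' x) : δ' = δ :=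
  hδ.eq_comp hf 1 hδ'

theorem Admissible.ne_zpow_mul (hf : IsUnit (fB q Q d)) {δ : Fin d → Bool} {x : Fin d → K}
    (hδ : Admissible q Q δ x) {i j : Fin d} (hij : δ i ≠ δ j) {e : ℤ} (he : |e| ≤ 1) :
    x i ≠ (q : K) ^ (2 * e) * x j := by
  obtain ⟨c, hc, hxc⟩ := hδ i
  obtain ⟨c', hc', hxc'⟩ := hδ j
  rw [hxc, hxc', contentValue_mul_zpow]
  refine contentValue_ne hf hij ?_
  have hcount := signCount_add_signCount_add_two_le hij
  rw [abs_le] at *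
  rw [abs_lt]
  omega

theorem exists_admissible {x : Fin d → K}
    (hx : ∀ k, (∃ s, x k = contentValue q Q s 0) ∨
      ∃ j < k, ∃ e : ℤ, |e| ≤ 1 ∧ x k = (q : K) ^ (2 * e) * x j) :
    ∃ δ, Admissible q Q δ x := by
  suffices hprefix : ∀ k ≤ d, ∃ δ : Fin d → Bool, ∀ j : Fin d, (j : ℕ) < k →
      ∃ c : ℤ, |c| ≤ signCount δ (δ j) j ∧ x j = contentValue q Q (δ j) c from
    (hprefix d le_rfl).imp fun δ h j => h j j.2
  intro k hk
  induction k with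
  | zero => exact ⟨fun _ => true, fun j hj => absurd hj (Nat.not_lt_zero _)⟩
  | succ k ih =>
    obtain ⟨δ, hδ⟩ := ih (by omega)
    set k' : Fin d := ⟨k, hk⟩
    suffices hs : ∃ s, ∃ c : ℤ, |c| ≤ signCount δ s k' ∧ x k' = contentValue q Q s c by
      obtain ⟨s, hs⟩ := hs
      have hagree (j : Fin d) (hj : j ≤ k') (i : Fin d) (hi : i < j) :
          Function.update δ k' s i = δ i := Function.update_of_ne (hi.trans_le hj).ne _ _
      refine ⟨Function.update δ k' s, fun j hj => ?_⟩
      obtain rfl | hjk := eq_or_ne j k'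
      · rwa [signCount_congr (hagree _ le_rfl), Function.update_self]
      · have hjk' : (j : ℕ) < k := lt_of_le_of_ne (Nat.lt_succ_iff.1 hj) fun e => hjk (Fin.ext e)
        rw [signCount_congr (hagree j hjk'.le), Function.update_of_ne hjk]
        exact hδ j hjk'
    obtain ⟨s, hs⟩ | ⟨j, hj, e, he, hxe⟩ := hx k'
    · exact ⟨s, 0, by simp, hs⟩
    · obtain ⟨c, hc, hxc⟩ := hδ j hj
      refine ⟨δ j, c + e, ?_, by rw [hxe, hxc, contentValue_mul_zpow]⟩
      have hcount := signCount_lt_signCount (δ := δ) hj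
      have := abs_add_le c e
      omega

end Signs

section SignSpaces

open Module Module.End

variable {K : Type*} [Field K] {d : ℕ} {q Q : Kˣ}
  {M : Type*} [AddCommGroup M] [Module K M] {T : ℕ → End K M}

/-- The simultaneous generalized eigenspace of the Jucys–Murphy elements for the eigenvalues `x`. -/
def weightSpace (T : ℕ → End K M) (x : Fin d → K) : Submodule K M :=
  ⨅ j : Fin d, (jucysMurphy T j).maxGenEigenspace (x j)

/-- The sum of the weight spaces whose eigenvalues are contents with components `δ`; in the
semisimple case these weights are the standard bitableaux with the entry `j` in component `δ j`. -/
def signSpace (q Q : Kˣ) (T : ℕ → End K M) (δ : Fin d → Bool) : Submodule K M :=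
  ⨆ (x) (_ : Admissible q Q δ x), weightSpace T x

theorem weightSpace_le_signSpace {δ : Fin d → Bool} {x : Fin d → K} (hx : Admissible q Q δ x) :
    weightSpace T x ≤ signSpace q Q T δ :=
  le_iSup₂_of_le x hx le_rfl

theorem weightSpace_le_maxGenEigenspace (x : Fin d → K) (j : Fin d) :
    weightSpace T x ≤ (jucysMurphy T j).maxGenEigenspace (x j) :=
  iInf_le _ j

theorem jucysMurphy_semiconj {M' : Type*} [AddCommGroup M'] [Module K M'] {T' : ℕ → End K M'}
    {φ : M →ₗ[K] M'} (h : ∀ j < d, ∀ m, φ (T j m) = T' j (φ m)) {j : ℕ} (hj : j < d) (m : M) :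
    φ (jucysMurphy T j m) = jucysMurphy T' j (φ m) := by
  induction j generalizing m with
  | zero => exact h 0 hj m
  | succ j ih => simp only [jucysMurphy, mul_apply, h _ hj, ih (by omega)]

theorem map_mem_signSpace {M' : Type*} [AddCommGroup M'] [Module K M'] {T' : ℕ → End K M'}
    {φ : M →ₗ[K] M'} (h : ∀ j < d, ∀ m, φ (T j m) = T' j (φ m)) {δ : Fin d → Bool} {m : M}
    (hm : m ∈ signSpace q Q T δ) : φ m ∈ signSpace q Q T' δ := by
  suffices hle : signSpace q Q T δ ≤ (signSpace q Q T' δ).comap φ from hle hm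
  refine iSup₂_le fun x hx m hm =>
    weightSpace_le_signSpace hx ((Submodule.mem_iInf _).2 fun j => ?_)
  obtain ⟨k, hk⟩ := (mem_maxGenEigenspace _ _ _).1 (weightSpace_le_maxGenEigenspace x j hm)
  have hpow (k : ℕ) (m : M) : φ (((jucysMurphy T j - x j • (1 : End K M)) ^ k) m) =
      ((jucysMurphy T' j - x j • (1 : End K M')) ^ k) (φ m) := by
    induction k generalizing m with
    | zero => rfl
    | succ k ih =>
      simp only [pow_succ, mul_apply, ih, LinearMap.sub_apply, LinearMap.smul_apply, one_apply,
        map_sub, map_smul, jucysMurphy_semiconj h j.2]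
  exact (mem_maxGenEigenspace _ _ _).2 ⟨k, by rw [← hpow, hk, map_zero]⟩

namespace IsHeckeB

variable (h : IsHeckeB q Q d T)
include h

theorem zero_sub_mul_zero_sub (hd : 0 < d) (s : Bool) :
    (T 0 - contentValue q Q s 0 • 1) * (T 0 - contentValue q Q (!s) 0 • 1) = 0 := by
  have hQ : (Q : K) ≠ 0 := Q.ne_zero
  simp only [sub_mul, mul_sub, h.quadZero hd, smul_mul_assoc, mul_smul_comm, one_mul, mul_one]
  cases s <;>
  · simp only [contentValue, mul_zero, zpow_zero, mul_one, Bool.not_true, Bool.not_false, if_true,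
      Bool.false_eq_true, if_false]
    match_scalars <;> field_simp <;> ring

theorem jucysMurphy_mem_weightSpace {x : Fin d → K} {m : M} (hm : m ∈ weightSpace T x) {j : ℕ}
    (hj : j < d) : jucysMurphy T j m ∈ weightSpace T x :=
  (Submodule.mem_iInf _).2 fun i => mapsTo_maxGenEigenspace_of_comm
    (h.jucysMurphy_commute i.2 hj) _ (weightSpace_le_maxGenEigenspace x i hm)

theorem jucysMurphy_mem_signSpace {δ : Fin d → Bool} {m : M} (hm : m ∈ signSpace q Q T δ) {j : ℕ}
    (hj : j < d) : jucysMurphy T j m ∈ signSpace q Q T δ := by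
  suffices hle : signSpace q Q T δ ≤ (signSpace q Q T δ).comap (jucysMurphy T j) from hle hm
  exact iSup₂_le fun x hx m hm =>
    weightSpace_le_signSpace hx (h.jucysMurphy_mem_weightSpace hm hj)

theorem intertwiner_mul_jucysMurphy_adjSwap {k : ℕ} (hk : k + 1 < d) (j : Fin d) :
    intertwiner q T k * jucysMurphy T (adjSwap k hk j) = jucysMurphy T j * intertwiner q T k := by
  obtain ⟨j, hj⟩ := j
  by_cases h0 : j = k
  · subst h0
    rw [adjSwap, Equiv.swap_apply_left]
    exact h.intertwiner_mul_jucysMurphy_succ hk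
  by_cases h1 : j = k + 1
  · subst h1
    rw [adjSwap, Equiv.swap_apply_right]
    exact h.intertwiner_mul_jucysMurphy hk
  · rw [adjSwap_apply_of_ne hk h0 h1]
    exact h.intertwiner_commute_jucysMurphy hk hj h0 h1

theorem intertwiner_mem_weightSpace {x : Fin d → K} {m : M} (hm : m ∈ weightSpace T x) {k : ℕ}
    (hk : k + 1 < d) : intertwiner q T k m ∈ weightSpace T (x ∘ adjSwap k hk) :=
  (Submodule.mem_iInf _).2 fun j => mapsTo_maxGenEigenspace_of_semiconj
    (h.intertwiner_mul_jucysMurphy_adjSwap hk j) (weightSpace_le_maxGenEigenspace x _ hm)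

theorem weightSpace_le_maxGenEigenspace_sub_smul (x : Fin d → K) (i j : Fin d) (c : K) :
    weightSpace T x ≤
      (jucysMurphy T i - c • jucysMurphy T j).maxGenEigenspace (x i - c * x j) :=
  (le_inf (weightSpace_le_maxGenEigenspace x i) (weightSpace_le_maxGenEigenspace x j)).trans
    (maxGenEigenspace_inf_le_sub_smul (h.jucysMurphy_commute i.2 j.2) _ _ c)

theorem eq_zero_of_mem_weightSpace {x : Fin d → K} {m : M} (hm : m ∈ weightSpace T x)
    {i j : Fin d} {c : K} (hx : x i ≠ c * x j)
    (h0 : (jucysMurphy T i - c • jucysMurphy T j) m = 0) : m = 0 :=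
  eq_zero_of_mem_maxGenEigenspace (sub_ne_zero.2 hx)
    (h.weightSpace_le_maxGenEigenspace_sub_smul x i j c hm) (h0.trans (zero_smul K m).symm)

theorem intertwiner_injOn_weightSpace {x : Fin d → K} {m : M} (hm : m ∈ weightSpace T x) {k : ℕ}
    (hk : k + 1 < d)
    (hx : ∀ e : ℤ, |e| ≤ 1 → x ⟨k + 1, hk⟩ ≠ (q : K) ^ (2 * e) * x ⟨k, by omega⟩)
    (h0 : intertwiner q T k m = 0) : m = 0 := by
  have hx₁ : x ⟨k, by omega⟩ ≠ (q : K) ^ 2 * x ⟨k + 1, hk⟩ := fun e =>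
    hx (-1) (by simp) (by rw [e, ← mul_assoc, ← zpow_natCast, ← zpow_add₀ q.ne_zero]; simp)
  have hx₂ : x ⟨k, by omega⟩ ≠ ((q : K)⁻¹) ^ 2 * x ⟨k + 1, hk⟩ := fun e =>
    hx 1 (by simp)
      (by rw [e, ← mul_assoc, inv_pow, ← zpow_natCast, mul_one]; simp)
  have hL := congrArg (fun f : End K M => f m) (h.intertwiner_mul_self hk)
  simp only [mul_apply, h0, map_zero, LinearMap.neg_apply] at hL
  have hm' : (jucysMurphy T k - ((q : K)⁻¹) ^ 2 • jucysMurphy T (k + 1)) m ∈ weightSpace T x :=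
    sub_mem (h.jucysMurphy_mem_weightSpace hm (by omega))
      (Submodule.smul_mem _ _ (h.jucysMurphy_mem_weightSpace hm hk))
  exact h.eq_zero_of_mem_weightSpace hm hx₂
    (h.eq_zero_of_mem_weightSpace hm' hx₁ (neg_eq_zero.1 hL.symm))

theorem exists_eq_contentValue_zero {x : Fin d → K} (hx : weightSpace T x ≠ ⊥) (hd : 0 < d) :
    ∃ s, x ⟨0, hd⟩ = contentValue q Q s 0 := by
  obtain ⟨m, hm, hm0⟩ := (Submodule.ne_bot_iff _).1 hx
  by_contra! hne
  have hcancel (s : Bool) {w : M} (hw : w ∈ weightSpace T x)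
      (h0 : (T 0 - contentValue q Q s 0 • (1 : End K M)) w = 0) : w = 0 :=
    eq_zero_of_mem_maxGenEigenspace (hne s) (weightSpace_le_maxGenEigenspace x ⟨0, hd⟩ hw)
      (sub_eq_zero.1 h0)
  have hmul := congrArg (fun f : End K M => f m) (h.zero_sub_mul_zero_sub hd true)
  refine hm0 (hcancel _ hm (hcancel _ ?_ hmul))
  exact sub_mem (h.jucysMurphy_mem_weightSpace hm hd) (Submodule.smul_mem _ _ hm)

theorem exists_eq_contentValue_or_exists_lt {k : ℕ} (hk : k < d) {x : Fin d → K}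
    (hx : weightSpace T x ≠ ⊥) : (∃ s, x ⟨k, hk⟩ = contentValue q Q s 0) ∨
      ∃ j < ⟨k, hk⟩, ∃ e : ℤ, |e| ≤ 1 ∧ x ⟨k, hk⟩ = (q : K) ^ (2 * e) * x j := by
  induction k generalizing x with
  | zero => exact Or.inl (h.exists_eq_contentValue_zero hx hk)
  | succ k ih =>
    have hkd : k < d := by omega
    by_cases hprev : ∃ e : ℤ, |e| ≤ 1 ∧ x ⟨k + 1, hk⟩ = (q : K) ^ (2 * e) * x ⟨k, hkd⟩
    · exact Or.inr ⟨⟨k, hkd⟩, Nat.lt_succ_self k, hprev⟩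
    push Not at hprev
    obtain ⟨m, hm, hm0⟩ := (Submodule.ne_bot_iff _).1 hx
    have hswap : weightSpace T (x ∘ adjSwap k hk) ≠ ⊥ :=
      (Submodule.ne_bot_iff _).2 ⟨_, h.intertwiner_mem_weightSpace hm hk,
        fun h0 => hm0 (h.intertwiner_injOn_weightSpace hm hk hprev h0)⟩
    have hxk : (x ∘ adjSwap k hk) ⟨k, hkd⟩ = x ⟨k + 1, hk⟩ :=
      congrArg x (Equiv.swap_apply_left _ _)
    rw [← hxk]
    refine (ih hkd hswap).imp_right fun ⟨j, hj, e, he, hxe⟩ =>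
      ⟨j, hj.trans (Nat.lt_succ_self k), e, he, ?_⟩
    have hjk : (j : ℕ) < k := hj
    rwa [Function.comp_apply (x := j), adjSwap_apply_of_ne hk (by omega) (by omega)] at hxe

theorem exists_admissible_of_weightSpace_ne_bot {x : Fin d → K} (hx : weightSpace T x ≠ ⊥) :
    ∃ δ, Admissible q Q δ x :=
  exists_admissible fun k => h.exists_eq_contentValue_or_exists_lt k.2 hx

theorem weightSpace_comp_adjSwap_le (hf : IsUnit (fB q Q d)) {δ : Fin d → Bool} {x : Fin d → K}
    (hx : Admissible q Q δ x) {k : ℕ} (hk : k + 1 < d) :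
    weightSpace T (x ∘ adjSwap k hk) ≤ signSpace q Q T (δ ∘ adjSwap k hk) := by
  by_cases hbot : weightSpace T (x ∘ adjSwap k hk) = ⊥
  · rw [hbot]
    exact bot_le
  · obtain ⟨δ', hδ'⟩ := h.exists_admissible_of_weightSpace_ne_bot hbot
    obtain rfl := hx.eq_comp hf _ hδ'
    exact weightSpace_le_signSpace hδ'

theorem intertwiner_mem_signSpace (hf : IsUnit (fB q Q d)) {δ : Fin d → Bool} {m : M}
    (hm : m ∈ signSpace q Q T δ) {k : ℕ} (hk : k + 1 < d) :
    intertwiner q T k m ∈ signSpace q Q T (δ ∘ adjSwap k hk) := by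
  suffices hle : signSpace q Q T δ ≤
    (signSpace q Q T (δ ∘ adjSwap k hk)).comap (intertwiner q T k) from hle hm
  exact iSup₂_le fun x hx m hm =>
    h.weightSpace_comp_adjSwap_le hf hx hk (h.intertwiner_mem_weightSpace hm hk)

theorem iSupIndep_signSpace (hf : IsUnit (fB q Q d)) :
    iSupIndep fun δ : Fin d → Bool => signSpace q Q T δ := by
  have hweight : iSupIndep fun x : Fin d → K => weightSpace T x :=
    independent_iInf_maxGenEigenspace_of_forall_mapsTo _ fun i j =>
      mapsTo_maxGenEigenspace_of_comm (h.jucysMurphy_commute j.2 i.2)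
  intro δ
  refine (hweight.disjoint_biSup_biSup (s := {x | Admissible q Q δ x})
    (t := {x | ¬ Admissible q Q δ x}) disjoint_compl_right).mono_right ?_
  refine iSup₂_le fun δ' hne => iSup₂_le fun x hx => ?_
  exact le_iSup₂_of_le (f := fun x _ => weightSpace T x) x (fun hx' => hne (hx'.unique hf hx))
    le_rfl

variable [FiniteDimensional K M]

theorem iSup_maxGenEigenspace_jucysMurphy {k : ℕ} (hk : k < d) :
    ⨆ μ, (jucysMurphy T k).maxGenEigenspace μ = ⊤ := by
  induction k with
  | zero => exact iSup_maxGenEigenspace_eq_top_of_quadratic (h.zero_sub_mul_zero_sub hk true)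
  | succ k ih =>
    exact iSup_maxGenEigenspace_eq_top_of_mul_self (pow_ne_zero 2 q.ne_zero)
      (pow_ne_zero 2 (inv_ne_zero q.ne_zero)) (h.jucysMurphy_commute (by omega) hk)
      (h.intertwiner_mul_jucysMurphy hk) (h.intertwiner_mul_self hk) (ih (by omega))

theorem le_iSup_inf_signSpace {p : Submodule K M} (hp : ∀ j < d, ∀ m ∈ p, jucysMurphy T j m ∈ p) :
    p ≤ ⨆ δ : Fin d → Bool, p ⊓ signSpace q Q T δ := by
  refine (le_iSup_inf_iInf_maxGenEigenspace (f := fun j : Fin d => jucysMurphy T j)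
    (fun i j _ => h.jucysMurphy_commute i.2 j.2)
    (fun j => h.iSup_maxGenEigenspace_jucysMurphy j.2) fun j => hp j j.2).trans
    (iSup_le fun x => ?_)
  change p ⊓ weightSpace T x ≤ _
  by_cases hx : weightSpace T x = ⊥
  · rw [hx, inf_bot_eq]
    exact bot_le
  · obtain ⟨δ, hδ⟩ := h.exists_admissible_of_weightSpace_ne_bot hx
    exact le_iSup_of_le δ (inf_le_inf_left p (weightSpace_le_signSpace hδ))

theorem iSup_signSpace : ⨆ δ : Fin d → Bool, signSpace q Q T δ = ⊤ := by
  simpa only [top_inf_eq, top_le_iff] using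
    h.le_iSup_inf_signSpace (p := ⊤) fun _ _ _ _ => Submodule.mem_top

end IsHeckeB

end SignSpaces

section SignDescents

variable {d : ℕ}

theorem comp_adjSwap_left {α : Type*} (f : Fin d → α) {k : ℕ} (hk : k + 1 < d) :
    (f ∘ adjSwap k hk) ⟨k, by omega⟩ = f ⟨k + 1, hk⟩ :=
  congrArg f (Equiv.swap_apply_left _ _)

theorem comp_adjSwap_right {α : Type*} (f : Fin d → α) {k : ℕ} (hk : k + 1 < d) :
    (f ∘ adjSwap k hk) ⟨k + 1, hk⟩ = f ⟨k, by omega⟩ :=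
  congrArg f (Equiv.swap_apply_right _ _)

theorem comp_adjSwap_of_ne {α : Type*} (f : Fin d → α) {k : ℕ} (hk : k + 1 < d) {j : Fin d}
    (h0 : (j : ℕ) ≠ k) (h1 : (j : ℕ) ≠ k + 1) : (f ∘ adjSwap k hk) j = f j :=
  congrArg f (adjSwap_apply_of_ne hk h0 h1)

theorem comp_adjSwap_comm {α : Type*} (f : Fin d → α) {k l : ℕ} (hk : k + 1 < d) (hl : l + 1 < d)
    (hkl : k + 1 < l ∨ l + 1 < k) :
    (f ∘ adjSwap k hk) ∘ adjSwap l hl = (f ∘ adjSwap l hl) ∘ adjSwap k hk := by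
  have hcomm : Commute (adjSwap k hk) (adjSwap l hl) :=
    (Equiv.Perm.disjoint_swap_swap (by simp [Fin.ext_iff]; omega)).commute
  rw [Function.comp_assoc, Function.comp_assoc, ← Equiv.Perm.coe_mul, hcomm.eq,
    Equiv.Perm.coe_mul]

/-- The sign sequence `δ` has a minus sign at `k` followed by a plus sign at `k + 1`. -/
def IsMinusPlus (δ : Fin d → Bool) (k : ℕ) : Prop :=
  ∃ hk : k + 1 < d, δ ⟨k, by omega⟩ = false ∧ δ ⟨k + 1, hk⟩ = true

/-- The sum of the positions of the plus signs of `δ`, which decreases when a plus sign is moved to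
the left. -/
def plusSum (δ : Fin d → Bool) : ℕ := ∑ j : Fin d, if δ j then (j : ℕ) else 0

theorem IsMinusPlus.comp_adjSwap {δ : Fin d → Bool} {k l : ℕ} (hk : IsMinusPlus δ k)
    (hl : l + 1 < d) (hkl : k + 1 < l ∨ l + 1 < k) : IsMinusPlus (δ ∘ adjSwap l hl) k := by
  obtain ⟨hk, h0, h1⟩ := hk
  refine ⟨hk, ?_, ?_⟩
  · rwa [comp_adjSwap_of_ne δ hl (by simp; omega) (by simp; omega)]
  · rwa [comp_adjSwap_of_ne δ hl (by simp; omega) (by simp; omega)]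

theorem IsMinusPlus.far {δ : Fin d → Bool} {k l : ℕ} (hk : IsMinusPlus δ k)
    (hl : IsMinusPlus δ l) (hkl : k ≠ l) : k + 1 < l ∨ l + 1 < k := by
  obtain ⟨_, hk0, hk1⟩ := hk
  obtain ⟨_, hl0, hl1⟩ := hl
  by_contra hnear
  obtain rfl | rfl : l = k + 1 ∨ k = l + 1 := by omega
  · simp_all
  · simp_all

theorem IsMinusPlus.ne {δ : Fin d → Bool} {k : ℕ} (h : IsMinusPlus δ k) :
    δ ⟨k, Nat.lt_of_succ_lt h.1⟩ ≠ δ ⟨k + 1, h.1⟩ := by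
  rw [h.2.1, h.2.2]
  decide

theorem isMinusPlus_or_comp_adjSwap {δ : Fin d → Bool} {k : ℕ} (hk : k + 1 < d)
    (hδ : δ ⟨k, by omega⟩ ≠ δ ⟨k + 1, hk⟩) :
    IsMinusPlus δ k ∨ IsMinusPlus (δ ∘ adjSwap k hk) k := by
  rw [IsMinusPlus, IsMinusPlus]
  simp only [comp_adjSwap_left, comp_adjSwap_right]
  cases h0 : δ ⟨k, by omega⟩ <;> cases h1 : δ ⟨k + 1, hk⟩ <;> simp_all

theorem IsMinusPlus.plusSum_lt {δ : Fin d → Bool} {k : ℕ} (h : IsMinusPlus δ k) :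
    plusSum (δ ∘ adjSwap k h.1) < plusSum δ := by
  obtain ⟨hk, h0, h1⟩ := h
  have hreindex : plusSum (δ ∘ adjSwap k hk) =
      ∑ j : Fin d, if δ j then (adjSwap k hk j : ℕ) else 0 := by
    rw [plusSum, ← Equiv.sum_comp (adjSwap k hk)]
    simp only [Function.comp_apply, Equiv.swap_apply_self]
  rw [hreindex, plusSum]
  refine Finset.sum_lt_sum (fun j _ => ?_) ⟨⟨k + 1, hk⟩, Finset.mem_univ _, ?_⟩
  · by_cases hj1 : (j : ℕ) = k + 1
    · obtain rfl : j = ⟨k + 1, hk⟩ := Fin.ext hj1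
      simp [h1]
    by_cases hj0 : (j : ℕ) = k
    · have hj : δ j = false := (congrArg δ (Fin.ext hj0)).trans h0
      simp [hj]
    · rw [adjSwap_apply_of_ne hk hj0 hj1]
  · simp [h1]

theorem antitone_or_exists_isMinusPlus (δ : Fin d → Bool) :
    Antitone δ ∨ ∃ k, IsMinusPlus δ k := by
  by_contra! hδ
  obtain ⟨hanti, hno⟩ := hδ
  apply hanti
  obtain _ | d := d
  · exact fun i => i.elim0
  · refine Fin.antitone_iff_succ_le.2 fun i hi => ?_
    by_contra h0
    exact hno i ⟨Nat.succ_lt_succ i.2, Bool.eq_false_iff.2 h0, hi⟩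

theorem not_isMinusPlus_of_antitone {δ : Fin d → Bool} (hδ : Antitone δ) :
    ¬ ∃ k, IsMinusPlus δ k := by
  rintro ⟨k, hk, h0, h1⟩
  have hle : δ ⟨k + 1, hk⟩ ≤ δ ⟨k, by omega⟩ := hδ (Fin.mk_le_mk.2 (Nat.le_succ k))
  rw [h0, h1] at hle
  exact absurd hle (by decide)

theorem sign_induction {P : (Fin d → Bool) → Prop} (anti : ∀ δ, Antitone δ → P δ)
    (step : ∀ δ k (hk : IsMinusPlus δ k), P (δ ∘ adjSwap k hk.1) → P δ) (δ : Fin d → Bool) :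
    P δ := by
  induction δ using WellFounded.induction (measure plusSum).wf with
  | _ δ ih =>
    obtain hδ | ⟨k, hk⟩ := antitone_or_exists_isMinusPlus δ
    · exact anti δ hδ
    · exact step δ k hk (ih _ hk.plusSum_lt)

end SignDescents

section SignSpaceAction

open Module Module.End

variable {K : Type*} [Field K] {d : ℕ} {q Q : Kˣ}
  {M : Type*} [AddCommGroup M] [Module K M] {T : ℕ → End K M}

theorem intertwiner_apply (k : ℕ) (m : M) : intertwiner q T k m =
    T (k + 1) ((jucysMurphy T k - jucysMurphy T (k + 1)) m) +
      ((q : K)⁻¹ - q) • jucysMurphy T (k + 1) m := rfl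

theorem signCount_zero (δ : Fin d → Bool) (s : Bool) (hd : 0 < d) :
    signCount δ s ⟨0, hd⟩ = 0 :=
  Finset.card_eq_zero.2 (Finset.filter_eq_empty_iff.2 fun i _ hi => absurd hi.1 (Nat.not_lt_zero i))

namespace IsHeckeB

variable (h : IsHeckeB q Q d T)
include h

theorem eq_zero_of_mem_signSpace (hf : IsUnit (fB q Q d)) {δ : Fin d → Bool} {m : M}
    (hm : m ∈ signSpace q Q T δ) {i j : Fin d} (hij : δ i ≠ δ j) {e : ℤ} (he : |e| ≤ 1)
    (h0 : (jucysMurphy T i - (q : K) ^ (2 * e) • jucysMurphy T j) m = 0) : m = 0 := by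
  refine eq_zero_of_mem_iSup_maxGenEigenspace_ne ?_ (h0.trans (zero_smul K m).symm)
  suffices hle : signSpace q Q T δ ≤ ⨆ b ≠ (0 : K),
    (jucysMurphy T i - (q : K) ^ (2 * e) • jucysMurphy T j).maxGenEigenspace b from hle hm
  exact iSup₂_le fun x hx => (h.weightSpace_le_maxGenEigenspace_sub_smul x i j _).trans
    (le_iSup₂_of_le _ (sub_ne_zero.2 (hx.ne_zpow_mul hf hij he)) le_rfl)

theorem jucysMurphy_sub_injOn_signSpace (hf : IsUnit (fB q Q d)) {δ : Fin d → Bool} {k : ℕ}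
    (hk : k + 1 < d) (hδ : δ ⟨k, by omega⟩ ≠ δ ⟨k + 1, hk⟩) {m : M}
    (hm : m ∈ signSpace q Q T δ) (h0 : (jucysMurphy T k - jucysMurphy T (k + 1)) m = 0) :
    m = 0 :=
  h.eq_zero_of_mem_signSpace hf hm hδ (e := 0) (by simp)
    (by simpa only [mul_zero, zpow_zero, one_smul] using h0)

theorem intertwiner_injOn_signSpace (hf : IsUnit (fB q Q d)) {δ : Fin d → Bool} {k : ℕ}
    (hk : k + 1 < d) (hδ : δ ⟨k, by omega⟩ ≠ δ ⟨k + 1, hk⟩) {m : M}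
    (hm : m ∈ signSpace q Q T δ) (h0 : intertwiner q T k m = 0) : m = 0 := by
  have hsq := congrArg (fun f : End K M => f m) (h.intertwiner_mul_self hk)
  simp only [mul_apply, h0, map_zero, LinearMap.neg_apply] at hsq
  have hm' : (jucysMurphy T k - ((q : K)⁻¹) ^ 2 • jucysMurphy T (k + 1)) m ∈ signSpace q Q T δ :=
    sub_mem (h.jucysMurphy_mem_signSpace hm (by omega))
      (Submodule.smul_mem _ _ (h.jucysMurphy_mem_signSpace hm hk))
  have hpos : (q : K) ^ (2 * 1 : ℤ) = (q : K) ^ 2 := by norm_cast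
  have hneg : (q : K) ^ (2 * (-1) : ℤ) = ((q : K)⁻¹) ^ 2 := by
    rw [mul_neg, mul_one, zpow_neg, inv_pow]; norm_cast
  refine h.eq_zero_of_mem_signSpace hf hm hδ (e := -1) (by simp) ?_
  rw [hneg]
  refine h.eq_zero_of_mem_signSpace hf hm' hδ (e := 1) (by simp) ?_
  rw [hpos]
  exact neg_eq_zero.1 hsq.symm

theorem intertwiner_intertwiner_mem {W : Submodule K M}
    (hW : ∀ j < d, ∀ w ∈ W, jucysMurphy T j w ∈ W) {k : ℕ} (hk : k + 1 < d) {w : M}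
    (hw : w ∈ W) : intertwiner q T k (intertwiner q T k w) ∈ W := by
  have hmem (c : K) (w : M) (hw : w ∈ W) : (jucysMurphy T k - c • jucysMurphy T (k + 1)) w ∈ W :=
    sub_mem (hW _ (by omega) _ hw) (Submodule.smul_mem _ _ (hW _ hk _ hw))
  rw [← mul_apply, h.intertwiner_mul_self hk, LinearMap.neg_apply, mul_apply]
  exact neg_mem (hmem _ _ (hmem _ _ hw))

variable [FiniteDimensional K M]

theorem le_map_jucysMurphy_sub (hf : IsUnit (fB q Q d)) {δ : Fin d → Bool} {k : ℕ}
    (hk : k + 1 < d) (hδ : δ ⟨k, by omega⟩ ≠ δ ⟨k + 1, hk⟩) {W : Submodule K M}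
    (hWδ : W ≤ signSpace q Q T δ) (hW : ∀ j < d, ∀ w ∈ W, jucysMurphy T j w ∈ W) :
    W ≤ W.map (jucysMurphy T k - jucysMurphy T (k + 1)) :=
  le_map_of_injOn (fun w hw => sub_mem (hW k (by omega) w hw) (hW (k + 1) hk w hw))
    fun _ hw => h.jucysMurphy_sub_injOn_signSpace hf hk hδ (hWδ hw)

theorem le_map_intertwiner_mul_self (hf : IsUnit (fB q Q d)) {δ : Fin d → Bool} {k : ℕ}
    (hk : k + 1 < d) (hδ : δ ⟨k, by omega⟩ ≠ δ ⟨k + 1, hk⟩) {W : Submodule K M}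
    (hWδ : W ≤ signSpace q Q T δ) (hW : ∀ j < d, ∀ w ∈ W, jucysMurphy T j w ∈ W) :
    W ≤ W.map (intertwiner q T k * intertwiner q T k) := by
  refine le_map_of_injOn (fun w hw => h.intertwiner_intertwiner_mem hW hk hw) fun w hw h0 => ?_
  refine h.intertwiner_injOn_signSpace hf hk hδ (hWδ hw)
    (h.intertwiner_injOn_signSpace hf hk (δ := δ ∘ adjSwap k hk) ?_
      (h.intertwiner_mem_signSpace hf (hWδ hw) hk) h0)
  rw [comp_adjSwap_left, comp_adjSwap_right]
  exact hδ.symm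

theorem exists_intertwiner_eq (hf : IsUnit (fB q Q d)) {δ : Fin d → Bool} {k : ℕ} (hk : k + 1 < d)
    (hδ : δ ⟨k, by omega⟩ ≠ δ ⟨k + 1, hk⟩) {m : M} (hm : m ∈ signSpace q Q T δ) :
    ∃ m' ∈ signSpace q Q T (δ ∘ adjSwap k hk), intertwiner q T k m' = m := by
  obtain ⟨u, hu, rfl⟩ := h.le_map_intertwiner_mul_self hf hk hδ le_rfl
    (fun j hj w hw => h.jucysMurphy_mem_signSpace hw hj) hm
  exact ⟨_, h.intertwiner_mem_signSpace hf hu hk, rfl⟩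

omit [FiniteDimensional K M] in
theorem mem_weightSpace_of_eq {x : Fin d → K} {k : ℕ} (hk : k + 1 < d)
    (hx : x ⟨k, by omega⟩ = x ⟨k + 1, hk⟩) {m : M} (hm : m ∈ weightSpace T x) :
    T (k + 1) m ∈ weightSpace T x := by
  have hk' : k < d := by omega
  set a := x ⟨k + 1, hk⟩
  have hcomm : Commute (jucysMurphy T k) (jucysMurphy T (k + 1)) := h.jucysMurphy_commute hk' hk
  have hmk : m ∈
      (jucysMurphy T k).maxGenEigenspace a ⊓ (jucysMurphy T (k + 1)).maxGenEigenspace a :=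
    ⟨hx ▸ weightSpace_le_maxGenEigenspace x ⟨k, hk'⟩ hm,
      weightSpace_le_maxGenEigenspace x ⟨k + 1, hk⟩ hm⟩
  have hadd := mapsTo_maxGenEigenspace_of_comm (h.commute_jucysMurphy_add hk).symm _
    (maxGenEigenspace_inf_le_add hcomm a a hmk)
  have hmul := mapsTo_maxGenEigenspace_of_comm (h.commute_jucysMurphy_mul hk).symm _
    (maxGenEigenspace_inf_le_mul hcomm a a hmk)
  refine (Submodule.mem_iInf _).2 fun ⟨j, hj⟩ => ?_
  by_cases h0 : j = k
  · subst h0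
    rw [hx]
    exact maxGenEigenspace_add_inf_mul_le hcomm a ⟨hadd, hmul⟩
  by_cases h1 : j = k + 1
  · subst h1
    rw [add_comm] at hadd
    rw [hcomm.eq] at hmul
    exact maxGenEigenspace_add_inf_mul_le hcomm.symm a ⟨hadd, hmul⟩
  · exact mapsTo_maxGenEigenspace_of_comm (h.commute_jucysMurphy hk hj h0 h1).symm _
      (weightSpace_le_maxGenEigenspace x ⟨j, hj⟩ hm)

theorem apply_mem_sup_signSpace (hf : IsUnit (fB q Q d)) {δ : Fin d → Bool} {k : ℕ}
    (hk : k + 1 < d) {m : M} (hm : m ∈ signSpace q Q T δ) :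
    T (k + 1) m ∈ signSpace q Q T δ ⊔ signSpace q Q T (δ ∘ adjSwap k hk) := by
  suffices hle : signSpace q Q T δ ≤ (signSpace q Q T δ ⊔
    signSpace q Q T (δ ∘ adjSwap k hk)).comap (T (k + 1)) from hle hm
  refine iSup₂_le fun x hx m hm => ?_
  by_cases hxk : x ⟨k, by omega⟩ = x ⟨k + 1, hk⟩
  · exact Submodule.mem_sup_left (weightSpace_le_signSpace hx (h.mem_weightSpace_of_eq hk hxk hm))
  have hinj : weightSpace T x ≤ (weightSpace T x).map (jucysMurphy T k - jucysMurphy T (k + 1)) :=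
    le_map_of_injOn (fun w hw => sub_mem (h.jucysMurphy_mem_weightSpace hw (by omega))
      (h.jucysMurphy_mem_weightSpace hw hk)) fun w hw h0 =>
        h.eq_zero_of_mem_weightSpace (i := ⟨k, by omega⟩) (j := ⟨k + 1, hk⟩) (c := 1) hw
          (by rwa [one_mul]) (by rwa [one_smul])
  obtain ⟨u, hu, rfl⟩ := hinj hm
  rw [Submodule.mem_comap, ← sub_eq_of_eq_add (intertwiner_apply (q := q) k u)]
  have hu' := weightSpace_le_signSpace hx hu
  exact sub_mem (Submodule.mem_sup_right (h.intertwiner_mem_signSpace hf hu' hk))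
    (Submodule.mem_sup_left (Submodule.smul_mem _ _ (h.jucysMurphy_mem_signSpace hu' hk)))

theorem apply_mem_signSpace (hf : IsUnit (fB q Q d)) {δ : Fin d → Bool} {k : ℕ} (hk : k + 1 < d)
    (hδ : δ ⟨k, by omega⟩ = δ ⟨k + 1, hk⟩) {m : M} (hm : m ∈ signSpace q Q T δ) :
    T (k + 1) m ∈ signSpace q Q T δ := by
  simpa only [comp_adjSwap_of_eq hk hδ, sup_idem] using h.apply_mem_sup_signSpace hf hk hm

omit [FiniteDimensional K M] in
theorem zero_apply_of_mem_signSpace (hf : IsUnit (fB q Q d)) (hd : 0 < d) {δ : Fin d → Bool}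
    {m : M} (hm : m ∈ signSpace q Q T δ) : T 0 m = contentValue q Q (δ ⟨0, hd⟩) 0 • m := by
  set s := δ ⟨0, hd⟩ with hs
  have hmul := congrArg (fun f : End K M => f m) (h.zero_sub_mul_zero_sub hd (!s))
  rw [Bool.not_not] at hmul
  have hmem : T 0 m - contentValue q Q s 0 • m ∈ signSpace q Q T δ :=
    sub_mem (h.jucysMurphy_mem_signSpace hm hd) (Submodule.smul_mem _ _ hm)
  refine sub_eq_zero.1 (eq_zero_of_mem_iSup_maxGenEigenspace_ne (f := T 0) ?_ (sub_eq_zero.1 hmul))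
  suffices hle : signSpace q Q T δ ≤ ⨆ b ≠ contentValue q Q (!s) 0, (T 0).maxGenEigenspace b from
    hle hmem
  refine iSup₂_le fun x hx => (weightSpace_le_maxGenEigenspace x ⟨0, hd⟩).trans
    (le_iSup₂_of_le (f := fun b _ => (T 0).maxGenEigenspace b) (x ⟨0, hd⟩) ?_ le_rfl)
  obtain ⟨c, hc, hxc⟩ := hx ⟨0, hd⟩
  rw [hxc, ← hs]
  rw [signCount_zero, Nat.cast_zero] at hc
  exact contentValue_ne hf (by simp) (by rw [sub_zero]; omega)

theorem jucysMurphy_apply_of_forall_lt (hf : IsUnit (fB q Q d)) {k : ℕ} (hk : k < d)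
    {δ : Fin d → Bool} (hδ : ∀ j < ⟨k, hk⟩, δ j ≠ δ ⟨k, hk⟩) {m : M}
    (hm : m ∈ signSpace q Q T δ) : jucysMurphy T k m = contentValue q Q (δ ⟨k, hk⟩) 0 • m := by
  induction k generalizing δ m with
  | zero => exact h.zero_apply_of_mem_signSpace hf hk hm
  | succ k ih =>
    have hkd : k < d := by omega
    have hk' : (⟨k, hkd⟩ : Fin d) < ⟨k + 1, hk⟩ := Fin.mk_lt_mk.2 (Nat.lt_succ_self k)
    obtain ⟨u, hu, rfl⟩ := h.exists_intertwiner_eq hf hk (hδ _ hk') hm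
    rw [← mul_apply, ← h.intertwiner_mul_jucysMurphy hk, mul_apply,
      ih hkd (δ := δ ∘ adjSwap k hk) ?_ hu, map_smul, comp_adjSwap_left]
    intro j hj
    have hjk : (j : ℕ) < k := hj
    rw [comp_adjSwap_left, comp_adjSwap_of_ne δ hk (by omega) (by omega)]
    exact hδ j (hj.trans hk')

theorem jucysMurphy_mem_of_antitone (hf : IsUnit (fB q Q d)) {δ : Fin d → Bool} (hδ : Antitone δ)
    {W : Submodule K M} (hWδ : W ≤ signSpace q Q T δ)
    (hW : ∀ k (hk : k + 1 < d), δ ⟨k, by omega⟩ = δ ⟨k + 1, hk⟩ → ∀ w ∈ W, T (k + 1) w ∈ W)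
    {j : ℕ} (hj : j < d) {w : M} (hw : w ∈ W) : jucysMurphy T j w ∈ W := by
  induction j generalizing w with
  | zero =>
    rw [jucysMurphy, h.zero_apply_of_mem_signSpace hf hj (hWδ hw)]
    exact Submodule.smul_mem _ _ hw
  | succ j ih =>
    by_cases heq : δ ⟨j, by omega⟩ = δ ⟨j + 1, hj⟩
    · exact hW j hj heq _ (ih (by omega) (hW j hj heq w hw))
    · rw [h.jucysMurphy_apply_of_forall_lt hf hj (fun i hi => ?_) (hWδ hw)]
      · exact Submodule.smul_mem _ _ hw
      have hlt : δ ⟨j + 1, hj⟩ < δ ⟨j, by omega⟩ :=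
        lt_of_le_of_ne (hδ (Fin.mk_le_mk.2 (Nat.le_succ j))) (Ne.symm heq)
      exact (hlt.trans_le (hδ (Nat.lt_succ_iff.1 hi))).ne'

end IsHeckeB

end SignSpaceAction

section InducedSpaces

open Module Module.End

variable {K : Type*} [Field K] {d : ℕ} {q Q : Kˣ}
  {M : Type*} [AddCommGroup M] [Module K M] {T : ℕ → End K M}

open Classical in
/-- The part in the sign space of `δ` of the Hecke submodule generated by given subspaces `Z δ` of
the sign spaces of the antitone `δ`: move the plus signs of `δ` to the front and apply the
corresponding intertwiners. -/
def inducedSpace (q : Kˣ) (T : ℕ → End K M) (Z : (Fin d → Bool) → Submodule K M)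
    (δ : Fin d → Bool) : Submodule K M :=
  if h : ∃ k, IsMinusPlus δ k then
    (inducedSpace q T Z (δ ∘ adjSwap h.choose h.choose_spec.1)).map (intertwiner q T h.choose)
  else Z δ
termination_by plusSum δ
decreasing_by exact h.choose_spec.plusSum_lt

theorem inducedSpace_of_antitone (Z : (Fin d → Bool) → Submodule K M) {δ : Fin d → Bool}
    (hδ : Antitone δ) : inducedSpace q T Z δ = Z δ := by
  rw [inducedSpace, dif_neg (not_isMinusPlus_of_antitone hδ)]

theorem jucysMurphy_mem_of_forall_apply_mem {W : Submodule K M}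
    (hW : ∀ j < d, ∀ w ∈ W, T j w ∈ W) {j : ℕ} (hj : j < d) {w : M} (hw : w ∈ W) :
    jucysMurphy T j w ∈ W := by
  induction j generalizing w with
  | zero => exact hW 0 hj w hw
  | succ j ih => exact hW _ hj _ (ih (by omega) (hW _ hj _ hw))

theorem intertwiner_mem_of_forall_apply_mem {W : Submodule K M}
    (hW : ∀ j < d, ∀ w ∈ W, T j w ∈ W) {k : ℕ} (hk : k + 1 < d) {w : M} (hw : w ∈ W) :
    intertwiner q T k w ∈ W := by
  have hL : jucysMurphy T k w ∈ W := jucysMurphy_mem_of_forall_apply_mem hW (by omega) hw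
  have hL' : jucysMurphy T (k + 1) w ∈ W := jucysMurphy_mem_of_forall_apply_mem hW hk hw
  rw [intertwiner_apply]
  exact add_mem (hW _ hk _ (sub_mem hL hL')) (Submodule.smul_mem _ _ hL')

theorem apply_mem_map_of_mul_eq {f g φ : End K M} (hfg : φ * g = f * φ) {W : Submodule K M}
    (hW : ∀ w ∈ W, g w ∈ W) {z : M} (hz : z ∈ W.map φ) : f z ∈ W.map φ := by
  obtain ⟨w, hw, rfl⟩ := hz
  exact ⟨g w, hW w hw, congrArg (· w) hfg⟩

theorem iSup_inf_eq_of_iSupIndep {α ι : Type*} [CompleteLattice α] [IsModularLattice α]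
    {a b : ι → α} (hb : iSupIndep b) (hab : a ≤ b) (i : ι) : (⨆ j, a j) ⊓ b i = a i := by
  have hdisj : (⨆ (j) (_ : j ≠ i), a j) ⊓ b i = ⊥ :=
    ((hb i).symm.mono_left (iSup₂_mono fun j _ => hab j)).eq_bot
  rw [iSup_split_single a i, sup_inf_assoc_of_le _ (hab i), hdisj, sup_bot_eq]

namespace IsHeckeB

variable (h : IsHeckeB q Q d T)
include h

theorem inducedSpace_of_isMinusPlus (Z : (Fin d → Bool) → Submodule K M) {δ : Fin d → Bool} {k : ℕ}
    (hk : IsMinusPlus δ k) :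
    inducedSpace q T Z δ = (inducedSpace q T Z (δ ∘ adjSwap k hk.1)).map (intertwiner q T k) := by
  induction δ using WellFounded.induction (measure plusSum).wf generalizing k with
  | _ δ ih =>
    have hex : ∃ k, IsMinusPlus δ k := ⟨k, hk⟩
    rw [inducedSpace, dif_pos hex]
    suffices hind : ∀ l (hl : IsMinusPlus δ l),
      (inducedSpace q T Z (δ ∘ adjSwap l hl.1)).map (intertwiner q T l) =
        (inducedSpace q T Z (δ ∘ adjSwap k hk.1)).map (intertwiner q T k) from
      hind _ hex.choose_spec
    intro l hl
    by_cases hkl : k = l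
    · subst hkl
      rfl
    have hfar := hk.far hl hkl
    rw [ih _ hl.plusSum_lt (hk.comp_adjSwap hl.1 hfar),
      ih _ hk.plusSum_lt (hl.comp_adjSwap hk.1 hfar.symm), comp_adjSwap_comm δ hl.1 hk.1 hfar.symm,
      ← Submodule.map_comp, ← Submodule.map_comp]
    exact congrArg (Submodule.map · _) (h.intertwiner_commute hl.1 hk.1 hfar.symm).eq

theorem inducedSpace_of_isMinusPlus_of_isMinusPlus (Z : (Fin d → Bool) → Submodule K M)
    {δ : Fin d → Bool} {k l : ℕ} (hk : IsMinusPlus δ k)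
    (hl : IsMinusPlus (δ ∘ adjSwap k hk.1) l) : inducedSpace q T Z δ =
      (inducedSpace q T Z ((δ ∘ adjSwap k hk.1) ∘ adjSwap l hl.1)).map
        (intertwiner q T k * intertwiner q T l) := by
  rw [h.inducedSpace_of_isMinusPlus Z hk, h.inducedSpace_of_isMinusPlus Z hl, ← Submodule.map_comp]
  rfl

theorem apply_mem_inducedSpace {Z : (Fin d → Bool) → Submodule K M}
    (hT : ∀ δ, Antitone δ → ∀ k (hk : k + 1 < d), δ ⟨k, by omega⟩ = δ ⟨k + 1, hk⟩ →
      ∀ z ∈ Z δ, T (k + 1) z ∈ Z δ)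
    (δ : Fin d → Bool) {k : ℕ} (hk : k + 1 < d) (hδ : δ ⟨k, by omega⟩ = δ ⟨k + 1, hk⟩) {z : M}
    (hz : z ∈ inducedSpace q T Z δ) : T (k + 1) z ∈ inducedSpace q T Z δ := by
  induction δ using WellFounded.induction (measure plusSum).wf generalizing k z with
  | _ δ ih =>
    obtain hanti | ⟨l, hl⟩ := antitone_or_exists_isMinusPlus δ
    · rw [inducedSpace_of_antitone Z hanti] at hz ⊢
      exact hT δ hanti k hk hδ z hz
    obtain ⟨hl', hl0, hl1⟩ := id hl
    obtain hfar | rfl | rfl : (k + 1 < l ∨ l + 1 < k) ∨ l = k + 1 ∨ k = l + 1 := by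
      have hne : l ≠ k := by
        rintro rfl
        simp [hl0, hl1] at hδ
      omega
    · rw [h.inducedSpace_of_isMinusPlus Z hl] at hz ⊢
      refine apply_mem_map_of_mul_eq (h.commute_intertwiner hk hl' hfar).eq.symm
        (fun w hw => ih _ hl.plusSum_lt hk ?_ hw) hz
      rwa [comp_adjSwap_of_ne δ hl' (by dsimp; omega) (by dsimp; omega),
        comp_adjSwap_of_ne δ hl' (by dsimp; omega) (by dsimp; omega)]
    · have hk2 : IsMinusPlus (δ ∘ adjSwap (k + 1) hl') k := by
        refine ⟨hk, ?_, ?_⟩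
        · rwa [comp_adjSwap_of_ne δ hl' (by dsimp; omega) (by dsimp; omega), hδ]
        · rwa [comp_adjSwap_left]
      rw [h.inducedSpace_of_isMinusPlus_of_isMinusPlus Z hl hk2] at hz ⊢
      refine apply_mem_map_of_mul_eq (h.mul_intertwiners hl').1.symm
        (fun w hw => ih _ (hk2.plusSum_lt.trans hl.plusSum_lt) hl' ?_ hw) hz
      rw [comp_adjSwap_right, comp_adjSwap_of_ne δ hl' (by dsimp; omega) (by dsimp; omega), hδ,
        comp_adjSwap_of_ne _ hk (by dsimp; omega) (by dsimp; omega), comp_adjSwap_right]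
    · have hk2 : IsMinusPlus (δ ∘ adjSwap l hl') (l + 1) := by
        refine ⟨hk, ?_, ?_⟩
        · rwa [comp_adjSwap_right]
        · rwa [comp_adjSwap_of_ne δ hl' (by dsimp; omega) (by dsimp; omega), ← hδ]
      rw [h.inducedSpace_of_isMinusPlus_of_isMinusPlus Z hl hk2] at hz ⊢
      refine apply_mem_map_of_mul_eq (h.mul_intertwiners hk).2.symm
        (fun w hw => ih _ (hk2.plusSum_lt.trans hl.plusSum_lt) hl' ?_ hw) hz
      rw [comp_adjSwap_left, comp_adjSwap_of_ne _ hk (by dsimp; omega) (by dsimp; omega),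
        comp_adjSwap_left,
        comp_adjSwap_of_ne δ hl' (by dsimp; omega) (by dsimp; omega), hδ]

variable [FiniteDimensional K M] (hf : IsUnit (fB q Q d)) {Z : (Fin d → Bool) → Submodule K M}
  (hZ : ∀ δ, Antitone δ → Z δ ≤ signSpace q Q T δ)
include hf hZ

omit [FiniteDimensional K M] in
theorem inducedSpace_le_signSpace (δ : Fin d → Bool) :
    inducedSpace q T Z δ ≤ signSpace q Q T δ := by
  induction δ using sign_induction with
  | anti δ hδ =>
    rw [inducedSpace_of_antitone Z hδ]
    exact hZ δ hδ
  | step δ k hk ih =>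
    rw [h.inducedSpace_of_isMinusPlus Z hk, Submodule.map_le_iff_le_comap]
    intro m hm
    simpa only [comp_adjSwap_comp_adjSwap, Submodule.mem_comap] using
      h.intertwiner_mem_signSpace hf (ih hm) hk.1

variable (hT : ∀ δ, Antitone δ → ∀ k (hk : k + 1 < d), δ ⟨k, by omega⟩ = δ ⟨k + 1, hk⟩ →
  ∀ z ∈ Z δ, T (k + 1) z ∈ Z δ)
include hT

theorem jucysMurphy_mem_inducedSpace (δ : Fin d → Bool) :
    ∀ j < d, ∀ z ∈ inducedSpace q T Z δ, jucysMurphy T j z ∈ inducedSpace q T Z δ := by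
  intro j hj z hz
  induction δ using sign_induction generalizing j z with
  | anti δ hδ =>
    rw [inducedSpace_of_antitone Z hδ] at hz ⊢
    exact h.jucysMurphy_mem_of_antitone hf hδ (hZ δ hδ) (hT δ hδ) hj hz
  | step δ k hk ih =>
    rw [h.inducedSpace_of_isMinusPlus Z hk] at hz ⊢
    exact apply_mem_map_of_mul_eq (h.intertwiner_mul_jucysMurphy_adjSwap hk.1 ⟨j, hj⟩)
      (ih _ (Fin.is_lt _)) hz

theorem intertwiner_mem_inducedSpace {δ : Fin d → Bool} {k : ℕ} (hk : k + 1 < d)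
    (hδ : δ ⟨k, by omega⟩ ≠ δ ⟨k + 1, hk⟩) {z : M} (hz : z ∈ inducedSpace q T Z δ) :
    intertwiner q T k z ∈ inducedSpace q T Z (δ ∘ adjSwap k hk) := by
  obtain hmp | hmp := isMinusPlus_or_comp_adjSwap hk hδ
  · rw [h.inducedSpace_of_isMinusPlus Z hmp] at hz
    obtain ⟨u, hu, rfl⟩ := hz
    exact h.intertwiner_intertwiner_mem (h.jucysMurphy_mem_inducedSpace hf hZ hT _) hk hu
  · rw [h.inducedSpace_of_isMinusPlus Z hmp, comp_adjSwap_comp_adjSwap]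
    exact Submodule.mem_map_of_mem hz

theorem apply_mem_iSup_inducedSpace {j : ℕ} (hj : j < d) {z : M}
    (hz : z ∈ ⨆ δ, inducedSpace q T Z δ) : T j z ∈ ⨆ δ, inducedSpace q T Z δ := by
  suffices hle : ⨆ δ, inducedSpace q T Z δ ≤ (⨆ δ, inducedSpace q T Z δ).comap (T j) from hle hz
  refine iSup_le fun δ z hz => ?_
  rw [Submodule.mem_comap]
  have hL := h.jucysMurphy_mem_inducedSpace hf hZ hT δ
  obtain _ | k := j
  · exact Submodule.mem_iSup_of_mem δ (hL 0 hj z hz)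
  by_cases hδ : δ ⟨k, by omega⟩ = δ ⟨k + 1, hj⟩
  · exact Submodule.mem_iSup_of_mem δ (h.apply_mem_inducedSpace hT δ hj hδ hz)
  obtain ⟨u, hu, rfl⟩ :=
    h.le_map_jucysMurphy_sub hf hj hδ (h.inducedSpace_le_signSpace hf hZ δ) hL hz
  rw [← sub_eq_of_eq_add (intertwiner_apply k u)]
  exact sub_mem
    (Submodule.mem_iSup_of_mem _ (h.intertwiner_mem_inducedSpace hf hZ hT hj hδ hu))
    (Submodule.mem_iSup_of_mem δ (Submodule.smul_mem _ _ (hL _ hj u hu)))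

theorem exists_inf_signSpace_eq : ∃ G : Submodule K M, (∀ j < d, ∀ m ∈ G, T j m ∈ G) ∧
    ∀ δ, Antitone δ → G ⊓ signSpace q Q T δ = Z δ := by
  refine ⟨⨆ δ, inducedSpace q T Z δ, fun j hj m hm => h.apply_mem_iSup_inducedSpace hf hZ hT hj hm,
    fun δ hδ => ?_⟩
  rw [iSup_inf_eq_of_iSupIndep (h.iSupIndep_signSpace hf) (h.inducedSpace_le_signSpace hf hZ) δ,
    inducedSpace_of_antitone Z hδ]

end IsHeckeB

end InducedSpaces

section Extension

open Module Module.End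

variable {K : Type*} [Field K] {d : ℕ} {q Q : Kˣ}
  {M : Type*} [AddCommGroup M] [Module K M] {T : ℕ → End K M}

theorem exists_eq_graph_of_map_fst_eq_top {G : Submodule K (M × M)}
    (htop : G.map (LinearMap.fst K M M) = ⊤) (hker : G ⊓ LinearMap.ker (LinearMap.fst K M M) = ⊥) :
    ∃ φ : End K M, G = LinearMap.graph φ := by
  refine Submodule.exists_eq_graph ⟨fun a b hab => ?_, fun m => ?_⟩
  · refine Subtype.ext (sub_eq_zero.1 ((Submodule.mem_bot K).1 (hker.le ⟨sub_mem a.2 b.2, ?_⟩)))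
    exact sub_eq_zero.2 hab
  · obtain ⟨z, hz, hzm⟩ := htop.ge (Submodule.mem_top (x := m))
    exact ⟨⟨z, hz⟩, hzm⟩

theorem mem_signSpace_prodMap {δ : Fin d → Bool} {m m' : M} (hm : m ∈ signSpace q Q T δ)
    (hm' : m' ∈ signSpace q Q T δ) :
    (m, m') ∈ signSpace q Q (fun j => (T j).prodMap (T j) : ℕ → End K (M × M)) δ := by
  have hinl := map_mem_signSpace (φ := LinearMap.inl K M M)
    (T' := fun j => (T j).prodMap (T j)) (fun j _ m => by simp) hm
  have hinr := map_mem_signSpace (φ := LinearMap.inr K M M)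
    (T' := fun j => (T j).prodMap (T j)) (fun j _ m => by simp) hm'
  simpa using add_mem hinl hinr

namespace IsHeckeB

theorem prodMap (h : IsHeckeB q Q d T) :
    IsHeckeB q Q d fun j => ((T j).prodMap (T j) : End K (M × M)) where
  quadZero hd := by
    rw [LinearMap.prodMap_mul, h.quadZero hd]
    ext <;> simp
  quad k hk := by
    rw [LinearMap.prodMap_mul, h.quad k hk]
    ext <;> simp
  braidZero hd := by simp only [LinearMap.prodMap_mul, h.braidZero hd]
  braid k hk := by simp only [LinearMap.prodMap_mul, h.braid k hk]
  comm i j hij hj := by simp only [LinearMap.prodMap_mul, h.comm i j hij hj]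

variable (h : IsHeckeB q Q d T) [FiniteDimensional K M] (hf : IsUnit (fB q Q d))
include h hf

theorem eq_top_of_signSpace_le {W : Submodule K M} (hW : ∀ j < d, ∀ w ∈ W, T j w ∈ W)
    (hanti : ∀ δ : Fin d → Bool, Antitone δ → signSpace q Q T δ ≤ W) : W = ⊤ := by
  rw [eq_top_iff, ← h.iSup_signSpace]
  refine iSup_le fun δ => ?_
  induction δ using sign_induction with
  | anti δ hδ => exact hanti δ hδ
  | step δ k hk ih =>
    intro m hm
    obtain ⟨u, hu, rfl⟩ := h.exists_intertwiner_eq hf hk.1 hk.ne hm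
    exact intertwiner_mem_of_forall_apply_mem hW hk.1 (ih hu)

theorem eq_bot_of_inf_signSpace_eq_bot {W : Submodule K M} (hW : ∀ j < d, ∀ w ∈ W, T j w ∈ W)
    (hanti : ∀ δ : Fin d → Bool, Antitone δ → W ⊓ signSpace q Q T δ = ⊥) : W = ⊥ := by
  rw [eq_bot_iff]
  refine (h.le_iSup_inf_signSpace fun j hj m hm =>
    jucysMurphy_mem_of_forall_apply_mem hW hj hm).trans (iSup_le fun δ => ?_)
  induction δ using sign_induction with
  | anti δ hδ => exact (hanti δ hδ).le
  | step δ k hk ih =>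
    rintro m ⟨hmW, hm⟩
    have hφm : intertwiner q T k m = 0 := (Submodule.mem_bot K).1
      (ih ⟨intertwiner_mem_of_forall_apply_mem hW hk.1 hmW,
        h.intertwiner_mem_signSpace hf hm hk.1⟩)
    exact (Submodule.mem_bot K).2 (h.intertwiner_injOn_signSpace hf hk.1 hk.ne hm hφm)

/-- The extension is found through its graph, a Hecke submodule of `M × M`. -/
theorem exists_extension {ψ : (Fin d → Bool) → End K M}
    (hψ : ∀ δ, Antitone δ → ∀ m ∈ signSpace q Q T δ, ψ δ m ∈ signSpace q Q T δ)
    (hψT : ∀ δ, Antitone δ → ∀ k (hk : k + 1 < d), δ ⟨k, by omega⟩ = δ ⟨k + 1, hk⟩ →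
      ∀ m ∈ signSpace q Q T δ, ψ δ (T (k + 1) m) = T (k + 1) (ψ δ m)) :
    ∃ φ : End K M, (∀ j < d, ∀ m, φ (T j m) = T j (φ m)) ∧
      ∀ δ, Antitone δ → ∀ m ∈ signSpace q Q T δ, φ m = ψ δ m := by
  let T' (j : ℕ) : End K (M × M) := (T j).prodMap (T j)
  let Z (δ : Fin d → Bool) : Submodule K (M × M) :=
    (signSpace q Q T δ).map (LinearMap.prod LinearMap.id (ψ δ))
  have hZ (δ : Fin d → Bool) (hδ : Antitone δ) : Z δ ≤ signSpace q Q T' δ := by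
    rintro _ ⟨m, hm, rfl⟩
    exact mem_signSpace_prodMap hm (hψ δ hδ m hm)
  have hZT (δ : Fin d → Bool) (hδ : Antitone δ) (k : ℕ) (hk : k + 1 < d)
      (heq : δ ⟨k, by omega⟩ = δ ⟨k + 1, hk⟩) : ∀ z ∈ Z δ, T' (k + 1) z ∈ Z δ := by
    rintro _ ⟨m, hm, rfl⟩
    exact ⟨T (k + 1) m, h.apply_mem_signSpace hf hk heq hm,
      Prod.ext rfl (hψT δ hδ k hk heq m hm)⟩
  obtain ⟨G, hGT, hGZ⟩ := h.prodMap.exists_inf_signSpace_eq hf hZ hZT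
  have hGψ (δ : Fin d → Bool) (hδ : Antitone δ) (m : M) (hm : m ∈ signSpace q Q T δ) :
      (m, ψ δ m) ∈ G := by
    have hmem : (m, ψ δ m) ∈ Z δ := ⟨m, hm, rfl⟩
    exact ((hGZ δ hδ).ge hmem).1
  have hsurj : G.map (LinearMap.fst K M M) = ⊤ := by
    refine h.eq_top_of_signSpace_le hf ?_ fun δ hδ m hm => ⟨_, hGψ δ hδ m hm, rfl⟩
    rintro j hj _ ⟨z, hz, rfl⟩
    exact ⟨T' j z, hGT j hj z hz, rfl⟩
  have hker : G ⊓ LinearMap.ker (LinearMap.fst K M M) = ⊥ := by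
    refine h.prodMap.eq_bot_of_inf_signSpace_eq_bot hf ?_ fun δ hδ => ?_
    · rintro j hj z ⟨hz, hz0 : z.1 = 0⟩
      exact ⟨hGT j hj z hz, (congrArg (T j) hz0).trans (map_zero _)⟩
    · rw [inf_right_comm, hGZ δ hδ, eq_bot_iff]
      rintro _ ⟨⟨m, -, rfl⟩, rfl : m = 0⟩
      exact map_zero _
  obtain ⟨φ, hφ⟩ := exists_eq_graph_of_map_fst_eq_top hsurj hker
  have hmem (m m' : M) : (m, m') ∈ G ↔ m' = φ m := by rw [hφ, LinearMap.mem_graph_iff]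
  refine ⟨φ, fun j hj m => ?_, fun δ hδ m hm => ((hmem _ _).1 (hGψ δ hδ m hm)).symm⟩
  exact ((hmem _ _).1 (hGT j hj (m, φ m) ((hmem _ _).2 rfl))).symm

theorem eq_of_eqOn_signSpace {φ φ' : End K M} (hφ : ∀ j < d, ∀ m, φ (T j m) = T j (φ m))
    (hφ' : ∀ j < d, ∀ m, φ' (T j m) = T j (φ' m))
    (heq : ∀ δ : Fin d → Bool, Antitone δ → ∀ m ∈ signSpace q Q T δ, φ m = φ' m) : φ = φ' := by
  refine LinearMap.eqLocus_eq_top.1 (h.eq_top_of_signSpace_le hf (fun j hj m hm => ?_) heq)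
  rw [LinearMap.mem_eqLocus] at hm ⊢
  rw [hφ j hj, hφ' j hj, hm]

end IsHeckeB

end Extension

section Letters

theorem mem_I {n : ℕ} {x : ℤ} : x ∈ I n ↔ (-((n / 2 : ℕ) : ℤ) ≤ x ∧ x ≤ ((n / 2 : ℕ) : ℤ)) ∧
    (Even n → x ≠ 0) := by
  rw [I, Finset.mem_filter, Finset.mem_Icc]

theorem card_I (n : ℕ) : (I n).card = n := by
  rcases Nat.even_or_odd' n with ⟨r, rfl | rfl⟩
  · simp only [I, even_two_mul, true_imp_iff, Finset.filter_ne']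
    rw [Finset.card_erase_of_mem (by simp), Int.card_Icc]
    omega
  · simp only [I, Nat.not_even_two_mul_add_one, false_imp_iff, Finset.filter_true, Int.card_Icc]
    omega

theorem card_filter_pos (n : ℕ) : ((I n).filter (0 < ·)).card = n / 2 := by
  suffices (I n).filter (0 < ·) = Finset.Icc 1 ((n / 2 : ℕ) : ℤ) by
    rw [this, Int.card_Icc]
    omega
  ext x
  rw [Finset.mem_filter, mem_I, Finset.mem_Icc]
  omega

theorem card_filter_nonneg (n : ℕ) : ((I n).filter (0 ≤ ·)).card = (n + 1) / 2 := by
  suffices (I n).filter (0 ≤ ·) = Finset.Icc (1 - (n % 2 : ℕ) : ℤ) ((n / 2 : ℕ) : ℤ) by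
    rw [this, Int.card_Icc]
    omega
  ext x
  rw [Finset.mem_filter, mem_I, Finset.mem_Icc, Nat.even_iff]
  omega

/-- The increasing embedding of `I m` into `I n` whose image consists of the letters satisfying
`P`. -/
def letterEmb {m n : ℕ} (P : ℤ → Prop) [DecidablePred P] (h : ((I n).filter P).card = m) :
    I m ↪o I n :=
  (((I m).orderIsoOfFin (card_I m)).symm.trans
    (((I n).filter P).orderIsoOfFin h)).toOrderEmbedding.trans
      (Subtype.orderEmbedding fun _ hx => (Finset.mem_filter.mp hx).1)

theorem exists_letterEmb_eq {m n : ℕ} {P : ℤ → Prop} [DecidablePred P]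
    (h : ((I n).filter P).card = m) {x : I n} (hx : P x) : ∃ y, letterEmb P h y = x :=
  ⟨I m |>.orderIsoOfFin (card_I m) ((((I n).filter P).orderIsoOfFin h).symm
    ⟨x, Finset.mem_filter.mpr ⟨x.2, hx⟩⟩), Subtype.ext (by simp [letterEmb])⟩

end Letters

section Words

open Module

variable {K : Type*} [Field K] {q Q : Kˣ} {n d : ℕ}

/-- The operators `T_0, …, T_{d-1}` on tensor space, indexed by natural numbers; those with index
`d` or larger are zero. -/
def opT (q Q : Kˣ) (n d j : ℕ) : End K (TensorSpace K n d) :=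
  if hj : j < d then opB q Q n d ⟨j, hj⟩ else 0

theorem opT_zero (hd : 0 < d) : opT q Q n d 0 = signOp Q ⟨0, hd⟩ := by
  simp [opT, opB, hd]

theorem opT_succ {k : ℕ} (hk : k + 1 < d) :
    opT q Q n d (k + 1) = swapOp q ⟨k, by omega⟩ ⟨k + 1, hk⟩ := by
  simp [opT, opB, hk]

theorem isHeckeB_opT : IsHeckeB q Q d (opT q Q n d) where
  quadZero hd := by rw [opT_zero hd]; exact signOp_sq _ _
  quad k hk := by rw [opT_succ hk]; exact swapOp_sq _ _ _
  braidZero hd := by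
    rw [opT_zero (by omega), show opT q Q n d 1 = _ from opT_succ (k := 0) hd]
    exact signOp_braid _ _ _ _ (by simp)
  braid k hk := by
    rw [opT_succ (by omega), show opT q Q n d (k + 2) = _ from opT_succ (k := k + 1) hk]
    exact swapOp_braid _ _ _ _ (by simp) (by simp [Fin.ext_iff]; omega) (by simp)
  comm i j hij hj := by
    obtain _ | j := j
    · omega
    obtain _ | i := i
    · rw [opT_zero (by omega), opT_succ hj]
      exact signOp_comm _ _ _ _ _ (by simp [Fin.ext_iff]; omega) (by simp [Fin.ext_iff])
    · rw [opT_succ (by omega), opT_succ hj]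
      apply swapOp_comm <;> simp [Fin.ext_iff] <;> omega

instance : FiniteDimensional K (TensorSpace K n d) :=
  Module.Basis.finiteDimensional_of_finite (v K n d)

theorem finrank_tensorSpace : finrank K (TensorSpace K n d) = n ^ d := by
  rw [finrank_eq_card_basis (v K n d), Fintype.card_fun, Fintype.card_coe, card_I,
    Fintype.card_fin]

theorem swapOp_semiconj {n' d' : ℕ} {a b : Fin d} {a' b' : Fin d'}
    {f : TensorSpace K n' d' →ₗ[K] TensorSpace K n d} {F : (Fin d' → I n') → Fin d → I n}
    (hf : ∀ μ, f (v K n' d' μ) = v K n d (F μ)) (hlt : ∀ μ, F μ a < F μ b ↔ μ a' < μ b')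
    (hswap : ∀ μ, F μ ∘ Equiv.swap a b = F (μ ∘ Equiv.swap a' b')) :
    swapOp q a b ∘ₗ f = f ∘ₗ swapOp q a' b' := by
  have hgt (μ) : F μ b < F μ a ↔ μ b' < μ a' := by
    have := hlt (μ ∘ Equiv.swap a' b')
    rw [← hswap] at this
    simpa using this
  refine (v K n' d').ext fun μ => ?_
  simp only [LinearMap.comp_apply, hf]
  rcases lt_trichotomy (μ a') (μ b') with h | h | h
  · rw [swapOp_lt _ _ _ _ ((hlt μ).mpr h), swapOp_lt _ _ _ _ h, hf, hswap]
  · have hF : F μ a = F μ b := le_antisymm (not_lt.mp fun h' => ((hgt μ).mp h').ne' h)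
      (not_lt.mp fun h' => ((hlt μ).mp h').ne h)
    rw [swapOp_eq _ _ _ _ (congrArg _ hF), swapOp_eq _ _ _ _ (congrArg _ h), map_smul, hf, hswap]
  · rw [swapOp_gt _ _ _ _ ((hgt μ).mpr h), swapOp_gt _ _ _ _ h, map_add, map_smul, hf, hf, hswap]

/-- The concatenation of a word in nonnegative letters and a word in positive letters. -/
def cat (n d i : ℕ) (μ : Fin i → I ((n + 1) / 2)) (ν : Fin (d - i) → I (n / 2)) (p : Fin d) :
    I n :=
  if hp : p.val < i then letterEmb _ (card_filter_nonneg n) (μ ⟨p, hp⟩)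
  else letterEmb _ (card_filter_pos n) (ν ⟨p - i, by omega⟩)

/-- The embedding of `V(⌈n/2⌉)^{⊗ i} ⊗ V(⌊n/2⌋)^{⊗ (d - i)}` into `V(n)^{⊗ d}` that identifies the
letters of the first factor with the nonnegative letters and those of the second with the positive
letters. -/
def emb (K : Type*) [Field K] (n d i : ℕ) :
    TensorSpace K ((n + 1) / 2) i ⊗[K] TensorSpace K (n / 2) (d - i) →ₗ[K] TensorSpace K n d :=
  ((v K ((n + 1) / 2) i).tensorProduct (v K (n / 2) (d - i))).constr K fun p =>
    v K n d (cat n d i p.1 p.2)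

theorem emb_apply (i : ℕ) (μ : Fin i → I ((n + 1) / 2)) (ν : Fin (d - i) → I (n / 2)) :
    emb K n d i (v K _ i μ ⊗ₜ v K _ (d - i) ν) = v K n d (cat n d i μ ν) := by
  rw [emb, ← Basis.tensorProduct_apply, Basis.constr_basis]

theorem cat_comp_swap_left {i k : ℕ} (hi : i ≤ d) (hk : k + 1 < i) (μ : Fin i → I ((n + 1) / 2))
    (ν : Fin (d - i) → I (n / 2)) :
    cat n d i μ ν ∘ Equiv.swap ⟨k, by omega⟩ ⟨k + 1, by omega⟩ =
      cat n d i (μ ∘ Equiv.swap ⟨k, by omega⟩ ⟨k + 1, hk⟩) ν := by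
  funext p
  simp only [Equiv.comp_swap_eq_update, Function.update_apply, cat, Fin.ext_iff]
  split_ifs <;> first | rfl | omega

theorem cat_comp_swap_right {i k : ℕ} (hk : i + k + 1 < d) (μ : Fin i → I ((n + 1) / 2))
    (ν : Fin (d - i) → I (n / 2)) :
    cat n d i μ ν ∘ Equiv.swap ⟨i + k, by omega⟩ ⟨i + k + 1, hk⟩ =
      cat n d i μ (ν ∘ Equiv.swap ⟨k, by omega⟩ ⟨k + 1, by omega⟩) := by
  funext p
  simp only [Equiv.comp_swap_eq_update, Function.update_apply, cat, Fin.ext_iff]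
  split_ifs <;> first | rfl | omega | (congr 3; omega)

theorem opT_emb_left {i k : ℕ} (hi : i ≤ d) (hk : k + 1 < i)
    (z : TensorSpace K ((n + 1) / 2) i ⊗[K] TensorSpace K (n / 2) (d - i)) :
    opT q Q n d (k + 1) (emb K n d i z) =
      emb K n d i (TensorProduct.map (swapOp q ⟨k, by omega⟩ ⟨k + 1, hk⟩) LinearMap.id z) := by
  suffices h : opT q Q n d (k + 1) ∘ₗ emb K n d i = emb K n d i ∘ₗ
      TensorProduct.map (swapOp q ⟨k, by omega⟩ ⟨k + 1, hk⟩) LinearMap.id from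
    LinearMap.congr_fun h z
  refine ((v K ((n + 1) / 2) i).tensorProduct (v K (n / 2) (d - i))).ext fun ⟨μ, ν⟩ => ?_
  have hswap := swapOp_semiconj (q := q)
    (f := emb K n d i ∘ₗ (TensorProduct.mk K _ _).flip (v K _ _ ν))
    (fun μ => emb_apply i μ ν)
    (fun μ => by
      simp only [cat, hk, (Nat.lt_succ_self k).trans hk, dif_pos, OrderEmbedding.lt_iff_lt])
    fun μ => cat_comp_swap_left hi hk μ ν
  rw [opT_succ (by omega), Basis.tensorProduct_apply]
  exact LinearMap.congr_fun hswap (v K _ _ μ)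

theorem opT_emb_right {i k : ℕ} (hk : i + k + 1 < d)
    (z : TensorSpace K ((n + 1) / 2) i ⊗[K] TensorSpace K (n / 2) (d - i)) :
    opT q Q n d (i + k + 1) (emb K n d i z) =
      emb K n d i (TensorProduct.map LinearMap.id
        (swapOp q ⟨k, by omega⟩ ⟨k + 1, by omega⟩) z) := by
  suffices h : opT q Q n d (i + k + 1) ∘ₗ emb K n d i = emb K n d i ∘ₗ
      TensorProduct.map LinearMap.id (swapOp q ⟨k, by omega⟩ ⟨k + 1, by omega⟩) from
    LinearMap.congr_fun h z
  refine ((v K ((n + 1) / 2) i).tensorProduct (v K (n / 2) (d - i))).ext fun ⟨μ, ν⟩ => ?_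
  have hswap := swapOp_semiconj (q := q) (f := emb K n d i ∘ₗ TensorProduct.mk K _ _ (v K _ _ μ))
    (emb_apply i μ)
    (fun ν => by
      simp only [cat, show ¬ i + k < i by omega, show ¬ i + k + 1 < i by omega, dif_neg,
        not_false_eq_true, OrderEmbedding.lt_iff_lt, Nat.add_sub_cancel_left,
        show i + k + 1 - i = k + 1 by omega])
    (cat_comp_swap_right hk μ)
  rw [opT_succ hk, Basis.tensorProduct_apply]
  exact LinearMap.congr_fun hswap (v K _ _ ν)

end Words

section Sorting

open Module

theorem lt_card_filter_iff {d : ℕ} {P : Fin d → Prop} [DecidablePred P] (hP : Antitone P)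
    (p : Fin d) : p.val < (Finset.univ.filter P).card ↔ P p := by
  constructor
  · intro h
    by_contra hp
    refine h.not_ge ((Finset.card_le_card fun r hr => ?_).trans_eq (Fin.card_Iio p))
    rw [Finset.mem_Iio]
    exact lt_of_not_ge fun hpr => hp (hP hpr (Finset.mem_filter.mp hr).2)
  · intro hp
    rw [Nat.lt_iff_add_one_le, ← Fin.card_Iic]
    exact Finset.card_le_card fun r hr =>
      Finset.mem_filter.mpr ⟨Finset.mem_univ r, hP (Finset.mem_Iic.mp hr) hp⟩

variable {K : Type*} [Field K] {q Q : Kˣ} {n d : ℕ}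

/-- The zeros of `μ` are its first `k` letters, and its other letters are positive. -/
def IsSorted (k : ℕ) (μ : Fin d → I n) : Prop :=
  (∀ p : Fin d, p.val < k → (μ p : ℤ) = 0) ∧ ∀ p : Fin d, k ≤ p.val → 0 < (μ p : ℤ)

theorem exists_isSorted_comp_perm {μ : Fin d → I n} (hμ : ∀ p, 0 ≤ (μ p : ℤ)) :
    ∃ k ≤ d, ∃ σ : Equiv.Perm (Fin d), IsSorted k (μ ∘ σ) := by
  set σ := Tuple.sort μ
  have hP : Antitone fun p => (μ (σ p) : ℤ) ≤ 0 := fun p r hpr hr =>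
    le_trans (Tuple.monotone_sort μ hpr) hr
  refine ⟨(Finset.univ.filter fun p => (μ (σ p) : ℤ) ≤ 0).card,
    (Finset.card_le_univ _).trans_eq (Fintype.card_fin d), σ, fun p hp => ?_, fun p hp => ?_⟩
  · exact le_antisymm ((lt_card_filter_iff hP p).mp hp) (hμ _)
  · exact not_le.mp ((lt_card_filter_iff hP p).not.mp hp.not_gt)

variable {G : Submodule K (TensorSpace K n d)} {μ : Fin d → I n}

theorem v_comp_swap_mem {a b : Fin d} (hG : ∀ z ∈ G, swapOp q a b z ∈ G) (hμ : v K n d μ ∈ G) :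
    v K n d (μ ∘ Equiv.swap a b) ∈ G := by
  have h := hG _ hμ
  rcases lt_trichotomy (μ a : ℤ) (μ b) with hab | hab | hab
  · rwa [swapOp_lt _ _ _ _ hab] at h
  · rwa [swapOp_eq _ _ _ _ hab, G.smul_mem_iff (inv_ne_zero q.ne_zero)] at h
  · rwa [swapOp_gt _ _ _ _ hab, G.add_mem_iff_left (G.smul_mem _ hμ)] at h

theorem v_update_neg_mem {a : Fin d} (hG : ∀ z ∈ G, signOp Q a z ∈ G) (hμ : v K n d μ ∈ G) :
    v K n d (Function.update μ a (neg (μ a))) ∈ G := by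
  have h := hG _ hμ
  rcases lt_trichotomy (μ a : ℤ) 0 with ha | ha | ha
  · rwa [signOp_neg _ _ _ ha, G.add_mem_iff_left (G.smul_mem _ hμ)] at h
  · rwa [signOp_zero _ _ _ ha, G.smul_mem_iff (inv_ne_zero Q.ne_zero)] at h
  · rwa [signOp_pos _ _ _ ha] at h

section HeckeStable

variable (hG : ∀ j < d, ∀ z ∈ G, opT q Q n d j z ∈ G)
include hG

theorem v_comp_perm_mem (σ : Equiv.Perm (Fin d)) (hμ : v K n d μ ∈ G) :
    v K n d (μ ∘ σ) ∈ G := by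
  obtain _ | d := d
  · rwa [Subsingleton.elim (μ ∘ σ) μ]
  have hσ : σ ∈ Submonoid.closure (Set.range fun i : Fin d => Equiv.swap i.castSucc i.succ) :=
    Equiv.Perm.mclosure_swap_castSucc_succ d ▸ Submonoid.mem_top σ
  induction hσ using Submonoid.closure_induction generalizing μ with
  | mem σ hσ =>
    obtain ⟨i, rfl⟩ := hσ
    have hi : i.val + 1 < d + 1 := by omega
    exact v_comp_swap_mem (fun z hz => opT_succ (q := q) (Q := Q) hi ▸ hG _ hi z hz) hμ
  | one => exact hμ
  | mul σ τ _ _ ihσ ihτ =>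
    rw [Equiv.Perm.coe_mul, ← Function.comp_assoc]
    exact ihτ (ihσ hμ)

theorem v_update_neg_mem_of_stable (p : Fin d) (hμ : v K n d μ ∈ G) :
    v K n d (Function.update μ p (neg (μ p))) ∈ G := by
  set σ := Equiv.swap ⟨0, p.pos⟩ p
  have hsign : ∀ z ∈ G, signOp Q ⟨0, p.pos⟩ z ∈ G := fun z hz =>
    opT_zero (q := q) (Q := Q) p.pos ▸ hG 0 p.pos z hz
  have h : v K n d (Function.update (μ ∘ σ) ⟨0, p.pos⟩ (neg ((μ ∘ σ) ⟨0, p.pos⟩)) ∘ σ) ∈ G :=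
    v_comp_perm_mem hG σ (v_update_neg_mem hsign (v_comp_perm_mem hG σ hμ))
  convert h using 2
  rw [Function.update_comp_equiv, Function.comp_assoc]
  simp [σ, ← Equiv.Perm.coe_mul]

theorem v_piecewise_neg_mem (s : Finset (Fin d)) (hμ : v K n d μ ∈ G) :
    v K n d (s.piecewise (fun p => neg (μ p)) μ) ∈ G := by
  induction s using Finset.induction_on with
  | empty => rwa [Finset.piecewise_empty]
  | insert a s ha ih =>
    have h := v_update_neg_mem_of_stable hG a ih
    rwa [Finset.piecewise_eq_of_notMem _ _ _ ha, ← Finset.piecewise_insert] at h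

theorem eq_top_of_isSorted_mem
    (hsorted : ∀ k ≤ d, ∀ μ : Fin d → I n, IsSorted k μ → v K n d μ ∈ G) : G = ⊤ := by
  rw [eq_top_iff, ← (v K n d).span_eq, Submodule.span_le]
  rintro _ ⟨μ, rfl⟩
  set s := Finset.univ.filter fun p => (μ p : ℤ) < 0 with hs
  set ν := s.piecewise (fun p => neg (μ p)) μ with hν
  have hν0 (p) : 0 ≤ (ν p : ℤ) := by
    simp only [hν, hs, Finset.piecewise, Finset.mem_filter, Finset.mem_univ, true_and]
    split_ifs with hp
    · rw [coe_neg]; omega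
    · exact not_lt.mp hp
  obtain ⟨k, hk, σ, hσ⟩ := exists_isSorted_comp_perm hν0
  have hνG : v K n d ν ∈ G := by
    have h := v_comp_perm_mem hG σ⁻¹ (hsorted k hk _ hσ)
    rwa [Function.comp_assoc, ← Equiv.Perm.coe_mul, mul_inv_cancel] at h
  have hμ : μ = s.piecewise (fun p => neg (ν p)) ν := by
    funext p
    by_cases hp : p ∈ s <;> simp [hν, hp]
  rw [hμ]
  exact v_piecewise_neg_mem hG s hνG

end HeckeStable

end Sorting

section InitialSigns

variable {d : ℕ}

/-- The sign sequence with `i` plus signs followed by minus signs. -/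
def initialSign (d i : ℕ) : Fin d → Bool := fun p => decide (p.val < i)

/-- The number of plus signs of `δ`. -/
def plusCount (δ : Fin d → Bool) : ℕ := (Finset.univ.filter (δ · = true)).card

theorem antitone_initialSign (i : ℕ) : Antitone (initialSign d i) := fun _ _ hpr =>
  Bool.le_iff_imp.2 fun hr => decide_eq_true (lt_of_le_of_lt hpr (of_decide_eq_true hr))

theorem initialSign_eq_initialSign {i k : ℕ} (hk : k + 1 < d) (hki : k + 1 ≠ i) :
    initialSign d i ⟨k, by omega⟩ = initialSign d i ⟨k + 1, hk⟩ :=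
  decide_eq_decide.2 (by dsimp; omega)

theorem succ_ne_of_initialSign_eq {i k : ℕ} (hk : k + 1 < d)
    (heq : initialSign d i ⟨k, by omega⟩ = initialSign d i ⟨k + 1, hk⟩) : k + 1 ≠ i := by
  rintro rfl
  simp [initialSign] at heq

theorem plusCount_le (δ : Fin d → Bool) : plusCount δ ≤ d :=
  (Finset.card_le_univ _).trans_eq (Fintype.card_fin d)

theorem plusCount_initialSign {i : ℕ} (hi : i ≤ d) : plusCount (initialSign d i) = i := by
  rw [plusCount]
  simp only [initialSign, decide_eq_true_eq]
  exact Fin.card_filter_val_lt.trans (min_eq_right hi)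

theorem initialSign_plusCount {δ : Fin d → Bool} (hδ : Antitone δ) :
    initialSign d (plusCount δ) = δ := by
  have hP : Antitone fun p => δ p = true := fun _ _ hpr => Bool.le_iff_imp.1 (hδ hpr)
  funext p
  rw [initialSign, plusCount, Bool.eq_iff_iff, decide_eq_true_iff]
  exact lt_card_filter_iff hP p

theorem plusCount_comp (δ : Fin d → Bool) (σ : Equiv.Perm (Fin d)) :
    plusCount (δ ∘ σ) = plusCount δ :=
  Finset.card_equiv σ (by simp)

end InitialSigns

section SignProjections

open Module Module.End

variable {K : Type*} [Field K] {d : ℕ} {q Q : Kˣ}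
  {M : Type*} [AddCommGroup M] [Module K M] {T : ℕ → End K M}

theorem commute_projection {U W : Submodule K M} (hUW : IsCompl U W) {f : End K M}
    (hU : ∀ m ∈ U, f m ∈ U) (hW : ∀ m ∈ W, f m ∈ W) : Commute (U.projection W hUW) f := by
  refine (LinearMap.IsIdempotentElem.commute_iff (Submodule.isIdempotentElem_projection hUW)).2
    ⟨?_, ?_⟩
  · rwa [Submodule.range_projection]
  · rwa [Submodule.ker_projection]

namespace IsHeckeB

variable (h : IsHeckeB q Q d T) [FiniteDimensional K M] (hf : IsUnit (fB q Q d))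
include h hf

theorem isCompl_signSpace (δ : Fin d → Bool) :
    IsCompl (signSpace q Q T δ) (⨆ (γ : Fin d → Bool) (_ : γ ≠ δ), signSpace q Q T γ) :=
  ⟨h.iSupIndep_signSpace hf δ, codisjoint_iff.2 <| by
    rw [← iSup_split_single (fun γ => signSpace q Q T γ) δ, h.iSup_signSpace]⟩

/-- The projection onto the sign space of `δ` along the other sign spaces. -/
def signProj (δ : Fin d → Bool) : End K M :=
  (signSpace q Q T δ).projection _ (h.isCompl_signSpace hf δ)

theorem signProj_mem (δ : Fin d → Bool) (m : M) : h.signProj hf δ m ∈ signSpace q Q T δ :=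
  Submodule.projection_apply_mem _ m

theorem signProj_of_mem {δ : Fin d → Bool} {m : M} (hm : m ∈ signSpace q Q T δ) :
    h.signProj hf δ m = m :=
  Submodule.projection_apply_of_mem_left _ hm

theorem commute_signProj_jucysMurphy (δ : Fin d → Bool) {j : ℕ} (hj : j < d) :
    Commute (h.signProj hf δ) (jucysMurphy T j) := by
  refine commute_projection _ (fun m hm => h.jucysMurphy_mem_signSpace hm hj) fun m hm => ?_
  suffices hle : (⨆ (γ : Fin d → Bool) (_ : γ ≠ δ), signSpace q Q T γ) ≤
    (⨆ (γ : Fin d → Bool) (_ : γ ≠ δ), signSpace q Q T γ).comap (jucysMurphy T j) from hle hm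
  exact iSup₂_le fun γ hγ m hm =>
    le_iSup₂_of_le (f := fun (γ : Fin d → Bool) (_ : γ ≠ δ) => signSpace q Q T γ) γ hγ le_rfl
      (h.jucysMurphy_mem_signSpace hm hj)

theorem commute_signProj_apply {δ : Fin d → Bool} {k : ℕ} (hk : k + 1 < d)
    (hδ : δ ⟨k, by omega⟩ = δ ⟨k + 1, hk⟩) : Commute (h.signProj hf δ) (T (k + 1)) := by
  refine commute_projection _ (fun m hm => h.apply_mem_signSpace hf hk hδ hm) fun m hm => ?_
  suffices hle : (⨆ (γ : Fin d → Bool) (_ : γ ≠ δ), signSpace q Q T γ) ≤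
    (⨆ (γ : Fin d → Bool) (_ : γ ≠ δ), signSpace q Q T γ).comap (T (k + 1)) from hle hm
  refine iSup₂_le fun γ hγ m hm => ?_
  have hγ' : γ ∘ adjSwap k hk ≠ δ := by
    rintro rfl
    exact hγ (by rw [← comp_adjSwap_of_eq hk hδ, comp_adjSwap_comp_adjSwap])
  have hle : signSpace q Q T γ ⊔ signSpace q Q T (γ ∘ adjSwap k hk) ≤
      ⨆ (γ : Fin d → Bool) (_ : γ ≠ δ), signSpace q Q T γ :=
    sup_le (le_iSup₂_of_le γ hγ le_rfl) (le_iSup₂_of_le _ hγ' le_rfl)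
  exact hle (h.apply_mem_sup_signSpace hf hk hm)

end IsHeckeB

end SignProjections

section JucysMurphyClosure

open Module Module.End

variable {K : Type*} [Field K] {d : ℕ} {q Q : Kˣ}
  {M : Type*} [AddCommGroup M] [Module K M] {T : ℕ → End K M}

/-- The smallest subspace containing `W` and stable under the Jucys–Murphy elements. -/
def jucysMurphyClosure (d : ℕ) (T : ℕ → End K M) (W : Submodule K M) : Submodule K M :=
  sInf {N | W ≤ N ∧ ∀ j < d, ∀ m ∈ N, jucysMurphy T j m ∈ N}

theorem le_jucysMurphyClosure (W : Submodule K M) : W ≤ jucysMurphyClosure d T W :=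
  le_sInf fun _ hN => hN.1

theorem jucysMurphyClosure_le {W N : Submodule K M} (hWN : W ≤ N)
    (hN : ∀ j < d, ∀ m ∈ N, jucysMurphy T j m ∈ N) : jucysMurphyClosure d T W ≤ N :=
  sInf_le ⟨hWN, hN⟩

theorem jucysMurphy_mem_jucysMurphyClosure {W : Submodule K M} {j : ℕ} (hj : j < d) {m : M}
    (hm : m ∈ jucysMurphyClosure d T W) : jucysMurphy T j m ∈ jucysMurphyClosure d T W :=
  Submodule.mem_sInf.2 fun N hN => hN.2 j hj m (Submodule.mem_sInf.1 hm N hN)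

namespace IsHeckeB

variable (h : IsHeckeB q Q d T)
include h

theorem apply_mem_jucysMurphyClosure {W : Submodule K M} {k : ℕ} (hk : k + 1 < d)
    (hW : ∀ w ∈ W, T (k + 1) w ∈ W) {m : M} (hm : m ∈ jucysMurphyClosure d T W) :
    T (k + 1) m ∈ jucysMurphyClosure d T W := by
  set N := jucysMurphyClosure d T W
  suffices hle : N ≤ N ⊓ N.comap (T (k + 1)) from (hle hm).2
  refine jucysMurphyClosure_le
    (le_inf (le_jucysMurphyClosure W) fun w hw => le_jucysMurphyClosure W (hW w hw)) ?_
  rintro j hj m ⟨hm, hTm : T (k + 1) m ∈ N⟩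
  refine ⟨jucysMurphy_mem_jucysMurphyClosure hj hm, ?_⟩
  change (T (k + 1) * jucysMurphy T j) m ∈ N
  have hL : jucysMurphy T (k + 1) m ∈ N := jucysMurphy_mem_jucysMurphyClosure hk hm
  by_cases h0 : j = k
  · subst h0
    rw [h.mul_jucysMurphy hk]
    exact sub_mem (jucysMurphy_mem_jucysMurphyClosure hk hTm) (Submodule.smul_mem _ _ hL)
  by_cases h1 : j = k + 1
  · subst h1
    rw [h.mul_jucysMurphy_succ hk]
    exact add_mem (Submodule.smul_mem _ _ hL)
      (jucysMurphy_mem_jucysMurphyClosure (by omega) hTm)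
  · rw [(h.commute_jucysMurphy hk hj h0 h1).eq]
    exact jucysMurphy_mem_jucysMurphyClosure hj hTm

variable [FiniteDimensional K M] (hf : IsUnit (fB q Q d))
include hf

theorem eq_true_of_jucysMurphy_apply {k : ℕ} {δ : Fin d → Bool} {m : M} (hm0 : m ≠ 0)
    (hm : m ∈ signSpace q Q T δ)
    (hmk : ∀ j < k, j < d → jucysMurphy T j m = contentValue q Q true (-j) • m)
    (p : Fin d) (hp : p.val < k) : δ p = true := by
  induction p using WellFoundedLT.induction with
  | _ p ih =>
    by_contra hδp
    rw [Bool.not_eq_true] at hδp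
    have hLm := h.jucysMurphy_apply_of_forall_lt hf p.2 (fun j hj => by
      rw [ih j hj (lt_trans hj hp), hδp]
      decide) hm
    rw [hmk p hp p.2, hδp] at hLm
    refine contentValue_ne hf (by decide) ?_ (smul_left_injective K hm0 hLm)
    rw [sub_zero, abs_neg, Nat.abs_cast]
    exact_mod_cast p.2

/-- Moving the plus signs of `δ` to the front never involves the first `k` places, because the
sign spaces that meet `N` start with `k` plus signs. -/
theorem le_of_inf_signSpace_le {k : ℕ} (hk : k ≤ d) {G N : Submodule K M}
    (hG : ∀ j < d, ∀ m ∈ G, T j m ∈ G) (hN : ∀ j < d, ∀ m ∈ N, jucysMurphy T j m ∈ N)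
    (hNT : ∀ l, k ≤ l → l + 1 < d → ∀ m ∈ N, T (l + 1) m ∈ N)
    (hNk : ∀ m ∈ N, ∀ j < k, j < d → jucysMurphy T j m = contentValue q Q true (-j) • m)
    (hanti : ∀ i ≤ d, k ≤ i → N ⊓ signSpace q Q T (initialSign d i) ≤ G) : N ≤ G := by
  have hsign {δ : Fin d → Bool} {m : M} (hm : m ∈ N ⊓ signSpace q Q T δ) (hm0 : m ≠ 0) :
      ∀ p : Fin d, p.val < k → δ p = true :=
    h.eq_true_of_jucysMurphy_apply hf hm0 hm.2 (hNk m hm.1)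
  refine (h.le_iSup_inf_signSpace hN).trans (iSup_le fun δ => ?_)
  induction δ using sign_induction with
  | anti δ hδ =>
    intro m hm
    by_cases hm0 : m = 0
    · exact hm0 ▸ zero_mem G
    obtain ⟨i, hi, rfl⟩ : ∃ i ≤ d, initialSign d i = δ :=
      ⟨_, plusCount_le δ, initialSign_plusCount hδ⟩
    refine hanti i hi (not_lt.1 fun hik => ?_) hm
    simpa [initialSign] using hsign hm hm0 ⟨i, by omega⟩ hik
  | step δ l hl ih =>
    by_cases hbot : N ⊓ signSpace q Q T δ = ⊥
    · exact hbot ▸ bot_le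
    obtain ⟨m, hm, hm0⟩ := Submodule.exists_mem_ne_zero_of_ne_bot hbot
    have hkl : k ≤ l := not_lt.1 fun hlk =>
      Bool.false_ne_true (hl.2.1.symm.trans (hsign hm hm0 _ hlk))
    refine (h.le_map_intertwiner_mul_self hf hl.1 hl.ne inf_le_right fun j hj m hm =>
      ⟨hN j hj m hm.1, h.jucysMurphy_mem_signSpace hm.2 hj⟩).trans ?_
    rintro _ ⟨m, ⟨hmN, hmδ⟩, rfl⟩
    have hφN : intertwiner q T l m ∈ N := by
      have hL := hN (l + 1) hl.1 m hmN
      rw [intertwiner_apply]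
      exact add_mem (hNT l hkl hl.1 _ (sub_mem (hN l (by have := hl.1; omega) m hmN) hL))
        (Submodule.smul_mem _ _ hL)
    exact intertwiner_mem_of_forall_apply_mem hG hl.1
      (ih ⟨hφN, h.intertwiner_mem_signSpace hf hmδ hl.1⟩)

end IsHeckeB

end JucysMurphyClosure

section SortedWords

open Module

variable {K : Type*} [Field K] {q Q : Kˣ} {n d : ℕ} {k : ℕ}

/-- The span of the basis vectors of the sorted words with `k` zeros. -/
def sortedSpan (K : Type*) [Field K] (n d k : ℕ) : Submodule K (TensorSpace K n d) :=
  Submodule.span K (v K n d '' {μ | IsSorted k μ})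

theorem IsSorted.v_mem_sortedSpan {μ : Fin d → I n} (hμ : IsSorted k μ) :
    v K n d μ ∈ sortedSpan K n d k :=
  Submodule.subset_span ⟨μ, hμ, rfl⟩

theorem sortedSpan_le {W : Submodule K (TensorSpace K n d)}
    (hW : ∀ μ : Fin d → I n, IsSorted k μ → v K n d μ ∈ W) : sortedSpan K n d k ≤ W :=
  Submodule.span_le.2 (Set.image_subset_iff.2 hW)

theorem IsSorted.comp_adjSwap {l : ℕ} {μ : Fin d → I n} (hμ : IsSorted k μ) (hl : l + 1 < d)
    (hkl : k ≤ l) : IsSorted k (μ ∘ adjSwap l hl) := by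
  refine ⟨fun p hp => ?_, fun p hp => hμ.2 _ ?_⟩
  · rw [comp_adjSwap_of_ne μ hl (by omega) (by omega)]
    exact hμ.1 p hp
  · by_cases h0 : (p : ℕ) = l
    · have hp' : p = ⟨l, by omega⟩ := Fin.ext h0
      rw [hp', adjSwap, Equiv.swap_apply_left]
      exact Nat.le_succ_of_le hkl
    by_cases h1 : (p : ℕ) = l + 1
    · have hp' : p = ⟨l + 1, hl⟩ := Fin.ext h1
      rw [hp', adjSwap, Equiv.swap_apply_right]
      exact hkl
    · rwa [adjSwap_apply_of_ne hl h0 h1]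

theorem opT_mem_sortedSpan {l : ℕ} (hl : l + 1 < d) (hkl : k ≤ l) {w : TensorSpace K n d}
    (hw : w ∈ sortedSpan K n d k) : opT q Q n d (l + 1) w ∈ sortedSpan K n d k := by
  suffices hle : sortedSpan K n d k ≤ (sortedSpan K n d k).comap (opT q Q n d (l + 1)) from hle hw
  refine sortedSpan_le fun μ hμ => ?_
  have hμl : v K n d (μ ∘ adjSwap l hl) ∈ sortedSpan K n d k :=
    (hμ.comp_adjSwap hl hkl).v_mem_sortedSpan
  rw [Submodule.mem_comap, opT_succ hl]
  rcases lt_trichotomy (μ ⟨l, by omega⟩ : ℤ) (μ ⟨l + 1, hl⟩) with hlt | heq | hgt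
  · rwa [swapOp_lt _ _ _ _ hlt]
  · rw [swapOp_eq _ _ _ _ heq]
    exact Submodule.smul_mem _ _ hμl
  · rw [swapOp_gt _ _ _ _ hgt]
    exact add_mem hμl (Submodule.smul_mem _ _ hμ.v_mem_sortedSpan)

theorem opT_zero_apply_of_isSorted {μ : Fin d → I n} (hμ : IsSorted k μ) (hk : 0 < k)
    (hd : 0 < d) : opT q Q n d 0 (v K n d μ) = (Q : K)⁻¹ • v K n d μ := by
  have h0 : (μ ⟨0, hd⟩ : ℤ) = 0 := hμ.1 _ hk
  have hneg : neg (μ ⟨0, hd⟩) = μ ⟨0, hd⟩ := Subtype.ext (by rw [coe_neg, h0, neg_zero])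
  rw [opT_zero hd, signOp_zero _ _ _ h0, hneg, Function.update_eq_self]

theorem opT_succ_apply_of_isSorted {μ : Fin d → I n} (hμ : IsSorted k μ) {j : ℕ} (hjk : j + 1 < k)
    (hj : j + 1 < d) : opT q Q n d (j + 1) (v K n d μ) = (q : K)⁻¹ • v K n d μ := by
  have heq : μ ⟨j, by omega⟩ = μ ⟨j + 1, hj⟩ := Subtype.ext
    ((hμ.1 ⟨j, by omega⟩ (Nat.lt_of_succ_lt hjk)).trans (hμ.1 ⟨j + 1, hj⟩ hjk).symm)
  rw [opT_succ hj, swapOp_eq _ _ _ _ (congrArg _ heq)]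
  exact congrArg (fun ν => (q : K)⁻¹ • v K n d ν) (comp_adjSwap_of_eq hj heq)

theorem jucysMurphy_apply_of_isSorted {μ : Fin d → I n} (hμ : IsSorted k μ) {j : ℕ} (hjk : j < k)
    (hj : j < d) :
    jucysMurphy (opT q Q n d) j (v K n d μ) = contentValue q Q true (-j) • v K n d μ := by
  induction j with
  | zero =>
    rw [jucysMurphy, opT_zero_apply_of_isSorted hμ hjk hj]
    simp [contentValue]
  | succ j ih =>
    have hT := opT_succ_apply_of_isSorted (q := q) (Q := Q) hμ hjk hj
    have hqq : (q : K) ^ (2 * (-1) : ℤ) = (q : K)⁻¹ * (q : K)⁻¹ := by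
      rw [mul_neg, mul_one, zpow_neg, zpow_two, mul_inv]
    rw [jucysMurphy, End.mul_apply, End.mul_apply, hT, map_smul, ih (by omega) (by omega),
      map_smul, map_smul, hT, smul_smul, smul_smul, mul_right_comm, ← hqq, contentValue_mul_zpow,
      Nat.cast_succ, neg_add]

theorem IsSorted.v_mem_range_emb {i : ℕ} (hi : i ≤ d) (hki : k ≤ i) {μ : Fin d → I n}
    (hμ : IsSorted k μ) : v K n d μ ∈ LinearMap.range (emb K n d i) := by
  have hnonneg (p : Fin d) : 0 ≤ (μ p : ℤ) :=
    (lt_or_ge p.val k).elim (fun hp => (hμ.1 p hp).ge) fun hp => (hμ.2 p hp).le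
  choose f hf using fun p : Fin d => exists_letterEmb_eq (card_filter_nonneg n) (hnonneg p)
  choose g hg using fun p : {p : Fin d // k ≤ p.val} =>
    exists_letterEmb_eq (card_filter_pos n) (hμ.2 p p.2)
  refine ⟨v K _ i (fun p => f ⟨p, by omega⟩) ⊗ₜ
    v K _ (d - i) (fun p => g ⟨⟨i + p, by omega⟩, hki.trans (Nat.le_add_right i p)⟩), ?_⟩
  rw [emb_apply]
  congr 1
  funext p
  unfold cat
  split_ifs with hp
  · exact hf p
  · rw [hg]
    exact congrArg μ (Fin.ext (Nat.add_sub_cancel' (not_lt.1 hp)))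

end SortedWords

section Surjectivity

open Module

variable {K : Type*} [Field K] {q Q : Kˣ} {n d : ℕ} (hf : IsUnit (fB q Q d))

/-- The map from `V(⌈n/2⌉)^{⊗ i} ⊗ V(⌊n/2⌋)^{⊗ (d - i)}` to the sign space of the sequence with `i`
plus signs followed by minus signs. -/
def embSign (hf : IsUnit (fB q Q d)) (n i : ℕ) :
    TensorSpace K ((n + 1) / 2) i ⊗[K] TensorSpace K (n / 2) (d - i) →ₗ[K] TensorSpace K n d :=
  isHeckeB_opT.signProj hf (initialSign d i) ∘ₗ emb K n d i

theorem embSign_mem (i : ℕ)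
    (z : TensorSpace K ((n + 1) / 2) i ⊗[K] TensorSpace K (n / 2) (d - i)) :
    embSign hf n i z ∈ signSpace q Q (opT q Q n d) (initialSign d i) :=
  isHeckeB_opT.signProj_mem hf _ _

theorem opT_embSign_left {i k : ℕ} (hi : i ≤ d) (hk : k + 1 < i)
    (z : TensorSpace K ((n + 1) / 2) i ⊗[K] TensorSpace K (n / 2) (d - i)) :
    opT q Q n d (k + 1) (embSign hf n i z) =
      embSign hf n i (TensorProduct.map (swapOp q ⟨k, by omega⟩ ⟨k + 1, hk⟩) LinearMap.id z) := by
  have hcomm := isHeckeB_opT.commute_signProj_apply hf (M := TensorSpace K n d) (hk.trans_le hi)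
    (initialSign_eq_initialSign (hk.trans_le hi) hk.ne)
  rw [embSign, LinearMap.comp_apply, LinearMap.comp_apply, ← opT_emb_left (q := q) (Q := Q) hi hk]
  exact (LinearMap.congr_fun hcomm.eq _).symm

theorem opT_embSign_right {i k : ℕ} (hk : i + k + 1 < d)
    (z : TensorSpace K ((n + 1) / 2) i ⊗[K] TensorSpace K (n / 2) (d - i)) :
    opT q Q n d (i + k + 1) (embSign hf n i z) =
      embSign hf n i (TensorProduct.map LinearMap.id
        (swapOp q ⟨k, by omega⟩ ⟨k + 1, by omega⟩) z) := by
  have hcomm := isHeckeB_opT.commute_signProj_apply hf (M := TensorSpace K n d) hk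
    (initialSign_eq_initialSign (i := i) hk (by omega))
  rw [embSign, LinearMap.comp_apply, LinearMap.comp_apply, ← opT_emb_right (q := q) (Q := Q) hk]
  exact (LinearMap.congr_fun hcomm.eq _).symm

theorem opT_mem_range_embSign {i : ℕ} (hi : i ≤ d) {k : ℕ} (hk : k + 1 < d) (hki : k + 1 ≠ i)
    {z : TensorSpace K n d} (hz : z ∈ LinearMap.range (embSign hf n i)) :
    opT q Q n d (k + 1) z ∈ LinearMap.range (embSign hf n i) := by
  obtain ⟨w, rfl⟩ := hz
  obtain hlt | hge := lt_or_ge (k + 1) i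
  · exact ⟨_, (opT_embSign_left hf hi hlt w).symm⟩
  · obtain ⟨l, rfl⟩ : ∃ l, k = i + l := ⟨k - i, by omega⟩
    exact ⟨_, (opT_embSign_right hf hk w).symm⟩

/-- The left-hand side is generated from vectors in the range of `emb` by the Jucys–Murphy
elements, and these preserve the range of `embSign`. -/
theorem jucysMurphyClosure_sortedSpan_inf_signSpace_le {i k : ℕ} (hi : i ≤ d) (hki : k ≤ i) :
    jucysMurphyClosure d (opT q Q n d) (sortedSpan K n d k) ⊓
      signSpace q Q (opT q Q n d) (initialSign d i) ≤ LinearMap.range (embSign hf n i) := by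
  have h : IsHeckeB q Q d (opT q Q n d) := isHeckeB_opT
  rintro m ⟨hm, hmδ⟩
  rw [← h.signProj_of_mem hf hmδ]
  suffices hle : jucysMurphyClosure d (opT q Q n d) (sortedSpan K n d k) ≤
    (LinearMap.range (embSign hf n i)).comap (h.signProj hf (initialSign d i)) from hle hm
  refine jucysMurphyClosure_le (sortedSpan_le fun μ hμ => ?_) fun j hj m hm => ?_
  · obtain ⟨z, hz⟩ := hμ.v_mem_range_emb (K := K) hi hki
    rw [Submodule.mem_comap, ← hz]
    exact LinearMap.mem_range_self (embSign hf n i) z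
  · rw [Submodule.mem_comap, ← End.mul_apply, (h.commute_signProj_jucysMurphy hf _ hj).eq]
    refine h.jucysMurphy_mem_of_antitone hf (antitone_initialSign i) ?_ ?_ hj hm
    · rintro _ ⟨z, rfl⟩
      exact embSign_mem hf i z
    · exact fun k hk heq w hw =>
        opT_mem_range_embSign hf hi hk (succ_ne_of_initialSign_eq hk heq) hw

theorem v_mem_of_isSorted {G : Submodule K (TensorSpace K n d)}
    (hG : ∀ j < d, ∀ z ∈ G, opT q Q n d j z ∈ G)
    (hGi : ∀ i ≤ d, LinearMap.range (embSign hf n i) ≤ G) {k : ℕ} (hk : k ≤ d)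
    {μ : Fin d → I n} (hμ : IsSorted k μ) : v K n d μ ∈ G := by
  have h : IsHeckeB q Q d (opT q Q n d) := isHeckeB_opT
  set N := jucysMurphyClosure d (opT q Q n d) (sortedSpan K n d k)
  have hNk : N ≤ ⨅ (j : Fin d) (_ : j.val < k),
      End.eigenspace (jucysMurphy (opT q Q n d) j) (contentValue q Q true (-(j : ℤ))) := by
    refine jucysMurphyClosure_le (sortedSpan_le fun μ hμ => ?_) fun j hj m hm => ?_
    · simp only [Submodule.mem_iInf, End.mem_eigenspace_iff]
      exact fun j hjk => jucysMurphy_apply_of_isSorted hμ hjk j.2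
    · simp only [Submodule.mem_iInf] at hm ⊢
      exact fun i hik => End.mapsTo_genEigenspace_of_comm (h.jucysMurphy_commute i.2 hj) _ _
        (hm i hik)
  refine h.le_of_inf_signSpace_le (N := N) hf hk hG
    (fun j hj m hm => jucysMurphy_mem_jucysMurphyClosure hj hm)
    (fun l hkl hl m hm => h.apply_mem_jucysMurphyClosure hl
      (fun w hw => opT_mem_sortedSpan hl hkl hw) hm)
    (fun m hm j hjk hj => ?_)
    (fun i hi hki => (jucysMurphyClosure_sortedSpan_inf_signSpace_le hf hi hki).trans (hGi i hi))
    (le_jucysMurphyClosure _ hμ.v_mem_sortedSpan)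
  have hmk := hNk hm
  simp only [Submodule.mem_iInf, End.mem_eigenspace_iff] at hmk
  exact hmk ⟨j, hj⟩ hjk

theorem range_embSign {i : ℕ} (hi : i ≤ d) :
    LinearMap.range (embSign hf n i) = signSpace q Q (opT q Q n d) (initialSign d i) := by
  have h : IsHeckeB q Q d (opT q Q n d) := isHeckeB_opT
  obtain ⟨G, hG, hGδ⟩ := h.exists_inf_signSpace_eq hf
    (Z := fun δ => LinearMap.range (embSign hf n (plusCount δ)))
    (fun δ hδ => by
      rintro _ ⟨z, rfl⟩
      exact (congrArg (signSpace q Q (opT q Q n d)) (initialSign_plusCount hδ)).le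
        (embSign_mem hf (plusCount δ) z))
    (fun δ hδ k hk heq z hz => opT_mem_range_embSign hf (plusCount_le δ) hk
      (succ_ne_of_initialSign_eq hk (by rwa [initialSign_plusCount hδ])) hz)
  have hGi (i : ℕ) (hi : i ≤ d) : G ⊓ signSpace q Q (opT q Q n d) (initialSign d i) =
      LinearMap.range (embSign hf n i) := by
    rw [hGδ _ (antitone_initialSign i), plusCount_initialSign hi]
  have htop : G = ⊤ := eq_top_of_isSorted_mem hG fun k hk μ hμ =>
    v_mem_of_isSorted hf hG (fun i hi => (hGi i hi).ge.trans inf_le_left) hk hμ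
  rw [← hGi i hi, htop, top_inf_eq]

end Surjectivity

section Injectivity

open Module

variable {K : Type*} [Field K] {q Q : Kˣ} {n d : ℕ} (hf : IsUnit (fB q Q d))
include hf

theorem finrank_signSpace_le (δ : Fin d → Bool) :
    finrank K (signSpace q Q (opT q Q n d) δ) ≤
      ((n + 1) / 2) ^ plusCount δ * (n / 2) ^ (d - plusCount δ) := by
  have h : IsHeckeB q Q d (opT q Q n d) := isHeckeB_opT
  induction δ using sign_induction with
  | anti δ hδ =>
    rw [← initialSign_plusCount hδ, ← range_embSign hf (plusCount_le δ), initialSign_plusCount hδ]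
    refine (LinearMap.finrank_range_le _).trans ?_
    rw [finrank_tensorProduct, finrank_tensorSpace, finrank_tensorSpace]
  | step δ k hk ih =>
    rw [plusCount_comp] at ih
    have hle : signSpace q Q (opT q Q n d) δ ≤
        (signSpace q Q (opT q Q n d) (δ ∘ adjSwap k hk.1)).map (intertwiner q (opT q Q n d) k) :=
      fun m hm => h.exists_intertwiner_eq hf hk.1 hk.ne hm
    exact (Submodule.finrank_mono hle).trans ((Submodule.finrank_map_le _ _).trans ih)

omit hf in
theorem sum_pow_plusCount_mul_pow (a b d : ℕ) :
    ∑ δ : Fin d → Bool, a ^ plusCount δ * b ^ (d - plusCount δ) = (a + b) ^ d := by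
  have hprod (δ : Fin d → Bool) : a ^ plusCount δ * b ^ (d - plusCount δ) =
      ∏ p : Fin d, if δ p = true then a else b := by
    have hcard := Finset.card_filter_add_card_filter_not (s := (Finset.univ : Finset (Fin d)))
      (fun p => δ p = true)
    rw [Finset.card_univ, Fintype.card_fin] at hcard
    rw [Finset.prod_ite, Finset.prod_const, Finset.prod_const, plusCount,
      ← Nat.eq_sub_of_add_eq' hcard]
  have hsum := Finset.prod_univ_sum (fun _ : Fin d => (Finset.univ : Finset Bool))
    (fun _ s => if s = true then a else b)
  rw [Fintype.piFinset_univ] at hsum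
  rw [Finset.sum_congr rfl fun δ _ => hprod δ, ← hsum]
  simp

theorem sum_finrank_signSpace :
    ∑ δ : Fin d → Bool, finrank K (signSpace q Q (opT q Q n d) δ) = n ^ d := by
  have h : IsHeckeB q Q d (opT q Q n d) := isHeckeB_opT
  rw [← finrank_tensorSpace (K := K), ← Module.finrank_directSum]
  have hinternal := (DirectSum.isInternal_submodule_iff_iSupIndep_and_iSup_eq_top _).2
    ⟨h.iSupIndep_signSpace hf, h.iSup_signSpace⟩
  exact (LinearEquiv.ofBijective (DirectSum.coeLinearMap (signSpace q Q (opT q Q n d)))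
    hinternal).finrank_eq

theorem finrank_signSpace (δ : Fin d → Bool) :
    finrank K (signSpace q Q (opT q Q n d) δ) =
      ((n + 1) / 2) ^ plusCount δ * (n / 2) ^ (d - plusCount δ) := by
  refine (Finset.sum_eq_sum_iff_of_le fun δ _ => finrank_signSpace_le hf δ).1 ?_ δ
    (Finset.mem_univ δ)
  rw [sum_finrank_signSpace hf, sum_pow_plusCount_mul_pow]
  congr 1
  omega

omit hf in
theorem injective_of_finrank_range_eq {V W : Type*} [AddCommGroup V] [Module K V]
    [FiniteDimensional K V] [AddCommGroup W] [Module K W] (e : V →ₗ[K] W)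
    (he : finrank K (LinearMap.range e) = finrank K V) : Function.Injective e := by
  have hrank := LinearMap.finrank_range_add_finrank_ker e
  rw [he, Nat.add_eq_left] at hrank
  exact LinearMap.ker_eq_bot.1 (Submodule.finrank_eq_zero.1 hrank)

theorem injective_embSign {i : ℕ} (hi : i ≤ d) : Function.Injective (embSign hf n i) := by
  refine injective_of_finrank_range_eq
    (V := TensorSpace K ((n + 1) / 2) i ⊗[K] TensorSpace K (n / 2) (d - i))
    (W := TensorSpace K n d) (embSign hf n i) ?_
  rw [range_embSign hf hi, finrank_signSpace hf, plusCount_initialSign hi, finrank_tensorProduct,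
    finrank_tensorSpace, finrank_tensorSpace]

end Injectivity

section Commutants

open Module

variable {K : Type*} [Field K]

theorem endRight_lift {X M : Type*} [AddCommGroup M] [Module K M] (f : X → End K M)
    {r : FreeAlgebra K X → FreeAlgebra K X → Prop}
    (hr : ∀ ⦃x y⦄, r x y → FreeAlgebra.lift K (fun x => MulOpposite.op (f x)) x =
      FreeAlgebra.lift K (fun x => MulOpposite.op (f x)) y) :
    endRight (RingQuot.liftAlgHom K ⟨FreeAlgebra.lift K fun x => MulOpposite.op (f x), hr⟩) =
      Subalgebra.centralizer K (Set.range f) := by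
  ext φ
  rw [Subalgebra.mem_centralizer_iff, Set.forall_mem_range]
  refine ⟨fun hφ x => LinearMap.ext fun m => ?_, fun hφ a => ?_⟩
  · have hx := hφ (RingQuot.mkAlgHom K r (FreeAlgebra.ι K x)) m
    rw [RingQuot.liftAlgHom_mkAlgHom_apply, FreeAlgebra.lift_ι_apply] at hx
    exact hx.symm
  · obtain ⟨a, rfl⟩ := RingQuot.mkAlgHom_surjective K r a
    rw [RingQuot.liftAlgHom_mkAlgHom_apply]
    induction a using FreeAlgebra.induction with
    | grade0 c => intro m; simp [Module.algebraMap_end_apply]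
    | grade1 x =>
      intro m
      rw [FreeAlgebra.lift_ι_apply]
      exact (LinearMap.congr_fun (hφ x) m).symm
    | mul a b ha hb =>
      intro m
      rw [map_mul, MulOpposite.unop_mul, End.mul_apply, End.mul_apply, hb, ha]
    | add a b ha hb =>
      intro m
      rw [map_add, MulOpposite.unop_add, LinearMap.add_apply, LinearMap.add_apply, map_add, ha, hb]

theorem schurA_eq_centralizer (q : Kˣ) (n d : ℕ) :
    SchurA q n d = Subalgebra.centralizer K (Set.range (opA q n d)) :=
  endRight_lift _ _

theorem schurB_eq_centralizer (q Q : Kˣ) (n d : ℕ) :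
    SchurB q Q n d = Subalgebra.centralizer K (Set.range (opB q Q n d)) :=
  endRight_lift _ _

theorem mem_schurB_iff {q Q : Kˣ} {n d : ℕ} {φ : End K (TensorSpace K n d)} :
    φ ∈ SchurB q Q n d ↔ ∀ j < d, ∀ m, φ (opT q Q n d j m) = opT q Q n d j (φ m) := by
  have hop (j : Fin d) : opT q Q n d j = opB q Q n d j := dif_pos j.2
  rw [schurB_eq_centralizer, Subalgebra.mem_centralizer_iff, Set.forall_mem_range]
  refine ⟨fun hφ j hj m => ?_, fun hφ j => LinearMap.ext fun m => ?_⟩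
  · exact (hop ⟨j, hj⟩ ▸ LinearMap.congr_fun (hφ ⟨j, hj⟩) m).symm
  · exact (hop j ▸ hφ j j.2 m).symm

section TensorProduct

variable {A B : Type*} [Ring A] [Algebra K A] [Ring B] [Algebra K B] {S : Set A} {T : Set B}

theorem mem_range_map_centralizer_val {z : A ⊗[K] B} (hS : ∀ s ∈ S, Commute (s ⊗ₜ 1) z)
    (hT : ∀ t ∈ T, Commute (1 ⊗ₜ t) z) :
    z ∈ (Algebra.TensorProduct.map (Subalgebra.centralizer K S).val
      (Subalgebra.centralizer K T).val).range := by
  have hzS : z ∈ Subalgebra.centralizer K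
      ((Algebra.TensorProduct.includeLeft : A →ₐ[K] A ⊗[K] B) '' S) := by
    rw [Subalgebra.mem_centralizer_iff, Set.forall_mem_image]
    exact hS
  rw [Subalgebra.centralizer_coe_image_includeLeft_eq_center_tensorProduct] at hzS
  obtain ⟨w, rfl⟩ := hzS
  have hinj : Function.Injective (Algebra.TensorProduct.map (Subalgebra.centralizer K S).val
      (AlgHom.id K B)) :=
    Module.Flat.rTensor_preserves_injective_linearMap (M := B)
      (Subalgebra.centralizer K S).val.toLinearMap Subtype.val_injective
  have hwT : w ∈ Subalgebra.centralizer K ((Algebra.TensorProduct.includeRight :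
      B →ₐ[K] Subalgebra.centralizer K S ⊗[K] B) '' T) := by
    rw [Subalgebra.mem_centralizer_iff, Set.forall_mem_image]
    exact fun t ht => hinj (by simpa using (hT t ht).eq)
  rw [Subalgebra.centralizer_coe_image_includeRight_eq_center_tensorProduct] at hwT
  obtain ⟨u, rfl⟩ := hwT
  refine ⟨u, ?_⟩
  change _ = (Algebra.TensorProduct.map (Subalgebra.centralizer K S).val (AlgHom.id K B)).comp
    (Algebra.TensorProduct.map (AlgHom.id K _) (Subalgebra.centralizer K T).val) u
  rw [← Algebra.TensorProduct.map_comp]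
  rfl

theorem commute_map_centralizer_val
    (u : Subalgebra.centralizer K S ⊗[K] Subalgebra.centralizer K T) :
    (∀ s ∈ S, Commute (s ⊗ₜ 1) (Algebra.TensorProduct.map (Subalgebra.centralizer K S).val
      (Subalgebra.centralizer K T).val u)) ∧
    ∀ t ∈ T, Commute (1 ⊗ₜ t) (Algebra.TensorProduct.map (Subalgebra.centralizer K S).val
      (Subalgebra.centralizer K T).val u) := by
  induction u with
  | zero => simp
  | add u w hu hw =>
    rw [map_add]
    exact ⟨fun s hs => (hu.1 s hs).add_right (hw.1 s hs),
      fun t ht => (hu.2 t ht).add_right (hw.2 t ht)⟩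
  | tmul a b =>
    have ha := (Subalgebra.mem_centralizer_iff K).1 a.2
    have hb := (Subalgebra.mem_centralizer_iff K).1 b.2
    constructor
    · intro s hs
      simp [commute_iff_eq, ha s hs]
    · intro t ht
      simp [commute_iff_eq, hb t ht]

theorem mem_range_map_centralizer_val_iff {z : A ⊗[K] B} :
    z ∈ (Algebra.TensorProduct.map (Subalgebra.centralizer K S).val
      (Subalgebra.centralizer K T).val).range ↔
      (∀ s ∈ S, Commute (s ⊗ₜ 1) z) ∧ ∀ t ∈ T, Commute (1 ⊗ₜ t) z := by
  refine ⟨?_, fun hz => mem_range_map_centralizer_val hz.1 hz.2⟩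
  rintro ⟨u, rfl⟩
  exact commute_map_centralizer_val u

end TensorProduct

theorem bijective_endTensorEnd {R M N : Type*} [CommRing R] [AddCommGroup M] [Module R M]
    [Module.Free R M] [Module.Finite R M] [AddCommGroup N] [Module R N] [Module.Free R N]
    [Module.Finite R N] :
    Function.Bijective (endTensorEndAlgHom (R := R) (S := R) (A := R) (M := M) (N := N)) := by
  convert (homTensorHomEquiv R M N M N).bijective using 1
  funext x
  rw [homTensorHomEquiv_apply]
  rfl

variable {M N : Type*} [AddCommGroup M] [Module K M] [AddCommGroup N] [Module K N]

/-- The action of the tensor product `A ⊗ B` of algebras of endomorphisms of `M` and `N` on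
`M ⊗ N`. -/
def tensorEnd (A : Subalgebra K (End K M)) (B : Subalgebra K (End K N)) :
    A ⊗[K] B →ₐ[K] End K (M ⊗[K] N) :=
  (endTensorEndAlgHom (R := K) (S := K) (A := K) (M := M) (N := N)).comp
    (Algebra.TensorProduct.map A.val B.val)

variable [FiniteDimensional K M] [FiniteDimensional K N]

theorem injective_tensorEnd (A : Subalgebra K (End K M)) (B : Subalgebra K (End K N)) :
    Function.Injective (tensorEnd A B) :=
  bijective_endTensorEnd.1.comp (TensorProduct.map_injective_of_flat_flat A.val.toLinearMap
    B.val.toLinearMap Subtype.val_injective Subtype.val_injective)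

theorem mem_range_tensorEnd_iff {S : Set (End K M)} {T : Set (End K N)} {ψ : End K (M ⊗[K] N)} :
    ψ ∈ (tensorEnd (Subalgebra.centralizer K S) (Subalgebra.centralizer K T)).range ↔
      (∀ s ∈ S, TensorProduct.map s LinearMap.id ∘ₗ ψ = ψ ∘ₗ TensorProduct.map s LinearMap.id) ∧
      ∀ t ∈ T, TensorProduct.map LinearMap.id t ∘ₗ ψ = ψ ∘ₗ TensorProduct.map LinearMap.id t := by
  have hbij := bijective_endTensorEnd (R := K) (M := M) (N := N)
  obtain ⟨z, rfl⟩ := hbij.2 ψ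
  rw [tensorEnd, AlgHom.range_comp, Subalgebra.mem_map]
  trans z ∈ (Algebra.TensorProduct.map (Subalgebra.centralizer K S).val
    (Subalgebra.centralizer K T).val).range
  · exact hbij.1.mem_set_image
  rw [mem_range_map_centralizer_val_iff]
  refine and_congr (forall₂_congr fun s _ => ?_) (forall₂_congr fun t _ => ?_)
  · rw [commute_iff_eq, ← hbij.1.eq_iff, map_mul, map_mul]
    rfl
  · rw [commute_iff_eq, ← hbij.1.eq_iff, map_mul, map_mul]
    rfl

end Commutants

section Restriction

open Module

variable {R : Type*} [CommSemiring R]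

theorem exists_restriction {M N : Type*} [AddCommMonoid M] [Module R M] [AddCommMonoid N]
    [Module R N] {e : N →ₗ[R] M} (he : Function.Injective e) {S : Subalgebra R (End R M)}
    (hS : ∀ φ ∈ S, ∀ w, φ (e w) ∈ LinearMap.range e) :
    ∃ ρ : S →ₐ[R] End R N, ∀ φ w, e (ρ φ w) = (φ : End R M) (e w) := by
  let ρ (φ : S) : End R N := (LinearEquiv.ofInjective e he).symm ∘ₗ
    ((φ : End R M) ∘ₗ e).codRestrict (LinearMap.range e) (hS φ φ.2)
  have hρ (φ : S) (w : N) : e (ρ φ w) = (φ : End R M) (e w) :=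
    congrArg Subtype.val ((LinearEquiv.ofInjective e he).apply_symm_apply _)
  refine ⟨AlgHom.ofLinearMap
    { toFun := ρ
      map_add' := fun φ ψ => LinearMap.ext fun w => he (by simp [hρ])
      map_smul' := fun c φ => LinearMap.ext fun w => he (by simp [hρ]) }
    (LinearMap.ext fun w => he ?_) fun φ ψ => LinearMap.ext fun w => he ?_, hρ⟩
  · exact hρ 1 w
  · change e (ρ (φ * ψ) w) = e (ρ φ (ρ ψ w))
    rw [hρ, hρ, hρ]
    rfl

theorem nonempty_algEquiv_pi {ι A : Type*} {B E : ι → Type*} [Semiring A] [Algebra R A]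
    [∀ i, Semiring (B i)] [∀ i, Algebra R (B i)] [∀ i, Semiring (E i)] [∀ i, Algebra R (E i)]
    (ρ : ∀ i, A →ₐ[R] E i) (τ : ∀ i, B i →ₐ[R] E i)
    (hρ : ∀ a a', (∀ i, ρ i a = ρ i a') → a = a') (hτ : ∀ i, Function.Injective (τ i))
    (hle : ∀ a i, ρ i a ∈ (τ i).range) (hge : ∀ b : ∀ i, B i, ∃ a, ∀ i, ρ i a = τ i (b i)) :
    Nonempty (A ≃ₐ[R] ∀ i, B i) := by
  let τ' : (∀ i, B i) →ₐ[R] ∀ i, E i := AlgHom.pi fun i => (τ i).comp (Pi.evalAlgHom R B i)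
  have hρ' : Function.Injective (AlgHom.pi ρ) := fun a a' h => hρ a a' fun i => congrFun h i
  have hτ' : Function.Injective τ' := fun b b' h => funext fun i => hτ i (congrFun h i)
  have hrange : (AlgHom.pi ρ).range = τ'.range := by
    ext ψ
    constructor
    · rintro ⟨a, rfl⟩
      choose b hb using hle a
      exact ⟨b, funext hb⟩
    · rintro ⟨b, rfl⟩
      obtain ⟨a, ha⟩ := hge b
      exact ⟨a, funext ha⟩
  exact ⟨(AlgEquiv.ofInjective _ hρ').trans
    ((Subalgebra.equivOfEq _ _ hrange).trans (AlgEquiv.ofInjective τ' hτ').symm)⟩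

end Restriction

section Decomposition

open Module

variable {K : Type*} [Field K] {q Q : Kˣ} {n d : ℕ} (hf : IsUnit (fB q Q d))
include hf

theorem apply_embSign_mem_range {i : ℕ} (hi : i ≤ d) {φ : End K (TensorSpace K n d)}
    (hφ : φ ∈ SchurB q Q n d)
    (w : TensorSpace K ((n + 1) / 2) i ⊗[K] TensorSpace K (n / 2) (d - i)) :
    φ (embSign hf n i w) ∈ LinearMap.range (embSign hf n i) := by
  rw [range_embSign hf hi]
  exact map_mem_signSpace (mem_schurB_iff.1 hφ) (embSign_mem hf i w)

theorem exists_restriction_embSign (n : ℕ) {i : ℕ} (hi : i ≤ d) :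
    ∃ ρ : SchurB q Q n d →ₐ[K]
        End K (TensorSpace K ((n + 1) / 2) i ⊗[K] TensorSpace K (n / 2) (d - i)),
      ∀ φ w, embSign hf n i (ρ φ w) = (φ : End K (TensorSpace K n d)) (embSign hf n i w) :=
  exists_restriction (injective_embSign hf hi) fun _ hφ => apply_embSign_mem_range hf hi hφ

theorem mem_range_tensorEnd_schurA_iff {i : ℕ} (hi : i ≤ d)
    {ψ : End K (TensorSpace K ((n + 1) / 2) i ⊗[K] TensorSpace K (n / 2) (d - i))} :
    ψ ∈ (tensorEnd (SchurA q ((n + 1) / 2) i) (SchurA q (n / 2) (d - i))).range ↔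
      ∀ k, k + 1 < d → k + 1 ≠ i → ∀ w w', opT q Q n d (k + 1) (embSign hf n i w) =
        embSign hf n i w' → opT q Q n d (k + 1) (embSign hf n i (ψ w)) =
          embSign hf n i (ψ w') := by
  have hinj := injective_embSign (n := n) hf hi
  rw [schurA_eq_centralizer, schurA_eq_centralizer, mem_range_tensorEnd_iff, Set.forall_mem_range,
    Set.forall_mem_range]
  refine ⟨fun ⟨hl, hr⟩ k hk hki w w' hw => ?_, fun h => ⟨fun k => ?_, fun k => ?_⟩⟩
  · rcases lt_or_ge (k + 1) i with hlt | hge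
    · rw [opT_embSign_left hf hi hlt] at hw ⊢
      rw [← hinj hw]
      exact congrArg _ (LinearMap.congr_fun (hl ⟨k, by omega⟩) w)
    · obtain ⟨l, rfl⟩ : ∃ l, k = i + l := ⟨k - i, by omega⟩
      rw [opT_embSign_right hf hk] at hw ⊢
      rw [← hinj hw]
      exact congrArg _ (LinearMap.congr_fun (hr ⟨l, by omega⟩) w)
  · have hk : k.val + 1 < i := by omega
    refine LinearMap.ext fun w => hinj ?_
    have hw := h k (by omega) (by omega) w _ (opT_embSign_left hf hi hk w)
    rwa [opT_embSign_left hf hi hk] at hw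
  · have hk : i + k.val + 1 < d := by omega
    refine LinearMap.ext fun w => hinj ?_
    have hw := h (i + k) hk (by omega) w _ (opT_embSign_right hf hk w)
    rwa [opT_embSign_right hf hk] at hw

theorem eq_of_apply_embSign {φ φ' : End K (TensorSpace K n d)} (hφ : φ ∈ SchurB q Q n d)
    (hφ' : φ' ∈ SchurB q Q n d)
    (heq : ∀ i ≤ d, ∀ w, φ (embSign hf n i w) = φ' (embSign hf n i w)) : φ = φ' := by
  refine isHeckeB_opT.eq_of_eqOn_signSpace hf (mem_schurB_iff.1 hφ) (mem_schurB_iff.1 hφ')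
    fun δ hδ m hm => ?_
  rw [← initialSign_plusCount hδ, ← range_embSign hf (plusCount_le δ)] at hm
  obtain ⟨w, rfl⟩ := hm
  exact heq _ (plusCount_le δ) w

theorem exists_comp_embSign_eq {i : ℕ} (hi : i ≤ d)
    (ψ : End K (TensorSpace K ((n + 1) / 2) i ⊗[K] TensorSpace K (n / 2) (d - i))) :
    ∃ g : End K (TensorSpace K n d), ∀ w, g (embSign hf n i w) = embSign hf n i (ψ w) := by
  obtain ⟨r, hr⟩ := LinearMap.exists_leftInverse_of_injective
    (V := TensorSpace K ((n + 1) / 2) i ⊗[K] TensorSpace K (n / 2) (d - i))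
    (V' := TensorSpace K n d) (embSign hf n i)
    (LinearMap.ker_eq_bot.2 (injective_embSign hf hi))
  exact ⟨embSign hf n i ∘ₗ ψ ∘ₗ r, fun w =>
    congrArg (fun u => embSign hf n i (ψ u)) (LinearMap.congr_fun hr w)⟩

theorem exists_mem_schurB (ψ : (i : Fin (d + 1)) →
      End K (TensorSpace K ((n + 1) / 2) i ⊗[K] TensorSpace K (n / 2) (d - i)))
    (hψ : ∀ i : Fin (d + 1),
      ψ i ∈ (tensorEnd (SchurA q ((n + 1) / 2) i) (SchurA q (n / 2) (d - i))).range) :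
    ∃ φ ∈ SchurB q Q n d,
      ∀ (i : Fin (d + 1)) w, φ (embSign hf n i w) = embSign hf n i (ψ i w) := by
  choose g hg using fun i : Fin (d + 1) => exists_comp_embSign_eq hf (i.is_le) (ψ i)
  let count (δ : Fin d → Bool) : Fin (d + 1) := ⟨plusCount δ, Nat.lt_succ_of_le (plusCount_le δ)⟩
  have hrange {δ : Fin d → Bool} (hδ : Antitone δ) :
      signSpace q Q (opT q Q n d) δ = LinearMap.range (embSign hf n (count δ)) := by
    rw [range_embSign hf (count δ).is_le, initialSign_plusCount hδ]
  have hgmem (δ : Fin d → Bool) (hδ : Antitone δ) : ∀ m ∈ signSpace q Q (opT q Q n d) δ,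
      g (count δ) m ∈ signSpace q Q (opT q Q n d) δ := by
    rw [hrange hδ]
    rintro _ ⟨w, rfl⟩
    exact ⟨_, (hg _ w).symm⟩
  have hgT (δ : Fin d → Bool) (hδ : Antitone δ) (k : ℕ) (hk : k + 1 < d)
      (heq : δ ⟨k, by omega⟩ = δ ⟨k + 1, hk⟩) : ∀ m ∈ signSpace q Q (opT q Q n d) δ,
      g (count δ) (opT q Q n d (k + 1) m) = opT q Q n d (k + 1) (g (count δ) m) := by
    intro m hm
    have hT := isHeckeB_opT.apply_mem_signSpace hf hk heq hm
    rw [hrange hδ] at hm hT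
    obtain ⟨w, rfl⟩ := hm
    obtain ⟨w', hw'⟩ := hT
    rw [← hw', hg, hg]
    exact ((mem_range_tensorEnd_schurA_iff hf (count δ).is_le).1 (hψ _) k hk
      (succ_ne_of_initialSign_eq hk (by rwa [initialSign_plusCount hδ])) w w' hw'.symm).symm
  obtain ⟨φ, hφT, hφ⟩ := isHeckeB_opT.exists_extension hf hgmem hgT
  refine ⟨φ, mem_schurB_iff.2 hφT, fun i w => ?_⟩
  have hi : count (initialSign d i) = i := Fin.ext (plusCount_initialSign i.is_le)
  rw [hφ _ (antitone_initialSign i) _ (embSign_mem hf i w), hi, hg]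

end Decomposition

end QSchur

end

open QSchur

theorem theorem3p1 {K : Type*} [Field K] (q Q : Kˣ) (n d : ℕ)
    (hf : IsUnit (QSchur.fB q Q d)) :
    Nonempty (QSchur.SchurB q Q n d ≃ₐ[K]
      ((i : Fin (d + 1)) →
        QSchur.SchurA q ((n + 1) / 2) (i : ℕ) ⊗[K] QSchur.SchurA q (n / 2) (d - (i : ℕ)))) := by
  choose ρ hρ using fun i : Fin (d + 1) => exists_restriction_embSign hf n i.is_le
  let τ (i : Fin (d + 1)) := tensorEnd (SchurA q ((n + 1) / 2) i) (SchurA q (n / 2) (d - i))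
  refine nonempty_algEquiv_pi ρ τ (fun φ φ' heq => ?_) (fun i => injective_tensorEnd _ _)
    (fun φ i => ?_) fun z => ?_
  · refine Subtype.ext (eq_of_apply_embSign hf φ.2 φ'.2 fun i hi w => ?_)
    have hi' := hρ ⟨i, Nat.lt_succ_of_le hi⟩
    rw [← hi' φ, ← hi' φ', heq]
  · refine (mem_range_tensorEnd_schurA_iff hf i.is_le).2 fun k hk _ w w' hw => ?_
    rw [hρ, hρ, ← hw, mem_schurB_iff.1 φ.2 _ hk]
  · obtain ⟨φ, hφ, hφz⟩ := exists_mem_schurB hf (fun i => τ i (z i)) fun i => ⟨z i, rfl⟩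
    exact ⟨⟨φ, hφ⟩, fun i => LinearMap.ext fun w =>
      injective_embSign hf i.is_le ((hρ i ⟨φ, hφ⟩ w).trans (hφz i w))⟩
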